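/- Let $P\subset\mathbb R^3$ be a regular dodecahedron centred at the origin, and let $G$ be the group of rotations of $\mathbb R^3$ about the origin that carry $P$ onto itself. Identify the unit sphere $S^2$ with the Riemann sphere $\widehat{\mathbb C}=\mathbb C\cup\{\infty\}$ by stereographic projection from the north pole, so that $G$ is regarded as a group of transformations of $\widehat{\mathbb C}$. For a finite set $\alpha\subset S^2$ let $\mathcal A_\alpha$ be the group of all linear fractional transformations $f$ of $\widehat{\mathbb C}$ with $f(\alpha)=\alpha$. Let $V_I$, $F_I$, $E_I\subset S^2$ be the sets of radial projections from the origin to $S^2$ of the vertices of $P$, of the centres of its faces and of the midpoints of its edges, respectively (if $P$ is inscribed in $S^2$, then $V_I$ is its set of vertices). For $X\in S^2\setminus(V_I\cup F_I\cup E_I)$ let $B_I(X)$ be the $G$-orbit of $X$. Then: 1. $G\cong A_5$. 2. $V_I$, $F_I$, $E_I$ are $G$-orbits, with $|V_I|=20$, $|F_I|=12$, $|E_I|=30$. For every $X\in S^2\setminus(V_I\cup F_I\cup E_I)$, no non-identity element of $G$ fixes $X$, and $|B_I(X)|=60$. 3. For every non-empty finite subset $\alpha$ of $S^2$, $\mathcal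 A_\alpha=G$ if and only if $\alpha$ is a union of members of $$\{V_I,F_I,E_I\}\cup\{B_I(X) : X\in S^2\setminus(V_I\cup F_I\cup E_I)\}.$$ -/

import Mathlib

open scoped Pointwise

noncomputable section

/-- Euclidean three-space. -/
abbrev E3 : Type := EuclideanSpace ℝ (Fin 3)

/-- The unit sphere `S²` centred at the origin. -/
abbrev S2 : Type := Metric.sphere (0 : E3) 1

theorem S2.sq_sum (X : S2) : X.1 0 ^ 2 + X.1 1 ^ 2 + X.1 2 ^ 2 = 1 := by
  have h : ‖X.1‖ = 1 := by simpa using X.2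
  have h2 := EuclideanSpace.real_norm_sq_eq X.1
  rw [h, Fin.sum_univ_three] at h2
  linarith

/-- The point of `S²` with prescribed coordinates. -/
def S2.mk (a b c : ℝ) (h : a ^ 2 + b ^ 2 + c ^ 2 = 1) : S2 :=
  ⟨!₂[a, b, c], by
    have h2 := EuclideanSpace.real_norm_sq_eq (!₂[a, b, c] : E3)
    rw [Fin.sum_univ_three] at h2
    have h3 : ‖(!₂[a, b, c] : E3)‖ ^ 2 = 1 := by rw [h2]; simp [h]
    rw [mem_sphere_zero_iff_norm]
    nlinarith [norm_nonneg (!₂[a, b, c] : E3)]⟩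

theorem S2.ext_coord {X Y : S2} (h0 : X.1 0 = Y.1 0) (h1 : X.1 1 = Y.1 1)
    (h2 : X.1 2 = Y.1 2) : X = Y := by
  apply Subtype.ext
  ext i
  fin_cases i
  · exact h0
  · exact h1
  · exact h2

/-- Inverse stereographic projection from the north pole: `∞ ↦ (0,0,1)` and
`z ↦ (2 Re z, 2 Im z, |z|² - 1) / (|z|² + 1)`. -/
def invStereo : OnePoint ℂ → S2
  | none => S2.mk 0 0 1 (by norm_num)
  | some z => S2.mk (2 * z.re / (Complex.normSq z + 1)) (2 * z.im / (Complex.normSq z + 1))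
      ((Complex.normSq z - 1) / (Complex.normSq z + 1)) (by
        have h : Complex.normSq z + 1 ≠ 0 := by
          have := Complex.normSq_nonneg z
          positivity
        field_simp
        rw [Complex.normSq_apply]
        ring)

open Classical in
/-- Stereographic projection from the north pole `(0,0,1)` onto the equatorial plane, as a
bijection of `S²` with the Riemann sphere `ℂ ∪ {∞}`: `(x, y, t) ↦ (x + i y) / (1 - t)`. -/
def stereo : S2 ≃ OnePoint ℂ where
  toFun X := if X.1 2 = 1 then OnePoint.infty
    else ((⟨X.1 0 / (1 - X.1 2), X.1 1 / (1 - X.1 2)⟩ : ℂ) : OnePoint ℂ)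
  invFun := invStereo
  left_inv X := by
    have hs := X.sq_sum
    by_cases h : X.1 2 = 1
    · simp only [h, if_true]
      have h0 : X.1 0 = 0 := by rw [h] at hs; nlinarith [sq_nonneg (X.1 0), sq_nonneg (X.1 1)]
      have h1 : X.1 1 = 0 := by rw [h] at hs; nlinarith [sq_nonneg (X.1 0), sq_nonneg (X.1 1)]
      apply S2.ext_coord
      · rw [h0]; rfl
      · rw [h1]; rfl
      · rw [h]; rfl
    · simp only [h, if_false]
      have hd : 1 - X.1 2 ≠ 0 := fun h' => h (by linarith)
      have key : Complex.normSq ⟨X.1 0 / (1 - X.1 2), X.1 1 / (1 - X.1 2)⟩ + 1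
          = 2 / (1 - X.1 2) := by
        rw [Complex.normSq_apply]
        field_simp
        nlinarith
      have key' : Complex.normSq ⟨X.1 0 / (1 - X.1 2), X.1 1 / (1 - X.1 2)⟩ - 1
          = 2 * X.1 2 / (1 - X.1 2) := by
        have : 2 * X.1 2 / (1 - X.1 2) = 2 / (1 - X.1 2) - 2 := by field_simp; ring
        rw [this, ← key]; ring
      apply S2.ext_coord
      · change 2 * (X.1 0 / (1 - X.1 2)) / (Complex.normSq _ + 1) = _
        rw [key]; field_simp
      · change 2 * (X.1 1 / (1 - X.1 2)) / (Complex.normSq _ + 1) = _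
        rw [key]; field_simp
      · change (Complex.normSq _ - 1) / (Complex.normSq _ + 1) = _
        rw [key, key']; field_simp
  right_inv z := by
    induction z using OnePoint.rec with
    | infty =>
      have : (invStereo OnePoint.infty).1 2 = 1 := rfl
      simp [this]
    | coe z =>
      have hp : Complex.normSq z + 1 ≠ 0 := by
        have := Complex.normSq_nonneg z
        positivity
      have e0 : (invStereo (z : OnePoint ℂ)).1 0 = 2 * z.re / (Complex.normSq z + 1) := rfl
      have e1 : (invStereo (z : OnePoint ℂ)).1 1 = 2 * z.im / (Complex.normSq z + 1) := rfl
      have e2 : (invStereo (z : OnePoint ℂ)).1 2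
          = (Complex.normSq z - 1) / (Complex.normSq z + 1) := rfl
      have e3 : 1 - (invStereo (z : OnePoint ℂ)).1 2 = 2 / (Complex.normSq z + 1) := by
        rw [e2]; field_simp; ring
      have h : (invStereo (z : OnePoint ℂ)).1 2 ≠ 1 := by
        intro h
        rw [h, sub_self, eq_comm, div_eq_zero_iff] at e3
        rcases e3 with h | h
        · norm_num at h
        · exact hp h
      simp only [h, if_false]
      rw [e3, e0, e1]
      congr 1
      apply Complex.ext
      · change 2 * z.re / (Complex.normSq z + 1) / (2 / (Complex.normSq z + 1)) = z.re
        field_simp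
      · change 2 * z.im / (Complex.normSq z + 1) / (2 / (Complex.normSq z + 1)) = z.im
        field_simp

open Classical in
/-- The group of linear fractional transformations `z ↦ (a z + b) / (c z + d)`, `a d - b c ≠ 0`,
of the Riemann sphere, as a group of permutations. -/
def linearFractionalGroup : Subgroup (Equiv.Perm (OnePoint ℂ)) :=
  (MulAction.toPermHom (GL (Fin 2) ℂ) (OnePoint ℂ)).range

/-- The group of linear fractional transformations `f` with `f(α) = α`. The points of `α ⊆ S²`
are regarded as points of the Riemann sphere through the stereographic projection. -/
def setStabilizer (α : Set S2) : Subgroup (Equiv.Perm (OnePoint ℂ)) :=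
  linearFractionalGroup ⊓ MulAction.stabilizer (Equiv.Perm (OnePoint ℂ)) (stereo '' α)

/-- The vertices `(±1, ±1, ±1)`, `(0, ±φ⁻¹, ±φ)`, `(±φ⁻¹, ±φ, 0)`, `(±φ, 0, ±φ⁻¹)` of the
standard regular dodecahedron, `φ` being the golden ratio. -/
def stdDodecahedronVertices : Set E3 :=
  {x | (|x 0| = 1 ∧ |x 1| = 1 ∧ |x 2| = 1) ∨
    (x 0 = 0 ∧ |x 1| = Real.goldenRatio⁻¹ ∧ |x 2| = Real.goldenRatio) ∨
    (|x 0| = Real.goldenRatio⁻¹ ∧ |x 1| = Real.goldenRatio ∧ x 2 = 0) ∨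
    (|x 0| = Real.goldenRatio ∧ x 1 = 0 ∧ |x 2| = Real.goldenRatio⁻¹)}

/-- `P` is a (solid) regular dodecahedron centred at the origin: the image of the standard one
under an orthogonal map followed by a dilation. -/
def IsRegularDodecahedron (P : Set E3) : Prop :=
  ∃ (r : ℝ) (L : E3 ≃ₗᵢ[ℝ] E3), 0 < r ∧
    P = (fun x => r • L x) '' convexHull ℝ stdDodecahedronVertices

/-- The point `X ∈ S²` is the projection of `p ≠ 0` from the origin. -/
def IsRadialProjection (X : S2) (p : E3) : Prop :=
  X.1 = ‖p‖⁻¹ • p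

/-- The vertices of `P`, projected to `S²` from the origin (for `P` inscribed in `S²`, these are
the vertices themselves). -/
def vertexPoints (P : Set E3) : Set S2 :=
  {X | ∃ v ∈ P.extremePoints ℝ, IsRadialProjection X v}

/-- A two-dimensional face of the convex body `P`. -/
def IsTwoFace (P F : Set E3) : Prop :=
  IsExposed ℝ P F ∧ Module.finrank ℝ (vectorSpan ℝ F) = 2

/-- `c` is the centre of the polygon `F`: the point of `F` equidistant from all its vertices. -/
def IsFaceCentre (F : Set E3) (c : E3) : Prop :=
  c ∈ F ∧ ∃ ρ : ℝ, ∀ v ∈ F.extremePoints ℝ, dist v c = ρ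

/-- The centres of the faces of `P`, projected to `S²` from the origin. -/
def facePoints (P : Set E3) : Set S2 :=
  {X | ∃ F c, IsTwoFace P F ∧ IsFaceCentre F c ∧ IsRadialProjection X c}

/-- The segment from `u` to `v` is an edge (one-dimensional face) of the convex body `P`. -/
def IsEdge (P : Set E3) (u v : E3) : Prop :=
  u ≠ v ∧ IsExposed ℝ P (segment ℝ u v)

/-- The midpoints of the edges of `P`, projected to `S²` from the origin. -/
def edgePoints (P : Set E3) : Set S2 :=
  {X | ∃ u v, IsEdge P u v ∧ IsRadialProjection X (midpoint ℝ u v)}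

/-- The rotations of three-space about the origin that carry `P` onto itself. -/
def rotationGroup (P : Set E3) : Subgroup (E3 ≃ₗᵢ[ℝ] E3) where
  carrier := {g | LinearMap.det (g.toLinearEquiv : E3 →ₗ[ℝ] E3) = 1 ∧ g '' P = P}
  one_mem' := by
    refine ⟨?_, ?_⟩
    · exact LinearMap.det_id
    · exact Set.image_id P
  mul_mem' := by
    rintro a b ⟨ha, ha'⟩ ⟨hb, hb'⟩
    refine ⟨?_, ?_⟩
    · have := LinearMap.det_comp (a.toLinearEquiv : E3 →ₗ[ℝ] E3) (b.toLinearEquiv : E3 →ₗ[ℝ] E3)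
      rw [ha, hb, one_mul] at this
      exact this
    · have : (fun x => a (b x)) '' P = P := by
        rw [← Set.image_image (fun x => a x) (fun x => b x) P, hb', ha']
      exact this
  inv_mem' := by
    rintro a ⟨ha, ha'⟩
    refine ⟨?_, ?_⟩
    · have := LinearMap.det_comp (a.toLinearEquiv : E3 →ₗ[ℝ] E3)
        (a.symm.toLinearEquiv : E3 →ₗ[ℝ] E3)
      have h2 : (a.toLinearEquiv : E3 →ₗ[ℝ] E3) ∘ₗ (a.symm.toLinearEquiv : E3 →ₗ[ℝ] E3)
          = LinearMap.id := by
        ext x : 1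
        exact a.apply_symm_apply x
      rw [h2, ha, one_mul, LinearMap.det_id] at this
      exact this.symm
    · have : a.symm '' P = P := by
        conv_lhs => rw [← ha']
        rw [Set.image_image]
        simp
      exact this

/-- Linear isometries act on `S²`. -/
def onSphere : (E3 ≃ₗᵢ[ℝ] E3) →* Equiv.Perm S2 where
  toFun g :=
    { toFun := fun X => ⟨g X.1, by simp⟩
      invFun := fun X => ⟨g.symm X.1, by simp⟩
      left_inv := fun X => by simp
      right_inv := fun X => by simp }
  map_one' := rfl
  map_mul' _ _ := rfl

/-- The rotations of `P`, regarded as transformations of the Riemann sphere through the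
stereographic projection. -/
def rotationGroupOnRiemannSphere (P : Set E3) : Subgroup (Equiv.Perm (OnePoint ℂ)) :=
  (rotationGroup P).map (stereo.permCongrHom.toMonoidHom.comp onSphere)

/-- The orbit of `X ∈ S²` under the rotations of `P`. -/
def rotationOrbit (P : Set E3) (X : S2) : Set S2 :=
  {Y | ∃ g ∈ rotationGroup P, onSphere g X = Y}

end

/-! A dilation changes nothing on the sphere, and an orthogonal map of determinant -1 may be
composed with -1, which preserves the dodecahedron. So `P` may be replaced by the standard
dodecahedron moved by a rotation `L`; since `L` acts on the Riemann sphere as a linear fractional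
transformation, conjugation by `L` reduces every claim to the standard solid.

There all coordinates lie in ℤ[φ], and rotations are written `v ↦ q v q̄` with unit quaternions `q`.
The rotations of the solid are the 60 pairs `±q` of icosian units: these are transitive on directed
edges, and a rotation is determined by the images of two independent vectors
(`mem_rotationGroup_std`). Finite facts about vertices, faces, edges and icosians are decided by
exact computation. The fifteen axes through edge midpoints form five orthogonal frames; the
stabilizer of one frame has index 5 and trivial core, which embeds the group in `S₅` with index 2.
Faces and edges are determined from convexity by studying the corner at one vertex. Every axis of a
nontrivial icosian passes through vertices, face centres or edge midpoints, so all other points of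
the sphere have trivial stabilizer.

For the third claim, being a union of orbits means being invariant under `G`. Let `α` be finite,
nonempty and invariant. It has at least twelve points, so its stabilizer `H` is finite. Averaging
gives an `H`-invariant Hermitian form; the half-turns in `G` force this form to be scalar, so `H`
consists of rotations (`exists_quaternion_of_mem_finite`). It remains to see that `G` is maximal
among finite rotation groups (`rotIso_mem_of_finite`). A commutator argument shows that a finite
group containing `G` has no nontrivial element of small angle. For `h` in this group, the conjugate
by `h` of a fifth-turn about a face axis is close to the fifth-turn about a nearby face axis, hence
equal to it. So `h` permutes the face normals and belongs to `G`. -/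

noncomputable section

open scoped Quaternion

/-! ### Exact arithmetic in ℤ[φ] -/

/-- Elements `a + b φ` of the ring `ℤ[φ]`, `φ` the golden ratio. -/
structure ZPhi where
  a : ℤ
  b : ℤ
  deriving DecidableEq

namespace ZPhi

instance : Add ZPhi := ⟨fun x y => ⟨x.a + y.a, x.b + y.b⟩⟩
instance : Sub ZPhi := ⟨fun x y => ⟨x.a - y.a, x.b - y.b⟩⟩
instance : Neg ZPhi := ⟨fun x => ⟨-x.a, -x.b⟩⟩
-- The formula encodes `φ² = φ + 1`.
instance : Mul ZPhi := ⟨fun x y => ⟨x.a * y.a + x.b * y.b, x.a * y.b + x.b * y.a + x.b * y.b⟩⟩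
instance (n : ℕ) : OfNat ZPhi n := ⟨⟨n, 0⟩⟩

/-- The golden ratio `φ`. -/
def phi : ZPhi := ⟨0, 1⟩

/-- The inverse `φ - 1` of the golden ratio. -/
def psi : ZPhi := ⟨-1, 1⟩

/-- The embedding of `ℤ[φ]` into `ℝ`. -/
def toReal (x : ZPhi) : ℝ := x.a + x.b * Real.goldenRatio

theorem toReal_add (x y : ZPhi) : (x + y).toReal = x.toReal + y.toReal := by
  change ((x.a + y.a : ℤ) : ℝ) + ((x.b + y.b : ℤ) : ℝ) * _ = _
  simp only [toReal]; push_cast; ring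

theorem toReal_sub (x y : ZPhi) : (x - y).toReal = x.toReal - y.toReal := by
  change ((x.a - y.a : ℤ) : ℝ) + ((x.b - y.b : ℤ) : ℝ) * _ = _
  simp only [toReal]; push_cast; ring

theorem toReal_neg (x : ZPhi) : (-x).toReal = -x.toReal := by
  change ((-x.a : ℤ) : ℝ) + ((-x.b : ℤ) : ℝ) * _ = _
  simp only [toReal]; push_cast; ring

theorem toReal_mul (x y : ZPhi) : (x * y).toReal = x.toReal * y.toReal := by
  change ((x.a * y.a + x.b * y.b : ℤ) : ℝ)
    + ((x.a * y.b + x.b * y.a + x.b * y.b : ℤ) : ℝ) * _ = _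
  simp only [toReal]; push_cast
  linear_combination (-(x.b * y.b : ℝ)) * Real.goldenRatio_sq

theorem toReal_ofNat (n : ℕ) : (OfNat.ofNat n : ZPhi).toReal = n := by
  change (((n : ℕ) : ℤ) : ℝ) + ((0 : ℤ) : ℝ) * _ = _
  simp

theorem toReal_zero : (0 : ZPhi).toReal = 0 := by simpa using toReal_ofNat 0
theorem toReal_one : (1 : ZPhi).toReal = 1 := by simpa using toReal_ofNat 1
theorem toReal_two : (2 : ZPhi).toReal = 2 := by simpa using toReal_ofNat 2
theorem toReal_three : (3 : ZPhi).toReal = 3 := by simpa using toReal_ofNat 3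
theorem toReal_four : (4 : ZPhi).toReal = 4 := by simpa using toReal_ofNat 4

theorem toReal_phi : phi.toReal = Real.goldenRatio := by simp [phi, toReal]

theorem toReal_psi : psi.toReal = Real.goldenRatio⁻¹ := by
  rw [Real.inv_goldenRatio, psi, toReal]
  have := Real.goldenRatio_add_goldenConj
  push_cast; linarith

/-- Irrationality of `φ` makes the two integer coordinates unique. Equalities between real
coordinates can thus be pulled back to ℤ[φ], where they are decidable. -/
theorem toReal_injective : Function.Injective toReal := by
  intro x y h
  have h1 : ((x.a - y.a : ℤ) : ℝ) = ((y.b - x.b : ℤ) : ℝ) * Real.goldenRatio := by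
    simp only [toReal] at h; push_cast; linarith
  have hb : y.b - x.b = 0 := by
    by_contra hb
    have h2 := (Real.goldenRatio_irrational.intCast_mul hb)
    rw [← h1] at h2
    exact (Int.not_irrational _) h2
  rw [hb] at h1
  have ha : x.a - y.a = 0 := by exact_mod_cast (by simpa using h1 : ((x.a - y.a : ℤ) : ℝ) = 0)
  cases x; cases y
  simp only [mk.injEq] at *
  omega

end ZPhi

open ZPhi

/-! ### Vectors, quaternions and icosians over ℤ[φ] -/

/-- Vectors with coordinates in `ℤ[φ]`. -/
structure ZVec where
  x : ZPhi
  y : ZPhi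
  z : ZPhi
  deriving DecidableEq

/-- Quaternions with coordinates in `ℤ[φ]`. -/
structure ZQuat where
  r : ZPhi
  v : ZVec
  deriving DecidableEq

namespace ZVec

/-- The inner product. -/
def dot (u v : ZVec) : ZPhi := u.x * v.x + u.y * v.y + u.z * v.z

/-- Multiplication by a scalar. -/
def scale (c : ZPhi) (v : ZVec) : ZVec := ⟨c * v.x, c * v.y, c * v.z⟩

/-- The cross product. -/
def cross (u v : ZVec) : ZVec :=
  ⟨u.y * v.z - u.z * v.y, u.z * v.x - u.x * v.z, u.x * v.y - u.y * v.x⟩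

/-- The cyclic permutations of the coordinates. -/
def cyc (v : ZVec) : List ZVec := [v, ⟨v.y, v.z, v.x⟩, ⟨v.z, v.x, v.y⟩]

/-- The vectors obtained by arbitrary changes of sign of the coordinates. -/
def signs (v : ZVec) : List ZVec :=
  [⟨v.x, v.y, v.z⟩, ⟨v.x, v.y, -v.z⟩, ⟨v.x, -v.y, v.z⟩, ⟨v.x, -v.y, -v.z⟩,
    ⟨-v.x, v.y, v.z⟩, ⟨-v.x, v.y, -v.z⟩, ⟨-v.x, -v.y, v.z⟩, ⟨-v.x, -v.y, -v.z⟩].dedup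

end ZVec

open ZVec

/-- The vertices of the standard dodecahedron. -/
def vertexList : List ZVec := signs ⟨1, 1, 1⟩ ++ (cyc ⟨0, psi, phi⟩).flatMap signs

/-- Multiples of the centres of the faces. -/
def faceList : List ZVec := (cyc ⟨1, 0, phi⟩).flatMap signs

/-- Multiples of the midpoints of the edges. -/
def edgeList : List ZVec := (cyc ⟨2, 0, 0⟩).flatMap signs ++ (cyc ⟨psi, 1, phi⟩).flatMap signs

/-- The doubles of the icosian units, one from each pair `±q`. -/
def icosianList : List ZQuat :=
  ⟨2, ⟨0, 0, 0⟩⟩ :: ([⟨2, 0, 0⟩, ⟨0, 2, 0⟩, ⟨0, 0, 2⟩].map (ZQuat.mk 0)) ++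
  (signs ⟨1, 1, 1⟩).map (ZQuat.mk 1) ++
  ((cyc ⟨0, psi, phi⟩).flatMap signs).map (ZQuat.mk 1) ++
  ((cyc ⟨psi, 0, 1⟩).flatMap signs).map (ZQuat.mk phi) ++
  ((cyc ⟨1, 0, phi⟩).flatMap signs).map (ZQuat.mk psi) ++
  [⟨psi, 1, phi⟩, ⟨psi, 1, -phi⟩, ⟨psi, -1, phi⟩, ⟨psi, -1, -phi⟩].flatMap
    (fun v => (cyc v).map (ZQuat.mk 0))

/-- The action of a quaternion on a vector, `v ↦ q v q̄`. -/
def ZQuat.act (q : ZQuat) (v : ZVec) : ZVec :=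
  let a := q.r
  let b := q.v.x
  let c := q.v.y
  let d := q.v.z
  ⟨(a * a + b * b - c * c - d * d) * v.x + 2 * (b * c - a * d) * v.y + 2 * (b * d + a * c) * v.z,
   2 * (b * c + a * d) * v.x + (a * a - b * b + c * c - d * d) * v.y + 2 * (c * d - a * b) * v.z,
   2 * (b * d - a * c) * v.x + 2 * (c * d + a * b) * v.y + (a * a - b * b - c * c + d * d) * v.z⟩

/-- The reference vertex. -/
def vertex₀ : ZVec := ⟨1, 1, 1⟩
/-- A neighbour of the reference vertex. -/
def vertex₁ : ZVec := ⟨0, psi, phi⟩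
/-- The reference face. -/
def face₀ : ZVec := ⟨1, 0, phi⟩
/-- A neighbour of the reference face. -/
def face₁ : ZVec := ⟨-1, 0, phi⟩
/-- The reference edge, from `vertex₀` to `vertex₁`. -/
def edge₀ : ZVec := ⟨psi, 1, phi⟩

/-! ### Finite facts about the icosians, decided by computation -/

theorem norm_icosian : ∀ q ∈ icosianList, q.r * q.r + dot q.v q.v = 4 := by decide +kernel

theorem icosian_act_vertex : ∀ q ∈ icosianList, ∀ v ∈ vertexList,
    ∃ w ∈ vertexList, q.act v = scale 4 w := by decide +kernel

/-- The inner product `2φ - 1 = √5` characterizes neighbouring vertices, so this is transitivity on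
directed edges. It shows that no rotation of the solid is missing from the list. -/
theorem icosian_vertex_pair : ∀ v ∈ vertexList, ∀ w ∈ vertexList, dot v w = 2 * phi - 1 →
    ∃ q ∈ icosianList, q.act vertex₀ = scale 4 v ∧ q.act vertex₁ = scale 4 w := by decide +kernel

/-- The normals of adjacent faces have inner product `φ`. This version serves for rotations only
known to permute the face normals. -/
theorem icosian_face_pair : ∀ v ∈ faceList, ∀ w ∈ faceList, dot v w = phi →
    ∃ q ∈ icosianList, q.act face₀ = scale 4 v ∧ q.act face₁ = scale 4 w := by decide +kernel

/-- Distinct listed quaternions give rotations that already differ on one directed edge. -/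
theorem icosian_pair_nodup :
    (icosianList.map fun q => (q.act vertex₀, q.act vertex₁)).Nodup := by decide +kernel

theorem icosian_act_vertex₀ : ∀ q ∈ icosianList, ∃ w ∈ vertexList, q.act vertex₀ = scale 4 w := by
  decide +kernel
theorem exists_icosian_act_vertex₀ : ∀ w ∈ vertexList, ∃ q ∈ icosianList,
    q.act vertex₀ = scale 4 w := by
  decide +kernel
theorem icosian_act_face₀ : ∀ q ∈ icosianList, ∃ w ∈ faceList, q.act face₀ = scale 4 w := by
  decide +kernel
theorem exists_icosian_act_face₀ : ∀ w ∈ faceList, ∃ q ∈ icosianList,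
    q.act face₀ = scale 4 w := by
  decide +kernel
theorem icosian_act_edge₀ : ∀ q ∈ icosianList, ∃ w ∈ edgeList, q.act edge₀ = scale 4 w := by
  decide +kernel
theorem exists_icosian_act_edge₀ : ∀ w ∈ edgeList, ∃ q ∈ icosianList,
    q.act edge₀ = scale 4 w := by
  decide +kernel

theorem icosian_axis : ∀ q ∈ icosianList, q = ⟨2, ⟨0, 0, 0⟩⟩ ∨
    (q.v ≠ ⟨0, 0, 0⟩ ∧ ∃ p ∈ vertexList ++ faceList ++ edgeList, cross q.v p = ⟨0, 0, 0⟩) := by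
  decide +kernel

/-- `q.act` carries a factor 4 and `dot p p = 4`, so the three values say that the image of `p` is
perpendicular to `p` or equal to `±p`, as happens when every orthogonal frame of edge axes is
preserved. -/
theorem icosian_core : ∀ q ∈ icosianList, (∀ p ∈ edgeList,
    dot p (q.act p) = 0 ∨ dot p (q.act p) = 16 ∨ dot p (q.act p) = -16) →
    q = ⟨2, ⟨0, 0, 0⟩⟩ := by decide +kernel

theorem lengths : vertexList.length = 20 ∧ faceList.length = 12 ∧ edgeList.length = 30 ∧
  icosianList.length = 60 := by decide +kernel
theorem nodups : vertexList.Nodup ∧ faceList.Nodup ∧ edgeList.Nodup := by decide +kernel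
/-! ### Vector algebra in Euclidean three-space -/

theorem E3.ext {u v : E3} (h0 : u 0 = v 0) (h1 : u 1 = v 1) (h2 : u 2 = v 2) : u = v := by
  ext i
  fin_cases i
  exacts [h0, h1, h2]

theorem E3.inner_eq (u v : E3) : inner ℝ u v = u 0 * v 0 + u 1 * v 1 + u 2 * v 2 := by
  simp [PiLp.inner_apply, Fin.sum_univ_three]; ring

theorem E3.norm_sq (u : E3) : ‖u‖ ^ 2 = u 0 ^ 2 + u 1 ^ 2 + u 2 ^ 2 := by
  rw [EuclideanSpace.real_norm_sq_eq, Fin.sum_univ_three]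

/-- The vector with given coordinates. -/
def vec3 (a b c : ℝ) : E3 := !₂[a, b, c]

theorem vec3_zero (a b c : ℝ) : vec3 a b c 0 = a := rfl
theorem vec3_one (a b c : ℝ) : vec3 a b c 1 = b := rfl
theorem vec3_two (a b c : ℝ) : vec3 a b c 2 = c := rfl

/-- The cross product. -/
def E3.cross (u v : E3) : E3 :=
  vec3 (u 1 * v 2 - u 2 * v 1) (u 2 * v 0 - u 0 * v 2) (u 0 * v 1 - u 1 * v 0)

theorem E3.cross_zero (u v : E3) : E3.cross u v 0 = u 1 * v 2 - u 2 * v 1 := rfl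
theorem E3.cross_one (u v : E3) : E3.cross u v 1 = u 2 * v 0 - u 0 * v 2 := rfl
theorem E3.cross_two (u v : E3) : E3.cross u v 2 = u 0 * v 1 - u 1 * v 0 := rfl

theorem E3.det_mul_triple (f : E3 →ₗ[ℝ] E3) (u v w : E3) :
    inner ℝ (E3.cross (f u) (f v)) (f w) = LinearMap.det f * inner ℝ (E3.cross u v) w := by
  obtain ⟨M, rfl⟩ := (Matrix.toLpLin 2 2 : Matrix (Fin 3) (Fin 3) ℝ ≃ₗ[ℝ] _).surjective f
  rw [LinearMap.det_toLpLin, Matrix.det_fin_three]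
  simp only [E3.inner_eq, E3.cross_zero, E3.cross_one, E3.cross_two, Matrix.ofLp_toLpLin,
    Matrix.toLin'_apply, Matrix.mulVec, dotProduct, Fin.sum_univ_three]
  ring

/-- Rotations preserve the cross product. -/
theorem E3.map_cross (g : E3 ≃ₗᵢ[ℝ] E3)
    (hg : LinearMap.det (g.toLinearEquiv : E3 →ₗ[ℝ] E3) = 1) (u v : E3) :
    g (E3.cross u v) = E3.cross (g u) (g v) := by
  refine ext_inner_right ℝ fun w => ?_
  obtain ⟨w, rfl⟩ := g.surjective w
  have := E3.det_mul_triple (g.toLinearEquiv : E3 →ₗ[ℝ] E3) u v w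
  rw [hg, one_mul] at this
  rw [g.inner_map_map]
  exact this.symm

/-- A rotation is determined by the images of two linearly independent vectors. -/
theorem E3.rotation_ext {g h : E3 ≃ₗᵢ[ℝ] E3}
    (hg : LinearMap.det (g.toLinearEquiv : E3 →ₗ[ℝ] E3) = 1)
    (hh : LinearMap.det (h.toLinearEquiv : E3 →ₗ[ℝ] E3) = 1) {u v : E3}
    (huv : E3.cross u v ≠ 0) (hu : g u = h u) (hv : g v = h v) : g = h := by
  have hc : g (E3.cross u v) = h (E3.cross u v) := by
    rw [E3.map_cross g hg, E3.map_cross h hh, hu, hv]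
  ext1 x
  -- Expansion of `x` in the basis `u`, `v`, `u × v`, with the denominator `‖u × v‖²` cleared.
  have key : (‖E3.cross u v‖ ^ 2) • x = inner ℝ (E3.cross v (E3.cross u v)) x • u
      + inner ℝ (E3.cross (E3.cross u v) u) x • v + inner ℝ (E3.cross u v) x • E3.cross u v := by
    apply E3.ext <;>
    simp only [E3.norm_sq, E3.inner_eq, PiLp.add_apply, PiLp.smul_apply, smul_eq_mul,
      E3.cross_zero, E3.cross_one, E3.cross_two] <;> ring
  have h2 : (‖E3.cross u v‖ ^ 2) • g x = (‖E3.cross u v‖ ^ 2) • h x := by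
    rw [← map_smul, ← map_smul, key]
    simp only [map_add, map_smul, hu, hv, hc]
  exact smul_right_injective _ (pow_ne_zero 2 (norm_ne_zero_iff.2 huv)) h2

/-! ### Quaternions and rotations -/

/-- The matrix of `v ↦ q v q̄`. -/
def rotMatrix (q : ℍ[ℝ]) : Matrix (Fin 3) (Fin 3) ℝ :=
  !![q.re * q.re + q.imI * q.imI - q.imJ * q.imJ - q.imK * q.imK,
      2 * (q.imI * q.imJ - q.re * q.imK), 2 * (q.imI * q.imK + q.re * q.imJ);
    2 * (q.imI * q.imJ + q.re * q.imK),
      q.re * q.re - q.imI * q.imI + q.imJ * q.imJ - q.imK * q.imK,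
      2 * (q.imJ * q.imK - q.re * q.imI);
    2 * (q.imI * q.imK - q.re * q.imJ), 2 * (q.imJ * q.imK + q.re * q.imI),
      q.re * q.re - q.imI * q.imI - q.imJ * q.imJ + q.imK * q.imK]

/-- The linear map `v ↦ q v q̄` of three-space. -/
def rot (q : ℍ[ℝ]) : E3 →ₗ[ℝ] E3 := Matrix.toLpLin 2 2 (rotMatrix q)

theorem rot_apply_zero (q : ℍ[ℝ]) (v : E3) : rot q v 0 =
    (q.re * q.re + q.imI * q.imI - q.imJ * q.imJ - q.imK * q.imK) * v 0 +
      2 * (q.imI * q.imJ - q.re * q.imK) * v 1 + 2 * (q.imI * q.imK + q.re * q.imJ) * v 2 := by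
  simp [rot, rotMatrix, Matrix.mulVec, dotProduct, Fin.sum_univ_three]

theorem rot_apply_one (q : ℍ[ℝ]) (v : E3) : rot q v 1 =
    2 * (q.imI * q.imJ + q.re * q.imK) * v 0 +
      (q.re * q.re - q.imI * q.imI + q.imJ * q.imJ - q.imK * q.imK) * v 1 +
      2 * (q.imJ * q.imK - q.re * q.imI) * v 2 := by
  simp [rot, rotMatrix, Matrix.mulVec, dotProduct, Fin.sum_univ_three]

theorem rot_apply_two (q : ℍ[ℝ]) (v : E3) : rot q v 2 =
    2 * (q.imI * q.imK - q.re * q.imJ) * v 0 + 2 * (q.imJ * q.imK + q.re * q.imI) * v 1 +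
      (q.re * q.re - q.imI * q.imI - q.imJ * q.imJ + q.imK * q.imK) * v 2 := by
  simp [rot, rotMatrix, Matrix.mulVec, dotProduct, Fin.sum_univ_three]

theorem rot_one_apply (v : E3) : rot 1 v = v := by
  apply E3.ext <;> simp [rot_apply_zero, rot_apply_one, rot_apply_two]

theorem rot_mul_apply (p q : ℍ[ℝ]) (v : E3) : rot (p * q) v = rot p (rot q v) := by
  apply E3.ext <;> simp only [rot_apply_zero, rot_apply_one, rot_apply_two, Quaternion.re_mul,
    Quaternion.imI_mul, Quaternion.imJ_mul, Quaternion.imK_mul] <;> ring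

theorem norm_sq_rot (q : ℍ[ℝ]) (v : E3) :
    ‖rot q v‖ ^ 2 = Quaternion.normSq q ^ 2 * ‖v‖ ^ 2 := by
  simp only [E3.norm_sq, rot_apply_zero, rot_apply_one, rot_apply_two, Quaternion.normSq_def']
  ring

theorem det_rot (q : ℍ[ℝ]) : LinearMap.det (rot q) = Quaternion.normSq q ^ 3 := by
  rw [rot, LinearMap.det_toLpLin, Matrix.det_fin_three, Quaternion.normSq_def']
  simp [rotMatrix]
  ring

theorem mem_unitary_quaternion {q : ℍ[ℝ]} : q ∈ unitary ℍ[ℝ] ↔ Quaternion.normSq q = 1 := by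
  rw [Unitary.mem_iff, Quaternion.star_mul_self, Quaternion.self_mul_star, and_self]
  constructor
  · intro h; simpa using congrArg (fun x : ℍ[ℝ] => x.re) h
  · intro h; rw [h]; rfl

theorem normSq_unitary (q : unitary ℍ[ℝ]) : Quaternion.normSq q.1 = 1 :=
  mem_unitary_quaternion.1 q.2

theorem sq_sum_unitary (q : unitary ℍ[ℝ]) :
    q.1.re ^ 2 + q.1.imI ^ 2 + q.1.imJ ^ 2 + q.1.imK ^ 2 = 1 := by
  rw [← Quaternion.normSq_def', normSq_unitary]

/-- The rotation `v ↦ q v q̄` attached to a unit quaternion. -/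
def rotIso : unitary ℍ[ℝ] →* (E3 ≃ₗᵢ[ℝ] E3) where
  toFun q := LinearIsometry.toLinearIsometryEquiv
    { rot q.1 with
      norm_map' := fun v => by
        have h := norm_sq_rot q.1 v
        rw [normSq_unitary, one_pow, one_mul] at h
        exact (pow_left_inj₀ (norm_nonneg _) (norm_nonneg _) two_ne_zero).1 h } rfl
  map_one' := by ext1 v; exact rot_one_apply v
  map_mul' p q := by ext1 v; exact rot_mul_apply p.1 q.1 v

theorem rotIso_apply (q : unitary ℍ[ℝ]) (v : E3) : rotIso q v = rot q.1 v := rfl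

theorem det_rotIso (q : unitary ℍ[ℝ]) :
    LinearMap.det ((rotIso q).toLinearEquiv : E3 →ₗ[ℝ] E3) = 1 := by
  have : ((rotIso q).toLinearEquiv : E3 →ₗ[ℝ] E3) = rot q.1 := rfl
  rw [this, det_rot, normSq_unitary, one_pow]

/-- The quaternion with given components. -/
def quat (a b c d : ℝ) : ℍ[ℝ] := ⟨a, b, c, d⟩

theorem quat_re (a b c d : ℝ) : (quat a b c d).re = a := rfl
theorem quat_imI (a b c d : ℝ) : (quat a b c d).imI = b := rfl
theorem quat_imJ (a b c d : ℝ) : (quat a b c d).imJ = c := rfl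
theorem quat_imK (a b c d : ℝ) : (quat a b c d).imK = d := rfl

theorem quat_mem_unitary {a b c d : ℝ} :
    quat a b c d ∈ unitary ℍ[ℝ] ↔ a ^ 2 + b ^ 2 + c ^ 2 + d ^ 2 = 1 := by
  rw [mem_unitary_quaternion, Quaternion.normSq_def']
  rfl

/-- The imaginary part of a quaternion, as a vector. -/
def imVec (q : ℍ[ℝ]) : E3 := vec3 q.imI q.imJ q.imK

theorem imVec_zero (q : ℍ[ℝ]) : imVec q 0 = q.imI := rfl
theorem imVec_one (q : ℍ[ℝ]) : imVec q 1 = q.imJ := rfl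
theorem imVec_two (q : ℍ[ℝ]) : imVec q 2 = q.imK := rfl

/-- The real part of the conjugate `p q p⁻¹` is that of `q`. -/
theorem re_conj_unitary (p q : unitary ℍ[ℝ]) : (p * q * p⁻¹).1.re = q.1.re := by
  have h := sq_sum_unitary p
  have e : (p * q * p⁻¹).1 = p.1 * q.1 * star p.1 := rfl
  rw [e]
  simp only [Quaternion.re_mul, Quaternion.imI_mul, Quaternion.imJ_mul, Quaternion.imK_mul,
    Quaternion.re_star, Quaternion.imI_star, Quaternion.imJ_star, Quaternion.imK_star]
  linear_combination q.1.re * h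

/-- The imaginary part of the conjugate `p q p⁻¹` is the rotated imaginary part of `q`. -/
theorem imVec_conj_unitary (p q : unitary ℍ[ℝ]) :
    imVec (p * q * p⁻¹).1 = rotIso p (imVec q.1) := by
  have e : (p * q * p⁻¹).1 = p.1 * q.1 * star p.1 := rfl
  rw [e]
  apply E3.ext <;> simp only [rotIso_apply, rot_apply_zero, rot_apply_one, rot_apply_two,
    imVec_zero, imVec_one, imVec_two,
    Quaternion.re_mul, Quaternion.imI_mul, Quaternion.imJ_mul, Quaternion.imK_mul,
    Quaternion.re_star, Quaternion.imI_star, Quaternion.imJ_star, Quaternion.imK_star] <;> ring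

/-- The points fixed by a rotation lie on its axis. -/
theorem cross_imVec_of_rot_eq {q : unitary ℍ[ℝ]} {v : E3} (h : rotIso q v = v) :
    E3.cross (imVec q.1) v = 0 := by
  have h0 := congrArg (fun w : E3 => w 0) h
  have h1 := congrArg (fun w : E3 => w 1) h
  have h2 := congrArg (fun w : E3 => w 2) h
  have hs := sq_sum_unitary q
  simp only [rotIso_apply, rot_apply_zero, rot_apply_one, rot_apply_two] at h0 h1 h2
  -- This rests on the identity `v · (v - q v q̄) = 2 ‖Im q × v‖²`.
  have key : ‖E3.cross (imVec q.1) v‖ ^ 2 = 0 := by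
    rw [E3.norm_sq]
    simp only [E3.cross_zero, E3.cross_one, E3.cross_two, imVec_zero, imVec_one, imVec_two]
    linear_combination (-1 / 2 * v 0) * h0 + (-1 / 2 * v 1) * h1 + (-1 / 2 * v 2) * h2
      + (1 / 2 * (v 0 ^ 2 + v 1 ^ 2 + v 2 ^ 2)) * hs
  exact norm_eq_zero.1 (pow_eq_zero_iff two_ne_zero |>.1 key)

/-- Vectors with vanishing cross product are parallel. -/
theorem E3.smul_eq_of_cross_eq_zero {u v : E3} (h : E3.cross u v = 0) :
    (‖u‖ ^ 2) • v = inner ℝ u v • u := by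
  have h0 := congrArg (fun w : E3 => w 0) h
  have h1 := congrArg (fun w : E3 => w 1) h
  have h2 := congrArg (fun w : E3 => w 2) h
  simp only [E3.cross_zero, E3.cross_one, E3.cross_two, PiLp.zero_apply] at h0 h1 h2
  apply E3.ext <;> simp only [E3.norm_sq, E3.inner_eq, PiLp.smul_apply, smul_eq_mul]
  · linear_combination u 2 * h1 - u 1 * h2
  · linear_combination u 0 * h2 - u 2 * h0
  · linear_combination u 1 * h0 - u 0 * h1

/-- Every rotation of three-space is given by a unit quaternion. -/
theorem exists_rotIso_eq (g : E3 ≃ₗᵢ[ℝ] E3)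
    (hg : LinearMap.det (g.toLinearEquiv : E3 →ₗ[ℝ] E3) = 1) : ∃ q, rotIso q = g := by
  have step : ∀ g : E3 ≃ₗᵢ[ℝ] E3, LinearMap.det (g.toLinearEquiv : E3 →ₗ[ℝ] E3) = 1 →
      g (vec3 0 0 1) = (vec3 0 0 1) → ∃ q, rotIso q = g := by
    intro g hg h3
    set x := g (vec3 1 0 0) with hx
    have hn : ‖x‖ ^ 2 = 1 := by
      rw [hx, g.norm_map, E3.norm_sq, vec3_zero, vec3_one, vec3_two]; norm_num
    have hx2 : x 2 = 0 := by
      have h := g.inner_map_map (vec3 1 0 0) (vec3 0 0 1)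
      rw [h3, ← hx, E3.inner_eq, E3.inner_eq] at h
      simpa [vec3_zero, vec3_one, vec3_two] using h
    rw [E3.norm_sq, hx2] at hn
    -- A turn by θ about the third axis comes from `cos(θ/2) + sin(θ/2) k`; the half-angle is found
    -- as a complex square root of the image of the first basis vector.
    obtain ⟨w, hw⟩ := IsAlgClosed.exists_pow_nat_eq (⟨x 0, x 1⟩ : ℂ) two_pos
    have hr : w.re * w.re - w.im * w.im = x 0 := by
      simpa [sq] using congrArg Complex.re hw
    have hi : 2 * (w.re * w.im) = x 1 := by
      have := congrArg Complex.im hw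
      simp [sq] at this
      linarith
    have hw1 : w.re ^ 2 + w.im ^ 2 = 1 := by
      have : (w.re ^ 2 + w.im ^ 2) ^ 2 = 1 := by
        rw [← hr, ← hi] at hn
        linear_combination hn
      nlinarith [sq_nonneg w.re, sq_nonneg w.im]
    have hq : quat w.re 0 0 w.im ∈ unitary ℍ[ℝ] := by
      rw [quat_mem_unitary]
      linear_combination hw1
    refine ⟨⟨_, hq⟩, E3.rotation_ext (det_rotIso _) hg (u := (vec3 1 0 0)) (v := (vec3 0 0 1))
      ?_ ?_ ?_⟩
    · intro h
      simpa [E3.cross_one, vec3_zero, vec3_one, vec3_two] using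
        congrArg (fun w : E3 => w 1) h
    · rw [← hx]
      apply E3.ext <;> simp only [rotIso_apply, rot_apply_zero, rot_apply_one, rot_apply_two,
        quat_re, quat_imI, quat_imJ, quat_imK,
        vec3_zero, vec3_one, vec3_two]
      · linear_combination hr
      · linear_combination hi
      · linear_combination -hx2
    · rw [h3]
      apply E3.ext <;> simp only [rotIso_apply, rot_apply_zero, rot_apply_one, rot_apply_two,
        quat_re, quat_imI, quat_imJ, quat_imK,
        vec3_zero, vec3_one, vec3_two]
      · ring
      · ring
      · linear_combination hw1
  have trans : ∃ p, rotIso p (vec3 0 0 1) = g (vec3 0 0 1) := by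
    set X := g (vec3 0 0 1) with hX
    have hn : ‖X‖ ^ 2 = 1 := by
      rw [hX, g.norm_map, E3.norm_sq, vec3_zero, vec3_one, vec3_two]; norm_num
    rw [E3.norm_sq] at hn
    by_cases hz : 1 + X 2 = 0
    · have hz' : X 2 = -1 := by linarith
      rw [hz'] at hn
      have hx : X 0 = 0 := by nlinarith [sq_nonneg (X 0), sq_nonneg (X 1)]
      have hy : X 1 = 0 := by nlinarith [sq_nonneg (X 0), sq_nonneg (X 1)]
      -- At the south pole the general formula below degenerates; the half-turn about the first axis
      -- serves instead.
      have hq : quat 0 1 0 0 ∈ unitary ℍ[ℝ] := by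
        rw [quat_mem_unitary]; norm_num
      refine ⟨⟨_, hq⟩, ?_⟩
      apply E3.ext <;> simp only [rotIso_apply, rot_apply_zero, rot_apply_one, rot_apply_two,
        quat_re, quat_imI, quat_imJ, quat_imK,
        vec3_zero, vec3_one, vec3_two]
      · linear_combination -hx
      · linear_combination -hy
      · linear_combination -hz'
    · have hpos : 0 < 1 + X 2 := by
        refine lt_of_le_of_ne ?_ (Ne.symm hz)
        nlinarith [sq_nonneg (X 0), sq_nonneg (X 1)]
      set t := (Real.sqrt (2 * (1 + X 2)))⁻¹ with ht
      have ht2 : t ^ 2 * (2 * (1 + X 2)) = 1 := by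
        rw [ht, inv_pow, Real.sq_sqrt (by positivity)]
        field_simp
      -- Up to the normalizing factor `t` this is `1 + e₃ · X + e₃ × X`, whose rotation axis is
      -- perpendicular to `e₃` and `X` and whose half-angle is half the angle between them.
      have hq : quat (t * (1 + X 2)) (-t * X 1) (t * X 0) 0 ∈ unitary ℍ[ℝ] := by
        rw [quat_mem_unitary]
        linear_combination ht2 + t ^ 2 * hn
      refine ⟨⟨_, hq⟩, ?_⟩
      apply E3.ext <;> simp only [rotIso_apply, rot_apply_zero, rot_apply_one, rot_apply_two,
        quat_re, quat_imI, quat_imJ, quat_imK,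
        vec3_zero, vec3_one, vec3_two]
      · linear_combination X 0 * ht2
      · linear_combination X 1 * ht2
      · linear_combination X 2 * ht2 - t ^ 2 * hn
  obtain ⟨p, hp⟩ := trans
  obtain ⟨q, hq⟩ := step ((rotIso p)⁻¹ * g) (by
    have h1 := det_rotIso p⁻¹
    have h2 := LinearMap.det_comp ((rotIso p⁻¹).toLinearEquiv : E3 →ₗ[ℝ] E3)
      (g.toLinearEquiv : E3 →ₗ[ℝ] E3)
    rw [h1, hg, one_mul] at h2
    rw [← map_inv]
    exact h2) (by
    change (rotIso p).symm (g _) = _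
    rw [← hp, LinearIsometryEquiv.symm_apply_apply])
  exact ⟨p * q, by rw [map_mul, hq, mul_inv_cancel_left]⟩

/-! ### The rotation group of the standard dodecahedron -/

/-- The vector of `E3` with coordinates in `ℤ[φ]`. -/
def ZVec.toE (v : ZVec) : E3 := vec3 v.x.toReal v.y.toReal v.z.toReal

theorem ZVec.toE_zero (v : ZVec) : v.toE 0 = v.x.toReal := rfl
theorem ZVec.toE_one (v : ZVec) : v.toE 1 = v.y.toReal := rfl
theorem ZVec.toE_two (v : ZVec) : v.toE 2 = v.z.toReal := rfl

theorem ZVec.toE_injective : Function.Injective ZVec.toE := by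
  intro u v h
  have h0 := toReal_injective (congrArg (fun w : E3 => w 0) h)
  have h1 := toReal_injective (congrArg (fun w : E3 => w 1) h)
  have h2 := toReal_injective (congrArg (fun w : E3 => w 2) h)
  cases u; cases v
  simp_all

theorem ZVec.toE_eq_zero {v : ZVec} : v.toE = 0 ↔ v = ⟨0, 0, 0⟩ := by
  have : (⟨0, 0, 0⟩ : ZVec).toE = 0 := by
    apply E3.ext <;> exact toReal_zero
  rw [← this, ZVec.toE_injective.eq_iff]

theorem ZVec.inner_toE (u v : ZVec) : inner ℝ u.toE v.toE = (dot u v).toReal := by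
  simp only [E3.inner_eq, toE_zero, toE_one, toE_two, dot, toReal_add, toReal_mul]

theorem ZVec.cross_toE (u v : ZVec) : E3.cross u.toE v.toE = (ZVec.cross u v).toE := by
  apply E3.ext <;> simp only [E3.cross_zero, E3.cross_one, E3.cross_two, toE_zero, toE_one,
    toE_two, ZVec.cross, toReal_sub, toReal_mul]

theorem ZVec.toE_scale (c : ZPhi) (v : ZVec) : (scale c v).toE = c.toReal • v.toE := by
  apply E3.ext <;> simp only [PiLp.smul_apply, smul_eq_mul, toE_zero, toE_one,
    toE_two, scale, toReal_mul]

/-- Half of the quaternion with coordinates in `ℤ[φ]`. -/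
def ZQuat.toQuat (q : ZQuat) : ℍ[ℝ] :=
  quat (q.r.toReal / 2) (q.v.x.toReal / 2) (q.v.y.toReal / 2) (q.v.z.toReal / 2)

theorem ZQuat.four_smul_rot (q : ZQuat) (v : ZVec) :
    (4 : ℝ) • rot q.toQuat v.toE = (q.act v).toE := by
  apply E3.ext <;> simp only [PiLp.smul_apply, smul_eq_mul, toE_zero, toE_one, toE_two,
    rot_apply_zero, rot_apply_one, rot_apply_two, ZQuat.toQuat, quat_re, quat_imI, quat_imJ,
    quat_imK, ZQuat.act, toReal_sub, toReal_mul, toReal_add, toReal_two] <;> ring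

theorem ZQuat.imVec_toQuat (q : ZQuat) : imVec q.toQuat = (2⁻¹ : ℝ) • q.v.toE := by
  apply E3.ext <;> simp only [PiLp.smul_apply, smul_eq_mul, toE_zero, toE_one, toE_two,
    imVec_zero, imVec_one, imVec_two, ZQuat.toQuat, quat_imI, quat_imJ, quat_imK] <;> ring

/-- The icosian units. -/
def icosianUnit (q : ZQuat) (hq : q ∈ icosianList) : unitary ℍ[ℝ] :=
  ⟨q.toQuat, quat_mem_unitary.2 (by
    have h := congrArg ZPhi.toReal (norm_icosian q hq)
    simp only [dot, toReal_add, toReal_mul, toReal_four] at h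
    linear_combination h / 4)⟩

theorem icosianUnit_apply {q : ZQuat} {hq : q ∈ icosianList} {v w : ZVec}
    (h : q.act v = scale 4 w) : rotIso (icosianUnit q hq) v.toE = w.toE := by
  have h1 := ZQuat.four_smul_rot q v
  rw [h, toE_scale, toReal_four] at h1
  exact smul_right_injective _ (four_ne_zero : (4 : ℝ) ≠ 0) h1

theorem mem_signs_of_abs {a b c : ZPhi} {x : E3} (h0 : |x 0| = a.toReal) (h1 : |x 1| = b.toReal)
    (h2 : |x 2| = c.toReal) : ∃ v ∈ signs ⟨a, b, c⟩, v.toE = x := by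
  have key : ∀ (t : ℝ) (z : ZPhi), |t| = z.toReal → z.toReal = t ∨ (-z).toReal = t := by
    intro t z h
    rcases abs_choice t with h' | h' <;> rw [h'] at h
    · exact Or.inl h.symm
    · right; rw [toReal_neg, ← h, neg_neg]
  rcases key _ _ h0 with h0 | h0 <;> rcases key _ _ h1 with h1 | h1 <;>
  rcases key _ _ h2 with h2 | h2
  all_goals exact ⟨⟨_, _, _⟩, by simp [signs], E3.ext h0 h1 h2⟩

theorem mem_stdDodecahedronVertices {x : E3} :
    x ∈ stdDodecahedronVertices ↔ ∃ v ∈ vertexList, v.toE = x := by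
  constructor
  · have hpsi := toReal_psi
    have hphi := toReal_phi
    have h0 := toReal_zero
    have h1 := toReal_one
    rintro (⟨a, b, c⟩ | ⟨a, b, c⟩ | ⟨a, b, c⟩ | ⟨a, b, c⟩)
    · rw [← h1] at a b c
      obtain ⟨v, hv, rfl⟩ := mem_signs_of_abs a b c
      exact ⟨v, by simp [vertexList, hv], rfl⟩
    · rw [← abs_eq_zero, ← h0] at a
      rw [← hpsi] at b
      rw [← hphi] at c
      obtain ⟨v, hv, rfl⟩ := mem_signs_of_abs a b c
      exact ⟨v, by simp [vertexList, cyc, hv], rfl⟩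
    · rw [← abs_eq_zero, ← h0] at c
      rw [← hpsi] at a
      rw [← hphi] at b
      obtain ⟨v, hv, rfl⟩ := mem_signs_of_abs a b c
      exact ⟨v, by simp [vertexList, cyc, hv], rfl⟩
    · rw [← abs_eq_zero, ← h0] at b
      rw [← hpsi] at c
      rw [← hphi] at a
      obtain ⟨v, hv, rfl⟩ := mem_signs_of_abs a b c
      exact ⟨v, by simp [vertexList, cyc, hv], rfl⟩
  · rintro ⟨v, hv, rfl⟩
    have hphi := Real.goldenRatio_pos
    simp only [vertexList, cyc, signs, List.flatMap_cons, List.flatMap_nil, List.append_nil,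
      List.mem_append, List.mem_dedup, List.mem_cons, List.not_mem_nil, or_false] at hv
    simp only [stdDodecahedronVertices, Set.mem_ofPred_eq, toE_zero, toE_one, toE_two]
    rcases hv with ((h|h|h|h|h|h|h|h)|(h|h|h|h|h|h|h|h)|(h|h|h|h|h|h|h|h)|(h|h|h|h|h|h|h|h))
    all_goals
      subst h
      simp only [toReal_neg, toReal_one, toReal_zero, toReal_phi, toReal_psi]
      generalize Real.goldenRatio = c at hphi
      simp [abs_of_pos hphi]

/-- The standard regular dodecahedron. -/
def stdDodecahedron : Set E3 := convexHull ℝ stdDodecahedronVertices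

theorem stdDodecahedronVertices_eq :
    stdDodecahedronVertices = ZVec.toE '' {v | v ∈ vertexList} := by
  ext x; exact mem_stdDodecahedronVertices

theorem finite_stdDodecahedronVertices : stdDodecahedronVertices.Finite := by
  rw [stdDodecahedronVertices_eq]
  exact (List.finite_toSet _).image _

theorem dot_vertex_self : ∀ v ∈ vertexList, dot v v = 3 := by decide +kernel

theorem norm_sq_vertex {x : E3} (hx : x ∈ stdDodecahedronVertices) : ‖x‖ ^ 2 = 3 := by
  obtain ⟨v, hv, rfl⟩ := mem_stdDodecahedronVertices.1 hx
  rw [← real_inner_self_eq_norm_sq, inner_toE, dot_vertex_self v hv, toReal_three]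

/-- The vertices lie on one sphere about the origin, so the inner product with a vertex is maximal
on the solid at that vertex alone: each vertex is exposed. -/
theorem extremePoints_stdDodecahedron :
    stdDodecahedron.extremePoints ℝ = stdDodecahedronVertices := by
  apply subset_antisymm extremePoints_convexHull_subset
  intro v hv
  refine exposedPoints_subset_extremePoints ⟨subset_convexHull ℝ _ hv, innerSL ℝ v, ?_⟩
  have hle : ∀ y ∈ stdDodecahedron, ‖y‖ ^ 2 ≤ 3 := by
    intro y hy
    have : stdDodecahedron ⊆ Metric.closedBall 0 (Real.sqrt 3) := by
      refine convexHull_min (fun x hx => ?_) (convex_closedBall _ _)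
      rw [mem_closedBall_zero_iff, ← norm_sq_vertex hx, Real.sqrt_sq (norm_nonneg _)]
    have h := mem_closedBall_zero_iff.1 (this hy)
    calc ‖y‖ ^ 2 ≤ Real.sqrt 3 ^ 2 := by gcongr
      _ = 3 := Real.sq_sqrt (by norm_num)
  intro y hy
  simp only [innerSL_apply_apply]
  have h1 := hle y hy
  have h2 := norm_sq_vertex hv
  have h3 : ‖v - y‖ ^ 2 = ‖v‖ ^ 2 - 2 * inner ℝ v y + ‖y‖ ^ 2 := norm_sub_sq_real v y
  rw [real_inner_self_eq_norm_sq]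
  have h4 := sq_nonneg ‖v - y‖
  refine ⟨by linarith, fun h => ?_⟩
  have : ‖v - y‖ ^ 2 ≤ 0 := by linarith
  have := pow_eq_zero_iff two_ne_zero |>.1 (le_antisymm this h4)
  exact (sub_eq_zero.1 (norm_eq_zero.1 this)).symm

theorem image_stdDodecahedron_eq_iff (g : E3 ≃ₗᵢ[ℝ] E3) : g '' stdDodecahedron = stdDodecahedron ↔
    g '' stdDodecahedronVertices = stdDodecahedronVertices := by
  constructor
  · intro h
    have h1 := image_extremePoints (𝕜 := ℝ) g.toLinearEquiv stdDodecahedron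
    rw [← extremePoints_stdDodecahedron]
    conv_rhs => rw [← h]
    exact h1
  · intro h
    have h1 := (g.toLinearEquiv : E3 →ₗ[ℝ] E3).image_convexHull stdDodecahedronVertices
    conv_rhs => rw [stdDodecahedron, ← h]
    exact h1

theorem rotIso_icosianUnit_mem (q : ZQuat) (hq : q ∈ icosianList) :
    rotIso (icosianUnit q hq) ∈ rotationGroup stdDodecahedron := by
  refine ⟨det_rotIso _, (image_stdDodecahedron_eq_iff _).2 ?_⟩
  refine (finite_stdDodecahedronVertices.image _).eq_of_subset_of_encard_le ?_ ?_
  · rintro _ ⟨x, hx, rfl⟩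
    obtain ⟨v, hv, rfl⟩ := mem_stdDodecahedronVertices.1 hx
    obtain ⟨w, hw, h⟩ := icosian_act_vertex q hq v hv
    exact mem_stdDodecahedronVertices.2 ⟨w, hw, (icosianUnit_apply h).symm⟩
  · rw [(rotIso (icosianUnit q hq)).injective.encard_image]

theorem eq_icosian_of_pair {g : E3 ≃ₗᵢ[ℝ] E3}
    (hg : LinearMap.det (g.toLinearEquiv : E3 →ₗ[ℝ] E3) = 1) {q : ZQuat} (hq : q ∈ icosianList)
    {a b v w : ZVec} (hab : ZVec.cross a b ≠ ⟨0, 0, 0⟩) (hv : g a.toE = v.toE)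
    (hw : g b.toE = w.toE) (hqv : q.act a = scale 4 v) (hqw : q.act b = scale 4 w) :
    g = rotIso (icosianUnit q hq) := by
  refine E3.rotation_ext hg (det_rotIso _) (u := a.toE) (v := b.toE) ?_ ?_ ?_
  · rwa [cross_toE, Ne, toE_eq_zero]
  · rw [hv, icosianUnit_apply hqv]
  · rw [hw, icosianUnit_apply hqw]

/-- The rotations of the standard dodecahedron are given by the icosian units. -/
theorem mem_rotationGroup_std {g : E3 ≃ₗᵢ[ℝ] E3} : g ∈ rotationGroup stdDodecahedron ↔
    ∃ q, ∃ hq : q ∈ icosianList, g = rotIso (icosianUnit q hq) := by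
  constructor
  · rintro ⟨hdet, himg⟩
    have himg := (image_stdDodecahedron_eq_iff g).1 himg
    have hmap : ∀ v ∈ vertexList, ∃ w ∈ vertexList, g v.toE = w.toE := by
      intro v hv
      have : g v.toE ∈ stdDodecahedronVertices := by
        rw [← himg]
        exact Set.mem_image_of_mem _ (mem_stdDodecahedronVertices.2 ⟨v, hv, rfl⟩)
      obtain ⟨w, hw, h⟩ := mem_stdDodecahedronVertices.1 this
      exact ⟨w, hw, h.symm⟩
    obtain ⟨v, hv, h0⟩ := hmap vertex₀ (by decide +kernel)
    obtain ⟨w, hw, h1⟩ := hmap vertex₁ (by decide +kernel)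
    have hd : dot v w = dot vertex₀ vertex₁ := by
      apply toReal_injective
      rw [← inner_toE, ← inner_toE, ← h0, ← h1, g.inner_map_map]
    obtain ⟨q, hq, hqv, hqw⟩ := icosian_vertex_pair v hv w hw
      (hd.trans (by decide +kernel))
    exact ⟨q, hq, eq_icosian_of_pair hdet hq (by decide +kernel) h0 h1 hqv hqw⟩
  · rintro ⟨q, hq, rfl⟩
    exact rotIso_icosianUnit_mem q hq

/-- The rotation group of the standard dodecahedron, listed by the icosian units. -/
def icosianEquiv : {q // q ∈ icosianList} ≃ rotationGroup stdDodecahedron :=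
  Equiv.ofBijective (fun q => ⟨rotIso (icosianUnit q.1 q.2), rotIso_icosianUnit_mem q.1 q.2⟩) (by
    constructor
    · rintro ⟨q, hq⟩ ⟨q', hq'⟩ h
      have h := congrArg Subtype.val h
      simp only at h
      have key : ∀ v, q.act v = q'.act v := by
        intro v
        apply toE_injective
        rw [← ZQuat.four_smul_rot, ← ZQuat.four_smul_rot]
        congr 1
        exact congrArg (fun f : E3 ≃ₗᵢ[ℝ] E3 => f v.toE) h
      have := List.inj_on_of_nodup_map icosian_pair_nodup hq hq' (by
        simp only [key])
      exact Subtype.ext this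
    · rintro ⟨g, hg⟩
      obtain ⟨q, hq, rfl⟩ := mem_rotationGroup_std.1 hg
      exact ⟨⟨q, hq⟩, rfl⟩)

theorem icosianList_nodup : icosianList.Nodup := List.Nodup.of_map _ icosian_pair_nodup

theorem card_rotationGroup_std : Nat.card (rotationGroup stdDodecahedron) = 60 := by
  rw [← Nat.card_congr icosianEquiv]
  rw [Nat.subtype_card icosianList.toFinset (fun x => List.mem_toFinset),
    List.toFinset_card_of_nodup icosianList_nodup, lengths.2.2.2]

/-! ### The isomorphism with the alternating group -/

/-- The coordinate axes, as a set of vectors of length two. -/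
def axisList : List ZVec := (cyc ⟨2, 0, 0⟩).flatMap signs

/-- The rotations of the standard dodecahedron that preserve the set of coordinate axes. -/
def axisStabilizer : Subgroup (rotationGroup stdDodecahedron) where
  carrier := {g | (g : E3 ≃ₗᵢ[ℝ] E3) '' (toE '' {v | v ∈ axisList}) = toE '' {v | v ∈ axisList}}
  one_mem' := Set.image_id _
  mul_mem' := by
    intro a b ha hb
    simp only [Set.mem_ofPred_eq] at ha hb ⊢
    conv_rhs => rw [← ha, ← hb, Set.image_image]
    rfl
  inv_mem' := by
    intro a ha
    simp only [Set.mem_ofPred_eq] at ha ⊢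
    conv_lhs => rw [← ha, Set.image_image]
    convert Set.image_id _ using 2
    ext1 x
    exact a.1.symm_apply_apply x

/-- The icosian units that preserve the coordinate axes. -/
def axisIcosians : List ZQuat :=
  icosianList.filter fun q => ∀ v ∈ axisList, ∃ w ∈ axisList, q.act v = scale 4 w

theorem icosianEquiv_mem_axisStabilizer (q : {q // q ∈ icosianList}) :
    icosianEquiv q ∈ axisStabilizer ↔ q.1 ∈ axisIcosians := by
  have hval : ∀ x, (icosianEquiv q).1 x = rotIso (icosianUnit q.1 q.2) x := fun _ => rfl
  constructor
  · intro h
    simp only [axisIcosians, List.mem_filter, decide_eq_true_eq]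
    refine ⟨q.2, fun v hv => ?_⟩
    have h1 : (icosianEquiv q).1 v.toE ∈ toE '' {v | v ∈ axisList} := by
      rw [← (show _ = _ from h)]
      exact Set.mem_image_of_mem _ ⟨v, hv, rfl⟩
    obtain ⟨w, hw, hvw⟩ := h1
    refine ⟨w, hw, toE_injective ?_⟩
    rw [← ZQuat.four_smul_rot, toE_scale, toReal_four, hvw]
    rfl
  · intro h
    simp only [axisIcosians, List.mem_filter, decide_eq_true_eq] at h
    change (icosianEquiv q).1 '' _ = _
    refine (((List.finite_toSet axisList).image toE).image _).eq_of_subset_of_encard_le ?_ ?_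
    · rintro _ ⟨_, ⟨v, hv, rfl⟩, rfl⟩
      obtain ⟨w, hw, hvw⟩ := h.2 v hv
      exact ⟨w, hw, (icosianUnit_apply hvw).symm⟩
    · rw [(icosianEquiv q).1.injective.encard_image]

/-- The twelve elements are the Hurwitz units up to sign: the rotations of a tetrahedron. -/
theorem card_axisStabilizer : Nat.card axisStabilizer = 12 := by
  have e : {q // q ∈ axisIcosians} ≃ axisStabilizer :=
    { toFun := fun q => ⟨icosianEquiv ⟨q.1, List.mem_of_mem_filter q.2⟩,
        (icosianEquiv_mem_axisStabilizer _).2 q.2⟩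
      invFun := fun g => ⟨(icosianEquiv.symm g.1).1, by
        rw [← icosianEquiv_mem_axisStabilizer, Equiv.apply_symm_apply]; exact g.2⟩
      left_inv := fun q => by simp
      right_inv := fun g => by simp }
  rw [← Nat.card_congr e, Nat.subtype_card axisIcosians.toFinset (fun x => List.mem_toFinset),
    List.toFinset_card_of_nodup (by exact icosianList_nodup.filter _)]
  decide +kernel

theorem index_axisStabilizer : axisStabilizer.index = 5 := by
  have := axisStabilizer.card_mul_index
  rw [card_axisStabilizer, card_rotationGroup_std] at this
  omega

theorem dot_axis : ∀ v ∈ axisList, ∀ w ∈ axisList,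
    dot v w = 0 ∨ dot v w = 4 ∨ dot v w = -4 := by decide +kernel

theorem exists_icosian_axis : ∀ p ∈ edgeList, ∃ q ∈ icosianList,
    q.act ⟨2, 0, 0⟩ = scale 4 p := by decide +kernel

/-- An element of the core preserves the image of the coordinate frame under every rotation of the
group. These images cover all edge directions (`exists_icosian_axis`), so `icosian_core` applies. -/
theorem normalCore_axisStabilizer : axisStabilizer.normalCore = ⊥ := by
  rw [Subgroup.eq_bot_iff_forall]
  intro g hg
  obtain ⟨⟨q, hq⟩, rfl⟩ := icosianEquiv.surjective g
  have key : q = ⟨2, ⟨0, 0, 0⟩⟩ := by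
    refine icosian_core q hq fun p hp => ?_
    obtain ⟨r, hr, hrp⟩ := exists_icosian_axis p hp
    set a : ZVec := ⟨2, 0, 0⟩
    have ha : a ∈ axisList := by decide +kernel
    have hg' := hg (icosianEquiv ⟨r, hr⟩)⁻¹
    rw [inv_inv] at hg'
    have hmem : ((icosianEquiv ⟨r, hr⟩)⁻¹ * icosianEquiv ⟨q, hq⟩ * icosianEquiv ⟨r, hr⟩).1 a.toE ∈
        toE '' {v | v ∈ axisList} := by
      rw [← (show _ = _ from hg')]
      exact Set.mem_image_of_mem _ ⟨a, ha, rfl⟩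
    obtain ⟨w, hw, hwa⟩ := hmem
    have hp' : rotIso (icosianUnit r hr) a.toE = p.toE := icosianUnit_apply hrp
    have h1 : rotIso (icosianUnit q hq) p.toE = rotIso (icosianUnit r hr) w.toE := by
      rw [hwa, ← hp']
      exact ((rotIso (icosianUnit r hr)).apply_symm_apply _).symm
    have h2 : inner ℝ p.toE (rotIso (icosianUnit q hq) p.toE) = inner ℝ a.toE w.toE := by
      rw [h1, ← hp', LinearIsometryEquiv.inner_map_map]
    have h3 : (dot p (q.act p)).toReal = (4 * dot a w).toReal := by
      rw [← inner_toE, ← ZQuat.four_smul_rot, inner_smul_right, toReal_mul, toReal_four,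
        ← inner_toE, ← h2]
      rfl
    rw [toReal_injective h3]
    rcases dot_axis a ha w hw with h | h | h <;> rw [h] <;> decide
  subst key
  apply Subtype.ext
  ext1 x
  have : (ZQuat.mk 2 ⟨0, 0, 0⟩).toQuat = 1 := by
    simp only [ZQuat.toQuat, toReal_two, toReal_zero]
    ext <;> simp [quat]
  change rot (ZQuat.mk 2 ⟨0, 0, 0⟩).toQuat x = x
  rw [this, rot_one_apply]

/-- The action on the five cosets of `H` has the core as kernel, so it embeds `G` in `S₅` with index
120/60 = 2, and the alternating group is the only subgroup of index 2. -/
theorem nonempty_mulEquiv_alternatingGroup {G : Type*} [Group G] (hG : Nat.card G = 60)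
    (H : Subgroup G) (hH : H.index = 5) (hcore : H.normalCore = ⊥) :
    Nonempty (G ≃* alternatingGroup (Fin 5)) := by
  have hcard : Nat.card (G ⧸ H) = Nat.card (Fin 5) := by
    rw [Nat.card_fin]; exact hH
  have : Finite (G ⧸ H) := Nat.finite_of_card_ne_zero (by rw [hcard]; simp)
  obtain ⟨e⟩ := Finite.card_eq.1 hcard
  let f : G →* Equiv.Perm (Fin 5) := e.permCongrHom.toMonoidHom.comp (MulAction.toPermHom G (G ⧸ H))
  have hf : Function.Injective f := by
    refine e.permCongrHom.injective.comp ?_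
    rw [← MonoidHom.ker_eq_bot_iff, ← Subgroup.normalCore_eq_ker, hcore]
  have hr : f.range = alternatingGroup (Fin 5) := by
    apply Equiv.Perm.eq_alternatingGroup_of_index_eq_two
    have h1 := f.range.card_mul_index
    rw [← Nat.card_congr (MonoidHom.ofInjective hf).toEquiv, hG, Nat.card_perm, Nat.card_fin] at h1
    have : Nat.factorial 5 = 120 := rfl
    omega
  exact ⟨(MonoidHom.ofInjective hf).trans (MulEquiv.subgroupCongr hr)⟩

/-! ### Similarities and the face structure -/

/-- The similarity `x ↦ r L x`. -/
def similarity (r : ℝ) (hr : r ≠ 0) (L : E3 ≃ₗᵢ[ℝ] E3) : E3 ≃L[ℝ] E3 :=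
  L.toContinuousLinearEquiv.trans (ContinuousLinearEquiv.smulLeft (Units.mk0 r hr))

theorem similarity_apply (r : ℝ) (hr : r ≠ 0) (L : E3 ≃ₗᵢ[ℝ] E3) (x : E3) :
    similarity r hr L x = r • L x := rfl

theorem IsExposed.image_equiv {P F : Set E3} (h : IsExposed ℝ P F) (e : E3 ≃L[ℝ] E3) :
    IsExposed ℝ (e '' P) (e '' F) := by
  intro hne
  obtain ⟨l, rfl⟩ := h hne.of_image
  refine ⟨l.comp (e.symm : E3 →L[ℝ] E3), ?_⟩
  ext x
  constructor
  · rintro ⟨y, ⟨hy, hmax⟩, rfl⟩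
    refine ⟨⟨y, hy, rfl⟩, ?_⟩
    rintro _ ⟨z, hz, rfl⟩
    simpa using hmax z hz
  · rintro ⟨⟨y, hy, rfl⟩, hmax⟩
    exact ⟨y, ⟨hy, fun z hz => by simpa using hmax (e z) ⟨z, hz, rfl⟩⟩, rfl⟩

theorem IsTwoFace.image_equiv {P F : Set E3} (h : IsTwoFace P F) (e : E3 ≃L[ℝ] E3) :
    IsTwoFace (e '' P) (e '' F) := by
  refine ⟨h.1.image_equiv e, ?_⟩
  have h1 : vectorSpan ℝ (e '' F) = (vectorSpan ℝ F).map (e.toLinearEquiv : E3 →ₗ[ℝ] E3) := by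
    exact (AffineMap.map_vectorSpan (e.toLinearEquiv : E3 →ₗ[ℝ] E3).toAffineMap (s := F)).symm
  rw [h1, ← h.2]
  exact LinearEquiv.finrank_map_eq e.toLinearEquiv _

theorem extremePoints_image_equiv (F : Set E3) (e : E3 ≃L[ℝ] E3) :
    (e '' F).extremePoints ℝ = e '' F.extremePoints ℝ :=
  (image_extremePoints (𝕜 := ℝ) e.toLinearEquiv F).symm

theorem IsFaceCentre.image_similarity {F : Set E3} {c : E3} (h : IsFaceCentre F c) {r : ℝ}
    (hr : 0 < r) (L : E3 ≃ₗᵢ[ℝ] E3) :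
    IsFaceCentre (similarity r hr.ne' L '' F) (similarity r hr.ne' L c) := by
  obtain ⟨hc, ρ, hρ⟩ := h
  refine ⟨⟨c, hc, rfl⟩, r * ρ, ?_⟩
  rw [extremePoints_image_equiv]
  rintro _ ⟨v, hv, rfl⟩
  rw [similarity_apply, similarity_apply, dist_smul₀, L.dist_map, hρ v hv, Real.norm_of_nonneg hr.le]

theorem IsEdge.image_equiv {P : Set E3} {u v : E3} (h : IsEdge P u v) (e : E3 ≃L[ℝ] E3) :
    IsEdge (e '' P) (e u) (e v) := by
  refine ⟨e.injective.ne h.1, ?_⟩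
  have h1 := h.2.image_equiv e
  have h2 : e '' segment ℝ u v = segment ℝ (e u) (e v) :=
    image_segment ℝ (e.toLinearEquiv : E3 →ₗ[ℝ] E3).toAffineMap u v
  rwa [h2] at h1

theorem IsRadialProjection.similarity {X : S2} {p : E3} (h : IsRadialProjection X p) {r : ℝ}
    (hr : 0 < r) (L : E3 ≃ₗᵢ[ℝ] E3) :
    IsRadialProjection (onSphere L X) (similarity r hr.ne' L p) := by
  change L X.1 = _
  rw [show X.1 = _ from h, similarity_apply, norm_smul, L.norm_map, map_smul, smul_smul, mul_inv,
    Real.norm_of_nonneg hr.le]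
  congr 1
  field_simp

theorem onSphere_mem_points {P : Set E3} {r : ℝ} (hr : 0 < r) (L : E3 ≃ₗᵢ[ℝ] E3) {X : S2} :
    (X ∈ vertexPoints P → onSphere L X ∈ vertexPoints (similarity r hr.ne' L '' P)) ∧
    (X ∈ facePoints P → onSphere L X ∈ facePoints (similarity r hr.ne' L '' P)) ∧
    (X ∈ edgePoints P → onSphere L X ∈ edgePoints (similarity r hr.ne' L '' P)) := by
  refine ⟨?_, ?_, ?_⟩
  · rintro ⟨v, hv, h⟩
    refine ⟨_, ?_, h.similarity hr L⟩
    rw [extremePoints_image_equiv]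
    exact ⟨v, hv, rfl⟩
  · rintro ⟨F, c, hF, hc, h⟩
    exact ⟨_, _, hF.image_equiv _, hc.image_similarity hr L, h.similarity hr L⟩
  · rintro ⟨u, v, hu, h⟩
    refine ⟨_, _, hu.image_equiv (similarity r hr.ne' L), ?_⟩
    have h1 := h.similarity hr L
    have h2 : similarity r hr.ne' L (midpoint ℝ u v) =
        midpoint ℝ (similarity r hr.ne' L u) (similarity r hr.ne' L v) :=
      (similarity r hr.ne' L).toLinearEquiv.toAffineEquiv.map_midpoint u v
    rwa [h2] at h1

theorem similarity_symm_image {r : ℝ} (hr : 0 < r) (L : E3 ≃ₗᵢ[ℝ] E3) (P : Set E3) :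
    similarity r⁻¹ (inv_pos.2 hr).ne' L.symm '' (similarity r hr.ne' L '' P) = P := by
  rw [Set.image_image]
  convert Set.image_id P using 2
  ext1 x
  simp [similarity_apply, smul_smul, hr.ne']

theorem points_similarity {P : Set E3} {r : ℝ} (hr : 0 < r) (L : E3 ≃ₗᵢ[ℝ] E3) :
    vertexPoints (similarity r hr.ne' L '' P) = onSphere L '' vertexPoints P ∧
    facePoints (similarity r hr.ne' L '' P) = onSphere L '' facePoints P ∧
    edgePoints (similarity r hr.ne' L '' P) = onSphere L '' edgePoints P := by
  have key : ∀ X : S2, onSphere L (onSphere L.symm X) = X := fun X =>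
    Subtype.ext (L.apply_symm_apply X.1)
  have h2 := @onSphere_mem_points (similarity r hr.ne' L '' P) _ (inv_pos.2 hr) L.symm
  simp only [similarity_symm_image hr] at h2
  refine ⟨?_, ?_, ?_⟩ <;> apply subset_antisymm
  · exact fun X hX => ⟨_, h2.1 hX, key X⟩
  · rintro _ ⟨X, hX, rfl⟩
    exact (onSphere_mem_points hr L).1 hX
  · exact fun X hX => ⟨_, h2.2.1 hX, key X⟩
  · rintro _ ⟨X, hX, rfl⟩
    exact (onSphere_mem_points hr L).2.1 hX
  · exact fun X hX => ⟨_, h2.2.2 hX, key X⟩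
  · rintro _ ⟨X, hX, rfl⟩
    exact (onSphere_mem_points hr L).2.2 hX

theorem similarity_one_image (L : E3 ≃ₗᵢ[ℝ] E3) (P : Set E3) :
    similarity 1 one_pos.ne' L '' P = L '' P := by
  refine Set.image_congr fun x _ => ?_
  rw [similarity_apply, one_smul]

/-! ### Orbits of the rotation group of the standard dodecahedron -/

theorem IsRadialProjection.onSphere {X : S2} {p : E3} (h : IsRadialProjection X p)
    (L : E3 ≃ₗᵢ[ℝ] E3) : IsRadialProjection (onSphere L X) (L p) := by
  have := h.similarity one_pos L
  rwa [similarity_apply, one_smul] at this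

theorem isRadialProjection_of_eq_smul {X : S2} {p : E3} {k : ℝ} (hk : 0 < k) (h : X.1 = k • p) :
    IsRadialProjection X p := by
  have h1 : ‖X.1‖ = 1 := by simp
  rw [h, norm_smul, Real.norm_of_nonneg hk.le] at h1
  rw [IsRadialProjection, h, eq_inv_of_mul_eq_one_left h1]

theorem IsRadialProjection.unique {X Y : S2} {p : E3} (hX : IsRadialProjection X p)
    (hY : IsRadialProjection Y p) : X = Y :=
  Subtype.ext (Eq.trans hX (Eq.symm hY))

theorem IsRadialProjection.smul_iff {X : S2} {p : E3} {t : ℝ} (ht : 0 < t) :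
    IsRadialProjection X (t • p) ↔ IsRadialProjection X p := by
  unfold IsRadialProjection
  rw [norm_smul, smul_smul, mul_inv, Real.norm_of_nonneg ht.le]
  have : t⁻¹ * ‖p‖⁻¹ * t = ‖p‖⁻¹ := by field_simp
  rw [this]

theorem exists_isRadialProjection {p : E3} (hp : p ≠ 0) : ∃ X, IsRadialProjection X p := by
  refine ⟨⟨‖p‖⁻¹ • p, ?_⟩, rfl⟩
  rw [mem_sphere_zero_iff_norm, norm_smul, norm_inv, norm_norm,
    inv_mul_cancel₀ (norm_ne_zero_iff.2 hp)]

/-- The projections to the sphere of a list of vectors. -/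
def radialSet (l : List ZVec) : Set S2 := {X | ∃ p ∈ l, IsRadialProjection X p.toE}

/-- Vectors of equal length and equal direction coincide, so projecting to the sphere loses none. -/
theorem ncard_radialSet {l : List ZVec} (hl : l.Nodup) {c : ZPhi} (hc : c ≠ 0)
    (h : ∀ v ∈ l, dot v v = c) : (radialSet l).ncard = l.length := by
  have hc0 : c.toReal ≠ 0 := by rwa [← toReal_zero, toReal_injective.ne_iff]
  have hn : ∀ v ∈ l, ‖v.toE‖ ^ 2 = c.toReal := fun v hv => by
    rw [← real_inner_self_eq_norm_sq, inner_toE, h v hv]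
  have hne : ∀ v ∈ l, ‖v.toE‖ ≠ 0 := fun v hv h0 => hc0 (by rw [← hn v hv, h0]; simp)
  have h1 : Subtype.val '' radialSet l = (fun v : ZVec => ‖v.toE‖⁻¹ • v.toE) '' (l.toFinset : Set ZVec) := by
    ext x
    constructor
    · rintro ⟨X, ⟨p, hp, hX⟩, rfl⟩
      exact ⟨p, by simpa using hp, hX.symm⟩
    · rintro ⟨p, hp, rfl⟩
      have hp : p ∈ l := by simpa using hp
      obtain ⟨X, hX⟩ := exists_isRadialProjection (norm_ne_zero_iff.1 (hne p hp))
      exact ⟨X, ⟨p, hp, hX⟩, hX⟩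
  rw [← Set.ncard_image_of_injective _ Subtype.val_injective, h1, Set.InjOn.ncard_image,
    Set.ncard_coe_finset, List.toFinset_card_of_nodup hl]
  intro u hu v hv huv
  have hu : u ∈ l := by simpa using hu
  have hv : v ∈ l := by simpa using hv
  have e : ‖u.toE‖ = ‖v.toE‖ := by
    rw [← pow_left_inj₀ (norm_nonneg _) (norm_nonneg _) two_ne_zero, hn u hu, hn v hv]
  simp only [e] at huv
  exact toE_injective (smul_right_injective _ (inv_ne_zero (hne v hv)) huv)

theorem rotationOrbit_eq_radialSet {l : List ZVec} {b : ZVec} {B : S2}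
    (hB : IsRadialProjection B b.toE)
    (h1 : ∀ q ∈ icosianList, ∃ w ∈ l, q.act b = scale 4 w)
    (h2 : ∀ w ∈ l, ∃ q ∈ icosianList, q.act b = scale 4 w) :
    rotationOrbit stdDodecahedron B = radialSet l := by
  ext X
  constructor
  · rintro ⟨g, hg, rfl⟩
    obtain ⟨q, hq, rfl⟩ := mem_rotationGroup_std.1 hg
    obtain ⟨w, hw, h⟩ := h1 q hq
    refine ⟨w, hw, ?_⟩
    rw [← icosianUnit_apply (hq := hq) h]
    exact hB.onSphere _
  · rintro ⟨w, hw, h⟩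
    obtain ⟨q, hq, h'⟩ := h2 w hw
    refine ⟨_, rotIso_icosianUnit_mem q hq, ?_⟩
    refine (hB.onSphere _).unique ?_
    rwa [icosianUnit_apply h']

theorem onSphere_mem_rotationOrbit {P : Set E3} {X Y : S2} {g : E3 ≃ₗᵢ[ℝ] E3}
    (hg : g ∈ rotationGroup P) (hY : Y ∈ rotationOrbit P X) :
    onSphere g Y ∈ rotationOrbit P X := by
  obtain ⟨h, hh, rfl⟩ := hY
  exact ⟨g * h, mul_mem hg hh, by rw [map_mul]; rfl⟩

theorem exists_vertexBase : ∃ B, IsRadialProjection B vertex₀.toE :=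
  exists_isRadialProjection (by rw [Ne, toE_eq_zero]; decide)
theorem exists_faceBase : ∃ B, IsRadialProjection B face₀.toE :=
  exists_isRadialProjection (by rw [Ne, toE_eq_zero]; decide)
theorem exists_edgeBase : ∃ B, IsRadialProjection B edge₀.toE :=
  exists_isRadialProjection (by rw [Ne, toE_eq_zero]; decide)

theorem rotationOrbit_vertexBase {B : S2} (hB : IsRadialProjection B vertex₀.toE) :
    rotationOrbit stdDodecahedron B = radialSet vertexList :=
  rotationOrbit_eq_radialSet hB icosian_act_vertex₀ exists_icosian_act_vertex₀
theorem rotationOrbit_faceBase {B : S2} (hB : IsRadialProjection B face₀.toE) :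
    rotationOrbit stdDodecahedron B = radialSet faceList :=
  rotationOrbit_eq_radialSet hB icosian_act_face₀ exists_icosian_act_face₀
theorem rotationOrbit_edgeBase {B : S2} (hB : IsRadialProjection B edge₀.toE) :
    rotationOrbit stdDodecahedron B = radialSet edgeList :=
  rotationOrbit_eq_radialSet hB icosian_act_edge₀ exists_icosian_act_edge₀

theorem ncard_radialSet_lists : (radialSet vertexList).ncard = 20 ∧
    (radialSet faceList).ncard = 12 ∧ (radialSet edgeList).ncard = 30 :=
  ⟨(ncard_radialSet nodups.1 (c := 3) (by decide) (by decide +kernel)).trans lengths.1,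
    (ncard_radialSet nodups.2.1 (c := phi + 2) (by decide) (by decide +kernel)).trans lengths.2.1,
    (ncard_radialSet nodups.2.2 (c := 4) (by decide) (by decide +kernel)).trans lengths.2.2.1⟩

theorem list_neg : ∀ p ∈ vertexList ++ faceList ++ edgeList,
    scale (-1) p ∈ vertexList ++ faceList ++ edgeList := by decide +kernel

/-- A point of the sphere off the special orbits is not fixed by any nontrivial rotation. -/
theorem eq_one_of_fixed {X : S2} (hX : X ∉ radialSet vertexList ∪ radialSet faceList ∪
    radialSet edgeList) {g : E3 ≃ₗᵢ[ℝ] E3} (hg : g ∈ rotationGroup stdDodecahedron)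
    (h : onSphere g X = X) : g = 1 := by
  obtain ⟨q, hq, rfl⟩ := mem_rotationGroup_std.1 hg
  have hfix : rotIso (icosianUnit q hq) X.1 = X.1 := congrArg Subtype.val h
  rcases icosian_axis q hq with rfl | ⟨hv, p, hp, hc⟩
  · have : icosianUnit ⟨2, ⟨0, 0, 0⟩⟩ hq = 1 := by
      apply Subtype.ext
      change (ZQuat.mk 2 ⟨0, 0, 0⟩).toQuat = 1
      simp only [ZQuat.toQuat, toReal_two, toReal_zero]
      ext <;> simp [quat]
    rw [this, map_one]
  · exfalso
    apply hX
    have hnX : ‖X.1‖ = 1 := by simp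
    have hX0 : X.1 ≠ 0 := fun h => by rw [h] at hnX; simp at hnX
    -- `X` is parallel to the imaginary part of the quaternion, which is parallel to a listed vector
    -- `p`; hence `X` is a multiple of `p`.
    have h1 := cross_imVec_of_rot_eq hfix
    have h2 : imVec (icosianUnit q hq).1 = (2⁻¹ : ℝ) • q.v.toE := ZQuat.imVec_toQuat q
    have hv0 : q.v.toE ≠ 0 := by rwa [Ne, toE_eq_zero]
    have him : imVec (icosianUnit q hq).1 ≠ 0 := by
      rw [h2]; exact smul_ne_zero (by norm_num) hv0
    have e1 := E3.smul_eq_of_cross_eq_zero h1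
    have e2 := E3.smul_eq_of_cross_eq_zero ((cross_toE q.v p).trans (toE_eq_zero.2 hc))
    rw [h2, norm_smul, inner_smul_left, smul_smul] at e1
    have hqn : ‖q.v.toE‖ ≠ 0 := norm_ne_zero_iff.2 hv0
    have hp0 : p.toE ≠ 0 := by
      rw [Ne, toE_eq_zero]
      exact (by decide +kernel : ∀ p ∈ vertexList ++ faceList ++ edgeList, p ≠ ⟨0, 0, 0⟩) p hp
    set t := inner ℝ q.v.toE p.toE
    have ht : t ≠ 0 := by
      intro ht
      rw [ht, zero_smul] at e2
      exact (smul_ne_zero (pow_ne_zero 2 hqn) hp0) e2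
    obtain ⟨s, hs⟩ : ∃ s : ℝ, X.1 = s • q.v.toE := by
      have hn : (‖(2⁻¹ : ℝ)‖ * ‖q.v.toE‖) ^ 2 ≠ 0 :=
        pow_ne_zero 2 (mul_ne_zero (norm_ne_zero_iff.2 (by norm_num)) hqn)
      exact ⟨_, ((eq_inv_smul_iff₀ hn).2 e1).trans (smul_smul _ _ _)⟩
    have e3 : X.1 = (s * (t⁻¹ * ‖q.v.toE‖ ^ 2)) • p.toE := by
      rw [mul_smul, mul_smul, e2, inv_smul_smul₀ ht, hs]
    set k := s * (t⁻¹ * ‖q.v.toE‖ ^ 2)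
    -- For a negative multiple, `X` is the projection of `-p`, which is again listed.
    have hmem : ∃ p ∈ vertexList ++ faceList ++ edgeList, IsRadialProjection X p.toE := by
      rcases lt_trichotomy k 0 with hk | hk | hk
      · refine ⟨_, list_neg p hp, isRadialProjection_of_eq_smul (neg_pos.2 hk) ?_⟩
        rw [toE_scale, smul_smul, toReal_neg, toReal_one, neg_mul_neg, mul_one, e3]
      · rw [hk, zero_smul] at e3
        exact absurd e3 hX0
      · exact ⟨p, hp, isRadialProjection_of_eq_smul hk e3⟩
    obtain ⟨p, hp, h⟩ := hmem
    rw [List.mem_append, List.mem_append] at hp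
    rcases hp with (hp | hp) | hp
    · exact Or.inl (Or.inl ⟨p, hp, h⟩)
    · exact Or.inl (Or.inr ⟨p, hp, h⟩)
    · exact Or.inr ⟨p, hp, h⟩

theorem ncard_rotationOrbit_of_free {X : S2}
    (h : ∀ g ∈ rotationGroup stdDodecahedron, onSphere g X = X → g = 1) :
    (rotationOrbit stdDodecahedron X).ncard = 60 := by
  have e : rotationOrbit stdDodecahedron X =
      Set.range fun g : rotationGroup stdDodecahedron => onSphere g.1 X := by
    ext Y
    simp [rotationOrbit]
  rw [e, ← Nat.card_coe_set_eq, Nat.card_range_of_injective, card_rotationGroup_std]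
  intro a b hab
  have h1 := h (b⁻¹ * a).1 (b⁻¹ * a).2 (by
    have : onSphere (b⁻¹ * a).1 X = (onSphere b.1)⁻¹ (onSphere a.1 X) := by
      rw [← map_inv]; rfl
    rw [this, Equiv.Perm.inv_eq_iff_eq]
    exact hab)
  have h2 : b⁻¹ * a = 1 := Subtype.ext h1
  exact (inv_mul_eq_one.1 h2).symm
/-! ### The faces and edges of the standard dodecahedron -/

/-- The third and second neighbours of the reference vertex. -/
def vertex₂ : ZVec := ⟨psi, phi, 0⟩
/-- A neighbour of the reference vertex. -/
def vertex₃ : ZVec := ⟨phi, 0, psi⟩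

theorem dot_face_vertex : ∀ f ∈ faceList, ∀ v ∈ vertexList, dot f v = phi + 1 ∨ dot f v = psi ∨
    dot f v = -psi ∨ dot f v = -(phi + 1) := by decide +kernel

theorem toReal_phi_add_one : (phi + 1).toReal = Real.goldenRatio + 1 := by
  rw [toReal_add, toReal_phi, toReal_one]

theorem toReal_psi_eq : psi.toReal = Real.goldenRatio - 1 := by
  simp [psi, toReal]; ring

theorem inner_face_le {f : ZVec} (hf : f ∈ faceList) {x : E3} (hx : x ∈ stdDodecahedron) :
    inner ℝ f.toE x ≤ Real.goldenRatio + 1 := by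
  have hconv : Convex ℝ {x : E3 | inner ℝ f.toE x ≤ Real.goldenRatio + 1} :=
    convex_halfSpace_le (innerₛₗ ℝ f.toE).isLinear _
  refine convexHull_min (fun x hx => ?_) hconv hx
  obtain ⟨v, hv, rfl⟩ := mem_stdDodecahedronVertices.1 hx
  have h1 := Real.one_lt_goldenRatio
  change inner ℝ f.toE v.toE ≤ _
  rw [inner_toE]
  rcases dot_face_vertex f hf v hv with h | h | h | h <;> rw [h] <;>
    simp only [toReal_neg, toReal_phi_add_one, toReal_psi_eq] <;> linarith

theorem vertex_mem {v : ZVec} (hv : v ∈ vertexList) : v.toE ∈ stdDodecahedron :=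
  subset_convexHull ℝ _ (mem_stdDodecahedronVertices.2 ⟨v, hv, rfl⟩)

/-- The face with outer normal `f`. -/
def facet (f : ZVec) : Set E3 :=
  {x | x ∈ stdDodecahedron ∧ inner ℝ f.toE x = Real.goldenRatio + 1}

/-- The normals of the three faces at the reference vertex. -/
def cornerFace₁ : ZVec := ⟨phi, 1, 0⟩
/-- The normal of a face at the reference vertex. -/
def cornerFace₃ : ZVec := ⟨0, phi, 1⟩

/-- The three normals at `vertex₀` and the three edge vectors there are dual bases up to the factor
2: each normal is orthogonal to the two edges in its face and pairs to 2 with the third. -/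
theorem corner_decomposition (y : E3) :
    y = (inner ℝ cornerFace₁.toE y / 2) • (vertex₀.toE - vertex₁.toE)
      + (inner ℝ face₀.toE y / 2) • (vertex₀.toE - vertex₂.toE)
      + (inner ℝ cornerFace₃.toE y / 2) • (vertex₀.toE - vertex₃.toE) := by
  have h := Real.goldenRatio_sq
  apply E3.ext <;> simp only [E3.inner_eq, PiLp.add_apply, PiLp.smul_apply, PiLp.sub_apply,
    smul_eq_mul, toE_zero, toE_one, toE_two, cornerFace₁, face₀, cornerFace₃, vertex₀, vertex₁,
    vertex₂, vertex₃, toReal_phi, toReal_psi_eq, toReal_one, toReal_zero]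
  · linear_combination ((y 1 + y 2) / 2) * h
  · linear_combination ((y 0 + y 2) / 2) * h
  · linear_combination ((y 0 + y 1) / 2) * h

theorem corner_mem : cornerFace₁ ∈ faceList ∧ face₀ ∈ faceList ∧ cornerFace₃ ∈ faceList ∧
    vertex₀ ∈ vertexList ∧ vertex₁ ∈ vertexList ∧ vertex₂ ∈ vertexList ∧ vertex₃ ∈ vertexList := by
  decide +kernel

theorem inner_vertex₀ : inner ℝ cornerFace₁.toE vertex₀.toE = Real.goldenRatio + 1 ∧
    inner ℝ face₀.toE vertex₀.toE = Real.goldenRatio + 1 ∧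
    inner ℝ cornerFace₃.toE vertex₀.toE = Real.goldenRatio + 1 := by
  refine ⟨?_, ?_, ?_⟩ <;> rw [inner_toE, ← toReal_phi_add_one] <;> congr 1

/-- The value of a functional at the points of the dodecahedron in terms of its values at the
reference vertex and its neighbours. -/
theorem functional_decomposition (l : StrongDual ℝ E3) (x : E3) :
    l vertex₀.toE - l x =
      (Real.goldenRatio + 1 - inner ℝ cornerFace₁.toE x) / 2 * (l vertex₀.toE - l vertex₁.toE)
      + (Real.goldenRatio + 1 - inner ℝ face₀.toE x) / 2 * (l vertex₀.toE - l vertex₂.toE)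
      + (Real.goldenRatio + 1 - inner ℝ cornerFace₃.toE x) / 2 *
        (l vertex₀.toE - l vertex₃.toE) := by
  have h := congrArg l (corner_decomposition (vertex₀.toE - x))
  simpa only [map_add, map_sub, map_smul, smul_eq_mul, inner_sub_right, inner_vertex₀.1,
    inner_vertex₀.2.1, inner_vertex₀.2.2] using h

theorem finrank_vectorSpan_le_one {F : Set E3} {f g : E3} {c d : ℝ} (hfg : E3.cross f g ≠ 0)
    (h : ∀ x ∈ F, inner ℝ f x = c ∧ inner ℝ g x = d) : Module.finrank ℝ (vectorSpan ℝ F) ≤ 1 := by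
  have : vectorSpan ℝ F ≤ Submodule.span ℝ {E3.cross f g} := by
    refine Submodule.span_le.2 ?_
    rintro _ ⟨x, hx, y, hy, rfl⟩
    obtain ⟨h1, h2⟩ := h x hx
    obtain ⟨h3, h4⟩ := h y hy
    change x - y ∈ _
    have hf : inner ℝ f (x - y) = 0 := by rw [inner_sub_right, h1, h3, sub_self]
    have hg : inner ℝ g (x - y) = 0 := by rw [inner_sub_right, h2, h4, sub_self]
    have hc : E3.cross (E3.cross f g) (x - y) = 0 := by
      generalize x - y = w at hf hg
      rw [E3.inner_eq] at hf hg
      apply E3.ext <;> simp only [E3.cross_zero, E3.cross_one, E3.cross_two, PiLp.zero_apply]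
      · linear_combination g 0 * hf - f 0 * hg
      · linear_combination g 1 * hf - f 1 * hg
      · linear_combination g 2 * hf - f 2 * hg
    have h5 := E3.smul_eq_of_cross_eq_zero hc
    have h6 : ‖E3.cross f g‖ ^ 2 ≠ 0 := pow_ne_zero 2 (norm_ne_zero_iff.2 hfg)
    exact Submodule.mem_span_singleton.2
      ⟨_, ((eq_inv_smul_iff₀ h6).2 h5 |>.trans (smul_smul _ _ _)).symm⟩
  calc _ ≤ Module.finrank ℝ (Submodule.span ℝ {E3.cross f g}) := Submodule.finrank_mono this
    _ ≤ 1 := (finrank_span_singleton hfg).le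

theorem finrank_ge_two {W : Submodule ℝ E3} {a b : E3} (ha : a ∈ W) (hb : b ∈ W)
    (hab : E3.cross a b ≠ 0) : 2 ≤ Module.finrank ℝ W := by
  have hli : LinearIndependent ℝ ![a, b] := by
    rw [LinearIndependent.pair_iff]
    intro s t hst
    have h0 := congrArg (fun w : E3 => w 0) hst
    have h1 := congrArg (fun w : E3 => w 1) hst
    have h2 := congrArg (fun w : E3 => w 2) hst
    simp only [PiLp.add_apply, PiLp.smul_apply, smul_eq_mul, PiLp.zero_apply] at h0 h1 h2
    constructor
    · by_contra hs
      refine hab ?_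
      apply (smul_eq_zero.1 (?_ : s • E3.cross a b = 0)).resolve_left hs
      apply E3.ext <;> simp only [E3.cross_zero, E3.cross_one, E3.cross_two, PiLp.zero_apply,
        PiLp.smul_apply, smul_eq_mul]
      · linear_combination b 2 * h1 - b 1 * h2
      · linear_combination b 0 * h2 - b 2 * h0
      · linear_combination b 1 * h0 - b 0 * h1
    · by_contra hs
      refine hab ?_
      apply (smul_eq_zero.1 (?_ : t • E3.cross a b = 0)).resolve_left hs
      apply E3.ext <;> simp only [E3.cross_zero, E3.cross_one, E3.cross_two, PiLp.zero_apply,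
        PiLp.smul_apply, smul_eq_mul]
      · linear_combination a 1 * h2 - a 2 * h1
      · linear_combination a 2 * h0 - a 0 * h2
      · linear_combination a 0 * h1 - a 1 * h0
  have h1 := finrank_span_eq_card hli
  refine (show 2 = Fintype.card (Fin 2) from rfl).trans_le (h1.symm.trans_le ?_)
  refine Submodule.finrank_mono (Submodule.span_le.2 ?_)
  rintro _ ⟨i, rfl⟩
  fin_cases i
  exacts [ha, hb]

theorem finrank_vectorSpan_stdDodecahedron :
    Module.finrank ℝ (vectorSpan ℝ stdDodecahedron) = 3 := by
  have : vectorSpan ℝ stdDodecahedron = ⊤ := by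
    refine (Submodule.eq_top_iff'.2 fun y => ?_)
    obtain ⟨-, -, -, h0, h1, h2, h3⟩ := corner_mem
    rw [corner_decomposition y]
    refine add_mem (add_mem ?_ ?_) ?_ <;> refine Submodule.smul_mem _ _ ?_
    · exact vsub_mem_vectorSpan ℝ (vertex_mem h0) (vertex_mem h1)
    · exact vsub_mem_vectorSpan ℝ (vertex_mem h0) (vertex_mem h2)
    · exact vsub_mem_vectorSpan ℝ (vertex_mem h0) (vertex_mem h3)
  rw [this, finrank_top, finrank_euclideanSpace_fin]

/-- If `l` is maximal at `vertex₀`, `functional_decomposition` writes the deficit of `l` at `x` as a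
sum of nonnegative products: the slack of `x` at a corner face times the drop of `l` along the
opposite edge. The exposed face is cut out by the vanishing of the slacks with positive drop. With
no positive drop it is the whole solid, with two it has dimension at most one; so exactly one drop
is positive. -/
theorem twoFace_eq_facet {F : Set E3} (hF : IsTwoFace stdDodecahedron F) (h0 : vertex₀.toE ∈ F) :
    F = facet cornerFace₁ ∨ F = facet face₀ ∨ F = facet cornerFace₃ := by
  obtain ⟨hexp, hrank⟩ := hF
  obtain ⟨l, rfl⟩ := hexp ⟨_, h0⟩
  obtain ⟨m1, m2, m3, v0, v1, v2, v3⟩ := corner_mem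
  have hmax : ∀ y ∈ stdDodecahedron, l y ≤ l vertex₀.toE := h0.2
  set F : Set E3 := {x | x ∈ stdDodecahedron ∧ ∀ y ∈ stdDodecahedron, l y ≤ l x} with hFdef
  have hmemF : ∀ x, x ∈ F ↔ x ∈ stdDodecahedron ∧ l vertex₀.toE - l x = 0 := by
    intro x
    constructor
    · rintro ⟨hx, h⟩
      exact ⟨hx, sub_eq_zero.2 (le_antisymm (h _ h0.1) (hmax x hx))⟩
    · rintro ⟨hx, h⟩
      refine ⟨hx, fun y hy => ?_⟩
      rw [← sub_eq_zero.1 h]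
      exact hmax y hy
  have c1 := sub_nonneg.2 (hmax _ (vertex_mem v1))
  have c2 := sub_nonneg.2 (hmax _ (vertex_mem v2))
  have c3 := sub_nonneg.2 (hmax _ (vertex_mem v3))
  have hd := functional_decomposition l
  set a1 := l vertex₀.toE - l vertex₁.toE
  set a2 := l vertex₀.toE - l vertex₂.toE
  set a3 := l vertex₀.toE - l vertex₃.toE
  have hpos : ∀ x ∈ stdDodecahedron,
      0 ≤ (Real.goldenRatio + 1 - inner ℝ cornerFace₁.toE x) / 2 ∧
      0 ≤ (Real.goldenRatio + 1 - inner ℝ face₀.toE x) / 2 ∧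
      0 ≤ (Real.goldenRatio + 1 - inner ℝ cornerFace₃.toE x) / 2 := fun x hx =>
    ⟨by linarith [inner_face_le m1 hx], by linarith [inner_face_le m2 hx],
      by linarith [inner_face_le m3 hx]⟩
  have hzero : ∀ x ∈ F, (0 < a1 → inner ℝ cornerFace₁.toE x = Real.goldenRatio + 1) ∧
      (0 < a2 → inner ℝ face₀.toE x = Real.goldenRatio + 1) ∧
      (0 < a3 → inner ℝ cornerFace₃.toE x = Real.goldenRatio + 1) := by
    intro x hx
    obtain ⟨hx, h⟩ := (hmemF x).1 hx
    obtain ⟨p1, p2, p3⟩ := hpos x hx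
    rw [hd x] at h
    have q1 := mul_nonneg p1 c1
    have q2 := mul_nonneg p2 c2
    have q3 := mul_nonneg p3 c3
    refine ⟨fun ha => ?_, fun ha => ?_, fun ha => ?_⟩
    · have := (mul_eq_zero.1 (le_antisymm (by linarith) q1)).resolve_right ha.ne'
      linarith
    · have := (mul_eq_zero.1 (le_antisymm (by linarith) q2)).resolve_right ha.ne'
      linarith
    · have := (mul_eq_zero.1 (le_antisymm (by linarith) q3)).resolve_right ha.ne'
      linarith
  have two : ∀ f g : ZVec, ZVec.cross f g ≠ ⟨0, 0, 0⟩ →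
      ¬ ∀ x ∈ F, inner ℝ f.toE x = Real.goldenRatio + 1 ∧
        inner ℝ g.toE x = Real.goldenRatio + 1 := by
    intro f g hfg h
    have := finrank_vectorSpan_le_one (by rwa [cross_toE, Ne, toE_eq_zero]) h
    omega
  rcases c1.eq_or_lt with e1 | e1 <;> rcases c2.eq_or_lt with e2 | e2 <;>
    rcases c3.eq_or_lt with e3 | e3
  · exfalso
    have : F = stdDodecahedron := by
      ext x
      rw [hmemF, hd x, ← e1, ← e2, ← e3]
      simp
    rw [this, finrank_vectorSpan_stdDodecahedron] at hrank
    omega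
  · refine Or.inr (Or.inr ?_)
    ext x
    refine ⟨fun hx => ⟨hx.1, (hzero x hx).2.2 e3⟩, fun hx => (hmemF x).2 ⟨hx.1, ?_⟩⟩
    rw [hd, ← e1, ← e2, hx.2]; ring
  · refine Or.inr (Or.inl ?_)
    ext x
    refine ⟨fun hx => ⟨hx.1, (hzero x hx).2.1 e2⟩, fun hx => (hmemF x).2 ⟨hx.1, ?_⟩⟩
    rw [hd, ← e1, ← e3, hx.2]; ring
  · exact absurd (fun x hx => ⟨(hzero x hx).2.1 e2, (hzero x hx).2.2 e3⟩)
      (two face₀ cornerFace₃ (by decide))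
  · refine Or.inl ?_
    ext x
    refine ⟨fun hx => ⟨hx.1, (hzero x hx).1 e1⟩, fun hx => (hmemF x).2 ⟨hx.1, ?_⟩⟩
    rw [hd, ← e2, ← e3, hx.2]; ring
  · exact absurd (fun x hx => ⟨(hzero x hx).1 e1, (hzero x hx).2.2 e3⟩)
      (two cornerFace₁ cornerFace₃ (by decide))
  · exact absurd (fun x hx => ⟨(hzero x hx).1 e1, (hzero x hx).2.1 e2⟩)
      (two cornerFace₁ face₀ (by decide))
  · exact absurd (fun x hx => ⟨(hzero x hx).1 e1, (hzero x hx).2.1 e2⟩)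
      (two cornerFace₁ face₀ (by decide))

theorem vertex_mem_extremePoints {F : Set E3} (hF : F ⊆ stdDodecahedron) {v : ZVec}
    (hv : v ∈ vertexList) (hvF : v.toE ∈ F) : v.toE ∈ F.extremePoints ℝ := by
  refine inter_extremePoints_subset_extremePoints_of_subset hF ⟨hvF, ?_⟩
  rw [extremePoints_stdDodecahedron]
  exact mem_stdDodecahedronVertices.2 ⟨v, hv, rfl⟩

/-- The vertices have equal norm, so a point equidistant from `vertex₀`, `a`, `b` has equal inner
products with them. It is therefore orthogonal to two independent differences, hence parallel to
`f`, and `f · c = φ + 1 > 0` fixes the direction. -/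
theorem isRadialProjection_facet_centre {f a b : ZVec} (ha : a ∈ vertexList) (hb : b ∈ vertexList)
    (h0 : dot f vertex₀ = phi + 1) (hfa : dot f a = phi + 1) (hfb : dot f b = phi + 1)
    (hpar : ZVec.cross (ZVec.cross ⟨1 - a.x, 1 - a.y, 1 - a.z⟩ ⟨1 - b.x, 1 - b.y, 1 - b.z⟩) f =
      ⟨0, 0, 0⟩)
    (hne : ZVec.cross ⟨1 - a.x, 1 - a.y, 1 - a.z⟩ ⟨1 - b.x, 1 - b.y, 1 - b.z⟩ ≠ ⟨0, 0, 0⟩)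
    {c : E3} (hc : IsFaceCentre (facet f) c) {X : S2} (hX : IsRadialProjection X c) :
    IsRadialProjection X f.toE := by
  obtain ⟨hcF, ρ, hρ⟩ := hc
  have hF : facet f ⊆ stdDodecahedron := fun x hx => hx.1
  have key : ∀ v ∈ vertexList, dot f v = phi + 1 → inner ℝ v.toE c = (3 + ‖c‖ ^ 2 - ρ ^ 2) / 2 := by
    intro v hv hfv
    have h1 := hρ v.toE (vertex_mem_extremePoints hF hv ⟨vertex_mem hv, by
      rw [inner_toE, hfv, toReal_phi_add_one]⟩)
    have h2 := norm_sub_sq_real v.toE c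
    rw [← dist_eq_norm, h1, norm_sq_vertex (mem_stdDodecahedronVertices.2 ⟨v, hv, rfl⟩)] at h2
    linarith
  have k0 := key vertex₀ corner_mem.2.2.2.1 h0
  have ka := key a ha hfa
  have kb := key b hb hfb
  set a' : ZVec := ⟨1 - a.x, 1 - a.y, 1 - a.z⟩
  set b' : ZVec := ⟨1 - b.x, 1 - b.y, 1 - b.z⟩
  have ea : vertex₀.toE - a.toE = a'.toE := by
    apply E3.ext <;> simp only [PiLp.sub_apply, toE_zero, toE_one, toE_two, a', toReal_sub] <;> rfl
  have eb : vertex₀.toE - b.toE = b'.toE := by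
    apply E3.ext <;> simp only [PiLp.sub_apply, toE_zero, toE_one, toE_two, b', toReal_sub] <;> rfl
  have ha0 : inner ℝ a'.toE c = 0 := by rw [← ea, inner_sub_left, k0, ka, sub_self]
  have hb0 : inner ℝ b'.toE c = 0 := by rw [← eb, inner_sub_left, k0, kb, sub_self]
  set w := ZVec.cross a' b' with hw
  have hwc : E3.cross w.toE c = 0 := by
    rw [hw, ← cross_toE]
    rw [E3.inner_eq] at ha0 hb0
    apply E3.ext <;> simp only [E3.cross_zero, E3.cross_one, E3.cross_two, PiLp.zero_apply]
    · linear_combination b'.toE 0 * ha0 - a'.toE 0 * hb0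
    · linear_combination b'.toE 1 * ha0 - a'.toE 1 * hb0
    · linear_combination b'.toE 2 * ha0 - a'.toE 2 * hb0
  have e1 := E3.smul_eq_of_cross_eq_zero hwc
  have hwf : E3.cross w.toE f.toE = 0 := by rw [cross_toE, hpar, toE_eq_zero]
  have hfc : E3.cross f.toE c = 0 := by
    have hw0 : ‖w.toE‖ ^ 2 ≠ 0 := by
      refine pow_ne_zero 2 (norm_ne_zero_iff.2 ?_)
      rwa [Ne, toE_eq_zero]
    refine (smul_eq_zero.1 (?_ : (‖w.toE‖ ^ 2) • E3.cross f.toE c = 0)).resolve_left hw0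
    have : (‖w.toE‖ ^ 2) • E3.cross f.toE c = E3.cross f.toE ((‖w.toE‖ ^ 2) • c) := by
      apply E3.ext <;> simp only [E3.cross_zero, E3.cross_one, E3.cross_two,
        PiLp.smul_apply, smul_eq_mul] <;> ring
    rw [this, e1]
    have h0 := congrArg (fun w : E3 => w 0) hwf
    have h1 := congrArg (fun w : E3 => w 1) hwf
    have h2 := congrArg (fun w : E3 => w 2) hwf
    simp only [E3.cross_zero, E3.cross_one, E3.cross_two, PiLp.zero_apply] at h0 h1 h2
    apply E3.ext <;> simp only [E3.cross_zero, E3.cross_one, E3.cross_two,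
        PiLp.smul_apply, smul_eq_mul, PiLp.zero_apply]
    · linear_combination -(inner ℝ w.toE c) * h0
    · linear_combination -(inner ℝ w.toE c) * h1
    · linear_combination -(inner ℝ w.toE c) * h2
  have e2 := E3.smul_eq_of_cross_eq_zero hfc
  have hpos := Real.goldenRatio_pos
  rw [hcF.2] at e2
  have hf0 : f.toE ≠ 0 := by
    intro h
    have := hcF.2
    rw [h, inner_zero_left] at this
    linarith
  rw [← IsRadialProjection.smul_iff (by positivity : 0 < Real.goldenRatio + 1), ← e2,
    IsRadialProjection.smul_iff (by positivity)]
  exact hX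

theorem onSphere_mem_points_std {g : E3 ≃ₗᵢ[ℝ] E3} (hg : g ∈ rotationGroup stdDodecahedron)
    {X : S2} :
    (X ∈ facePoints stdDodecahedron → onSphere g X ∈ facePoints stdDodecahedron) ∧
    (X ∈ edgePoints stdDodecahedron → onSphere g X ∈ edgePoints stdDodecahedron) := by
  have := @onSphere_mem_points stdDodecahedron 1 one_pos g X
  rw [similarity_one_image, hg.2] at this
  exact this.2

theorem exists_rotation_to_vertex₀ {u : E3} (hu : u ∈ stdDodecahedronVertices) :
    ∃ g ∈ rotationGroup stdDodecahedron, g u = vertex₀.toE := by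
  obtain ⟨v, hv, rfl⟩ := mem_stdDodecahedronVertices.1 hu
  obtain ⟨q, hq, h⟩ := exists_icosian_act_vertex₀ v hv
  refine ⟨_, inv_mem (rotIso_icosianUnit_mem q hq), ?_⟩
  rw [← icosianUnit_apply (hq := hq) h]
  exact (rotIso (icosianUnit q hq)).symm_apply_apply _

/-- A compact face has an extreme point, which is a vertex of the solid. Rotating it to `vertex₀`
leaves only the three faces of that corner. -/
theorem facePoints_subset : facePoints stdDodecahedron ⊆ radialSet faceList := by
  rintro X ⟨F, c, hF, hc, hX⟩
  have hne : F.Nonempty := ⟨c, hc.1⟩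
  have hcomp : IsCompact stdDodecahedron := finite_stdDodecahedronVertices.isCompact_convexHull (𝕜 := ℝ)
  obtain ⟨u, hu⟩ := (hF.1.isCompact hcomp).extremePoints_nonempty hne
  have huV : u ∈ stdDodecahedronVertices := by
    rw [← extremePoints_stdDodecahedron]
    exact hF.1.isExtreme.extremePoints_subset_extremePoints hu
  obtain ⟨g, hg, hgu⟩ := exists_rotation_to_vertex₀ huV
  have hF' := hF.image_equiv (similarity 1 one_pos.ne' g)
  have hc' := hc.image_similarity one_pos g
  have hX' := hX.similarity one_pos g
  rw [similarity_one_image] at hF' hc'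
  rw [similarity_one_image, hg.2] at hF'
  set c' := similarity 1 one_pos.ne' g c
  obtain ⟨B, hB⟩ := exists_faceBase
  suffices h : onSphere g X ∈ radialSet faceList by
    rw [← rotationOrbit_faceBase hB] at h ⊢
    have := onSphere_mem_rotationOrbit (inv_mem hg) h
    rw [map_inv] at this
    simpa using this
  rcases twoFace_eq_facet hF' ⟨u, hu.1, hgu⟩ with h | h | h <;> rw [h] at hc'
  · exact ⟨_, corner_mem.1, isRadialProjection_facet_centre corner_mem.2.2.2.2.2.1
      corner_mem.2.2.2.2.2.2 (by decide +kernel) (by decide +kernel) (by decide +kernel)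
      (by decide +kernel) (by decide +kernel) hc' hX'⟩
  · exact ⟨_, corner_mem.2.1, isRadialProjection_facet_centre corner_mem.2.2.2.2.1
      corner_mem.2.2.2.2.2.2 (by decide +kernel) (by decide +kernel) (by decide +kernel)
      (by decide +kernel) (by decide +kernel) hc' hX'⟩
  · exact ⟨_, corner_mem.2.2.1, isRadialProjection_facet_centre corner_mem.2.2.2.2.1
      corner_mem.2.2.2.2.2.1 (by decide +kernel) (by decide +kernel) (by decide +kernel)
      (by decide +kernel) (by decide +kernel) hc' hX'⟩

/-- The vertices of the reference face. -/
def faceVertices : Fin 5 → ZVec :=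
  ![⟨1, 1, 1⟩, ⟨1, -1, 1⟩, ⟨0, psi, phi⟩, ⟨0, -psi, phi⟩, ⟨phi, 0, psi⟩]

theorem faceVertices_mem : ∀ i, faceVertices i ∈ vertexList ∧
    dot face₀ (faceVertices i) = phi + 1 := by decide +kernel

theorem sum_faceVertices : ∑ i, (5⁻¹ : ℝ) • (faceVertices i).toE =
    ((Real.goldenRatio + 2) / 5) • face₀.toE := by
  have h := Real.goldenRatio_sq
  rw [Fin.sum_univ_five]
  apply E3.ext <;> simp only [PiLp.add_apply, PiLp.smul_apply, smul_eq_mul, toE_zero, toE_one,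
    toE_two, faceVertices, face₀, Matrix.cons_val, toReal_phi, toReal_psi_eq, toReal_one,
    toReal_zero, toReal_neg]
  · ring
  · ring
  · linear_combination (-1 / 5) * h

theorem isTwoFace_facet : IsTwoFace stdDodecahedron (facet face₀) := by
  obtain ⟨m1, m2, m3, v0, v1, v2, v3⟩ := corner_mem
  constructor
  · intro _
    refine ⟨innerSL ℝ face₀.toE, ?_⟩
    ext x
    simp only [innerSL_apply_apply]
    constructor
    · rintro ⟨hx, h⟩
      refine ⟨hx, fun y hy => ?_⟩
      rw [h]; exact inner_face_le m2 hy
    · rintro ⟨hx, h⟩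
      refine ⟨hx, le_antisymm (inner_face_le m2 hx) ?_⟩
      rw [← inner_vertex₀.2.1]
      exact h _ (vertex_mem v0)
  · apply le_antisymm
    · have h : vectorSpan ℝ (facet face₀) ≤ (Submodule.span ℝ {face₀.toE})ᗮ := by
        refine Submodule.span_le.2 ?_
        rintro _ ⟨x, hx, y, hy, rfl⟩
        change x - y ∈ (Submodule.span ℝ {face₀.toE})ᗮ
        rw [Submodule.mem_orthogonal_singleton_iff_inner_right, inner_sub_right, hx.2, hy.2,
          sub_self]
      have : Fact (Module.finrank ℝ E3 = 2 + 1) := ⟨finrank_euclideanSpace_fin⟩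
      have h0 : face₀.toE ≠ 0 := by rw [Ne, toE_eq_zero]; decide
      exact (Submodule.finrank_mono h).trans (Submodule.finrank_orthogonal_span_singleton h0).le
    · have hm : ∀ v ∈ vertexList, dot face₀ v = phi + 1 → v.toE ∈ facet face₀ := fun v hv h =>
        ⟨vertex_mem hv, by rw [inner_toE, h, toReal_phi_add_one]⟩
      have k0 := hm _ v0 (by decide +kernel)
      refine finrank_ge_two (vsub_mem_vectorSpan ℝ (hm _ v1 (by decide +kernel)) k0)
        (vsub_mem_vectorSpan ℝ (hm _ v3 (by decide +kernel)) k0) ?_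
      intro h
      have h2 := congrArg (fun w : E3 => w 0) h
      have h3 := Real.one_lt_goldenRatio
      have h4 := Real.goldenRatio_sq
      simp only [E3.cross_zero, vsub_eq_sub, PiLp.sub_apply, toE_one, toE_two, vertex₀,
        vertex₁, vertex₃, toReal_phi, toReal_psi_eq, toReal_one, toReal_zero, PiLp.zero_apply] at h2
      nlinarith

/-- The point is the centroid of the five vertices. The radius comes from `‖v - c‖² = ‖v‖² - 2 v · c
+ ‖c‖²`, where `‖v‖² = 3` and `v · c` is the same for all vertices of the face. -/
theorem isFaceCentre_facet :
    IsFaceCentre (facet face₀) (((Real.goldenRatio + 2) / 5) • face₀.toE) := by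
  set c := ((Real.goldenRatio + 2) / 5) • face₀.toE with hc
  have hF : IsTwoFace stdDodecahedron (facet face₀) := isTwoFace_facet
  refine ⟨⟨?_, ?_⟩, Real.sqrt (3 - 2 * ((Real.goldenRatio + 2) / 5 * (Real.goldenRatio + 1))
    + ‖c‖ ^ 2), ?_⟩
  · rw [hc, ← sum_faceVertices]
    refine (convex_convexHull ℝ _).sum_mem (fun i _ => by positivity) ?_
      (fun i _ => vertex_mem (faceVertices_mem i).1)
    simp
  · have h : dot face₀ face₀ = phi + 2 := by decide +kernel
    rw [hc, inner_smul_right, inner_toE, h, toReal_add, toReal_phi, toReal_two]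
    have h := Real.goldenRatio_sq
    linear_combination h / 5
  · intro v hv
    have hvV : v ∈ stdDodecahedronVertices := by
      rw [← extremePoints_stdDodecahedron]
      exact hF.1.isExtreme.extremePoints_subset_extremePoints hv
    have h1 : inner ℝ v c = (Real.goldenRatio + 2) / 5 * (Real.goldenRatio + 1) := by
      rw [hc, inner_smul_right, real_inner_comm, hv.1.2]
    rw [dist_eq_norm, ← h1, ← norm_sq_vertex hvV, ← norm_sub_sq_real, Real.sqrt_sq (norm_nonneg _)]

theorem facePoints_std : facePoints stdDodecahedron = radialSet faceList := by
  refine subset_antisymm facePoints_subset ?_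
  obtain ⟨B, hB⟩ := exists_faceBase
  have hpos := Real.goldenRatio_pos
  have hBF : B ∈ facePoints stdDodecahedron :=
    ⟨_, _, isTwoFace_facet, isFaceCentre_facet,
      (IsRadialProjection.smul_iff (by positivity)).2 hB⟩
  rw [← rotationOrbit_faceBase hB]
  rintro _ ⟨g, hg, rfl⟩
  exact (onSphere_mem_points_std hg).1 hBF

theorem vertexPoints_std : vertexPoints stdDodecahedron = radialSet vertexList := by
  ext X
  constructor
  · rintro ⟨v, hv, h⟩
    rw [extremePoints_stdDodecahedron] at hv
    obtain ⟨w, hw, rfl⟩ := mem_stdDodecahedronVertices.1 hv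
    exact ⟨w, hw, h⟩
  · rintro ⟨w, hw, h⟩
    refine ⟨_, ?_, h⟩
    rw [extremePoints_stdDodecahedron]
    exact mem_stdDodecahedronVertices.2 ⟨w, hw, rfl⟩

/-! ### Edges -/

theorem dot_corner : ∀ v ∈ vertexList, v = vertex₀ ∨ v = vertex₁ ∨ v = vertex₂ ∨ v = vertex₃ ∨
    (dot cornerFace₁ v ≠ phi + 1 ∧ dot face₀ v ≠ phi + 1) ∨
    (dot cornerFace₁ v ≠ phi + 1 ∧ dot cornerFace₃ v ≠ phi + 1) ∨
    (dot face₀ v ≠ phi + 1 ∧ dot cornerFace₃ v ≠ phi + 1) := by decide +kernel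

/-- A functional exposing the edge has deficit zero at `w`, so all products of slack and drop vanish
there. If `w` is not a neighbour, some slack at `w` is positive and the matching drop is zero; the
corresponding neighbour then lies on the segment and, being extreme, equals `w`. -/
theorem edge_at_vertex₀ {w : ZVec} (hw : w ∈ vertexList)
    (h : IsEdge stdDodecahedron vertex₀.toE w.toE) :
    w = vertex₁ ∨ w = vertex₂ ∨ w = vertex₃ := by
  obtain ⟨hne, hexp⟩ := h
  have hsub : segment ℝ vertex₀.toE w.toE ⊆ stdDodecahedron := hexp.subset
  obtain ⟨l, hl⟩ := hexp ⟨_, left_mem_segment ℝ _ _⟩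
  obtain ⟨m1, m2, m3, v0, v1, v2, v3⟩ := corner_mem
  have h0 : vertex₀.toE ∈ segment ℝ vertex₀.toE w.toE := left_mem_segment ℝ _ _
  have hw' : w.toE ∈ segment ℝ vertex₀.toE w.toE := right_mem_segment ℝ _ _
  have hmax : ∀ y ∈ stdDodecahedron, l y ≤ l vertex₀.toE := by
    rw [hl] at h0; exact h0.2
  have hlw : l vertex₀.toE - l w.toE = 0 := by
    rw [hl] at hw'
    exact sub_eq_zero.2 (le_antisymm (hw'.2 _ (vertex_mem v0)) (hmax _ hw'.1))
  have hmem : ∀ v ∈ vertexList, l vertex₀.toE - l v.toE = 0 → v = vertex₀ ∨ v = w := by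
    intro v hv h
    have h1 : v.toE ∈ segment ℝ vertex₀.toE w.toE := by
      rw [hl]
      refine ⟨vertex_mem hv, fun y hy => ?_⟩
      rw [← sub_eq_zero.1 h]; exact hmax y hy
    have h2 := vertex_mem_extremePoints hsub hv h1
    rw [← convexHull_pair] at h2
    rcases extremePoints_convexHull_subset h2 with h3 | h3
    · exact Or.inl (toE_injective h3)
    · exact Or.inr (toE_injective h3)
  have c1 := sub_nonneg.2 (hmax _ (vertex_mem v1))
  have c2 := sub_nonneg.2 (hmax _ (vertex_mem v2))
  have c3 := sub_nonneg.2 (hmax _ (vertex_mem v3))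
  have hd := functional_decomposition l w.toE
  rw [hlw] at hd
  have hpos : ∀ f ∈ faceList, 0 ≤ (Real.goldenRatio + 1 - inner ℝ f.toE w.toE) / 2 ∧
      (dot f w ≠ phi + 1 → 0 < (Real.goldenRatio + 1 - inner ℝ f.toE w.toE) / 2) := by
    intro f hf
    have h1 := inner_face_le hf (vertex_mem hw)
    refine ⟨by linarith, fun h => ?_⟩
    have : inner ℝ f.toE w.toE ≠ Real.goldenRatio + 1 := by
      rw [inner_toE, ← toReal_phi_add_one]
      exact toReal_injective.ne h
    have := lt_of_le_of_ne h1 this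
    linarith
  obtain ⟨p1, p1'⟩ := hpos _ m1
  obtain ⟨p2, p2'⟩ := hpos _ m2
  obtain ⟨p3, p3'⟩ := hpos _ m3
  have q1 := mul_nonneg p1 c1
  have q2 := mul_nonneg p2 c2
  have q3 := mul_nonneg p3 c3
  have z1 := mul_eq_zero.1 (le_antisymm (by linarith) q1)
  have z2 := mul_eq_zero.1 (le_antisymm (by linarith) q2)
  have z3 := mul_eq_zero.1 (le_antisymm (by linarith) q3)
  have d1 : vertex₁ ≠ vertex₀ := by decide
  have d2 : vertex₂ ≠ vertex₀ := by decide
  have d3 : vertex₃ ≠ vertex₀ := by decide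
  rcases dot_corner w hw with h | h | h | h | ⟨k1, k2⟩ | ⟨k1, k2⟩ | ⟨k1, k2⟩
  · exact absurd (by rw [h]) hne
  · exact Or.inl h
  · exact Or.inr (Or.inl h)
  · exact Or.inr (Or.inr h)
  · exact Or.inl ((hmem _ v1 (z1.resolve_left (p1' k1).ne')).resolve_left d1).symm
  · exact Or.inl ((hmem _ v1 (z1.resolve_left (p1' k1).ne')).resolve_left d1).symm
  · exact Or.inr (Or.inl ((hmem _ v2 (z2.resolve_left (p2' k1).ne')).resolve_left d2).symm)

theorem IsEdge.mem_extremePoints {P : Set E3} {u v : E3} (h : IsEdge P u v) :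
    u ∈ P.extremePoints ℝ ∧ v ∈ P.extremePoints ℝ := by
  have key : ∀ a b : E3, a ≠ b → a ∈ (segment ℝ a b).extremePoints ℝ := by
    intro a b hab
    rw [mem_extremePoints_iff_left]
    refine ⟨left_mem_segment ℝ a b, ?_⟩
    intro x hx y hy hxy
    rw [segment_eq_image'] at hx hy
    obtain ⟨s, ⟨hs, -⟩, rfl⟩ := hx
    obtain ⟨t, ⟨ht, -⟩, rfl⟩ := hy
    obtain ⟨c, d, hc, hd, hcd, h⟩ := hxy
    have h1 : (c * s + d * t) • (b - a) = 0 := by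
      have : c • (a + s • (b - a)) + d • (a + t • (b - a)) =
          (c + d) • a + (c * s + d * t) • (b - a) := by module
      rw [this, hcd, one_smul] at h
      simpa using h
    have h2 := (smul_eq_zero.1 h1).resolve_right (sub_ne_zero.2 hab.symm)
    have h3 : s = 0 := by
      have := mul_nonneg hc.le hs
      have := mul_nonneg hd.le ht
      exact (mul_eq_zero.1 (by linarith : c * s = 0)).resolve_left hc.ne'
    simp [h3]
  have h1 := h.2.isExtreme.extremePoints_subset_extremePoints
  refine ⟨h1 (key u v h.1), h1 ?_⟩
  rw [segment_symm]
  exact key v u h.1.symm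

theorem midpoint_corner : ∀ v ∈ [vertex₁, vertex₂, vertex₃], ∃ e ∈ edgeList,
    ZVec.mk (1 + v.x) (1 + v.y) (1 + v.z) = scale phi e := by decide +kernel

theorem isRadialProjection_midpoint {X : S2} {v : ZVec} (hv : v ∈ [vertex₁, vertex₂, vertex₃])
    (h : IsRadialProjection X (midpoint ℝ vertex₀.toE v.toE)) : X ∈ radialSet edgeList := by
  obtain ⟨e, he, hev⟩ := midpoint_corner v hv
  refine ⟨e, he, ?_⟩
  have hpos := Real.goldenRatio_pos
  have h1 : midpoint ℝ vertex₀.toE v.toE = (2⁻¹ * Real.goldenRatio) • e.toE := by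
    have h2 := toE_scale phi e
    rw [← hev, toReal_phi] at h2
    rw [midpoint_eq_smul_add, mul_smul, ← h2, invOf_eq_inv]
    congr 1
    apply E3.ext <;> simp only [PiLp.add_apply, toE_zero, toE_one, toE_two, vertex₀,
      toReal_add]
  rwa [h1, IsRadialProjection.smul_iff (by positivity)] at h

theorem edgePoints_subset : edgePoints stdDodecahedron ⊆ radialSet edgeList := by
  rintro X ⟨u, v, he, hX⟩
  have hu := he.mem_extremePoints.1
  rw [extremePoints_stdDodecahedron] at hu
  obtain ⟨g, hg, hgu⟩ := exists_rotation_to_vertex₀ hu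
  have he' := he.image_equiv (similarity 1 one_pos.ne' g)
  have hX' := hX.onSphere g
  rw [similarity_one_image, hg.2] at he'
  simp only [similarity_apply, one_smul, hgu] at he'
  have hmid : g (midpoint ℝ u v) = midpoint ℝ (g u) (g v) :=
    g.toLinearEquiv.toAffineEquiv.map_midpoint u v
  rw [hmid, hgu] at hX'
  obtain ⟨B, hB⟩ := exists_edgeBase
  suffices h : onSphere g X ∈ radialSet edgeList by
    rw [← rotationOrbit_edgeBase hB] at h ⊢
    have := onSphere_mem_rotationOrbit (inv_mem hg) h
    rw [map_inv] at this
    simpa using this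
  have hv := he'.mem_extremePoints.2
  rw [extremePoints_stdDodecahedron] at hv
  obtain ⟨w, hw, hwv⟩ := mem_stdDodecahedronVertices.1 hv
  rw [← hwv] at he' hX'
  refine isRadialProjection_midpoint ?_ hX'
  simpa using edge_at_vertex₀ hw he'

theorem dot_edge : ∀ v ∈ vertexList, v = vertex₀ ∨ v = vertex₁ ∨ dot edge₀ v = 2 ∨
    dot edge₀ v = 0 ∨ dot edge₀ v = -2 ∨ dot edge₀ v = -(2 * phi) ∨
    dot edge₀ v = 2 * phi - 2 ∨ dot edge₀ v = 2 - 2 * phi := by decide +kernel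

/-- The direction of the midpoint exposes the edge: its maximum `2φ` over the vertices is attained
only at the two endpoints, and by Krein–Milman the exposed face is the hull of its extreme points.
-/
theorem isEdge_std : IsEdge stdDodecahedron vertex₀.toE vertex₁.toE := by
  refine ⟨toE_injective.ne (by decide), ?_⟩
  obtain ⟨m1, m2, m3, v0, v1, v2, v3⟩ := corner_mem
  set F := (innerSL ℝ edge₀.toE).toExposed stdDodecahedron with hFdef
  have hF : IsExposed ℝ stdDodecahedron F := ContinuousLinearMap.toExposed.isExposed
  have hcomp : IsCompact stdDodecahedron :=
    finite_stdDodecahedronVertices.isCompact_convexHull (𝕜 := ℝ)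
  have hφ := Real.one_lt_goldenRatio
  have d0 : dot edge₀ vertex₀ = 2 * phi := by decide +kernel
  have d1 : dot edge₀ vertex₁ = 2 * phi := by decide +kernel
  have e2 : (2 * phi).toReal = 2 * Real.goldenRatio := by rw [toReal_mul, toReal_two, toReal_phi]
  have hlt : ∀ v ∈ vertexList, v = vertex₀ ∨ v = vertex₁ ∨
      inner ℝ edge₀.toE v.toE < 2 * Real.goldenRatio := by
    intro v hv
    rw [inner_toE]
    rcases dot_edge v hv with h | h | h | h | h | h | h | h
    · exact Or.inl h
    · exact Or.inr (Or.inl h)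
    all_goals
      refine Or.inr (Or.inr ?_)
      rw [h]
      simp only [toReal_neg, toReal_sub, e2, toReal_two, toReal_zero]
      linarith
  have hle : ∀ x ∈ stdDodecahedron, inner ℝ edge₀.toE x ≤ 2 * Real.goldenRatio := by
    intro x hx
    have hconv : Convex ℝ {x : E3 | inner ℝ edge₀.toE x ≤ 2 * Real.goldenRatio} :=
      convex_halfSpace_le (innerₛₗ ℝ edge₀.toE).isLinear _
    refine convexHull_min (fun x hx => ?_) hconv hx
    obtain ⟨v, hv, rfl⟩ := mem_stdDodecahedronVertices.1 hx
    change inner ℝ edge₀.toE v.toE ≤ _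
    rcases hlt v hv with rfl | rfl | h
    · rw [inner_toE, d0, e2]
    · rw [inner_toE, d1, e2]
    · exact h.le
  have k0 : vertex₀.toE ∈ F := by
    refine ⟨vertex_mem v0, fun y hy => ?_⟩
    simp only [innerSL_apply_apply]
    rw [inner_toE _ vertex₀, d0, e2]; exact hle y hy
  have k1 : vertex₁.toE ∈ F := by
    refine ⟨vertex_mem v1, fun y hy => ?_⟩
    simp only [innerSL_apply_apply]
    rw [inner_toE _ vertex₁, d1, e2]; exact hle y hy
  have hext : F.extremePoints ℝ ⊆ {vertex₀.toE, vertex₁.toE} := by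
    intro x hx
    have hxV := hF.isExtreme.extremePoints_subset_extremePoints hx
    rw [extremePoints_stdDodecahedron] at hxV
    obtain ⟨v, hv, rfl⟩ := mem_stdDodecahedronVertices.1 hxV
    rcases hlt v hv with rfl | rfl | h
    · exact Or.inl rfl
    · exact Or.inr rfl
    · have h1 := hx.1.2 _ (vertex_mem v0)
      simp only [innerSL_apply_apply] at h1
      rw [inner_toE _ vertex₀, d0, e2] at h1
      exact absurd h (not_lt.2 h1)
  have hFconv : Convex ℝ F := hF.convex (convex_convexHull ℝ _)
  have : segment ℝ vertex₀.toE vertex₁.toE = F := by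
    refine subset_antisymm (hFconv.segment_subset k0 k1) ?_
    rw [← closure_convexHull_extremePoints (hF.isCompact hcomp) hFconv]
    refine closure_minimal ?_ ?_
    · rw [← convexHull_pair]
      exact convexHull_mono hext
    · rw [← convexHull_pair]
      exact (Set.toFinite _).isClosed_convexHull (𝕜 := ℝ)
  rw [this]
  exact hF

theorem edgePoints_std : edgePoints stdDodecahedron = radialSet edgeList := by
  refine subset_antisymm edgePoints_subset ?_
  obtain ⟨B, hB⟩ := exists_edgeBase
  have hpos := Real.goldenRatio_pos
  have hmid : midpoint ℝ vertex₀.toE vertex₁.toE = (2⁻¹ * Real.goldenRatio) • edge₀.toE := by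
    have h := Real.goldenRatio_sq
    rw [midpoint_eq_smul_add, mul_smul, invOf_eq_inv]
    congr 1
    apply E3.ext <;> simp only [PiLp.add_apply, PiLp.smul_apply, smul_eq_mul, toE_zero, toE_one,
      toE_two, vertex₀, vertex₁, edge₀, toReal_phi, toReal_psi_eq, toReal_one, toReal_zero] <;>
      linarith
  have hBF : B ∈ edgePoints stdDodecahedron :=
    ⟨_, _, isEdge_std, by
      rw [hmid]; exact (IsRadialProjection.smul_iff (by positivity)).2 hB⟩
  rw [← rotationOrbit_edgeBase hB]
  rintro _ ⟨g, hg, rfl⟩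
  exact (onSphere_mem_points_std hg).2 hBF
/-! ### Linear fractional transformations and rotations -/

/-- The action of `GL(2, ℂ)` on the Riemann sphere, as a homomorphism to permutations. -/
def mobius : GL (Fin 2) ℂ →* Equiv.Perm (OnePoint ℂ) :=
  MulAction.toPermHom (GL (Fin 2) ℂ) (OnePoint ℂ)

theorem mem_linearFractionalGroup {f : Equiv.Perm (OnePoint ℂ)} :
    f ∈ linearFractionalGroup ↔ ∃ A, mobius A = f := Iff.rfl

/-- Linear isometries as permutations of the Riemann sphere. -/
def stereoConj : (E3 ≃ₗᵢ[ℝ] E3) →* Equiv.Perm (OnePoint ℂ) :=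
  stereo.permCongrHom.toMonoidHom.comp onSphere

theorem stereoConj_apply (g : E3 ≃ₗᵢ[ℝ] E3) (x : OnePoint ℂ) :
    stereoConj g x = stereo (onSphere g (stereo.symm x)) := rfl

theorem stereoConj_injective : Function.Injective stereoConj := by
  refine stereo.permCongrHom.injective.comp ?_
  intro g h hgh
  ext1 x
  by_cases hx : x = 0
  · rw [hx, map_zero, map_zero]
  · obtain ⟨X, hX⟩ := exists_isRadialProjection hx
    have h1 : onSphere g X = onSphere h X := by rw [hgh]
    have h2 : g X.1 = h X.1 := congrArg Subtype.val h1
    rw [show X.1 = _ from hX, map_smul, map_smul] at h2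
    exact smul_right_injective _ (inv_ne_zero (norm_ne_zero_iff.2 hx)) h2

/-- The unnormalized point of the sphere with homogeneous coordinate `[w₀ : w₁]`. -/
def homVec (a b : ℂ) : E3 :=
  vec3 (2 * (a.re * b.re + a.im * b.im)) (2 * (a.im * b.re - a.re * b.im))
    (Complex.normSq a - Complex.normSq b)

/-- The point of the sphere with homogeneous coordinate `[w₀ : w₁]`. -/
def homPoint (a b : ℂ) : E3 := (Complex.normSq a + Complex.normSq b)⁻¹ • homVec a b

theorem homPoint_smul {c : ℂ} (hc : c ≠ 0) (a b : ℂ) : homPoint (c * a) (c * b) = homPoint a b := by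
  have hv : homVec (c * a) (c * b) = Complex.normSq c • homVec a b := by
    apply E3.ext <;> simp only [homVec, PiLp.smul_apply, smul_eq_mul, vec3_zero, vec3_one,
      vec3_two, Complex.mul_re, Complex.mul_im, Complex.normSq_apply] <;> ring
  have h : Complex.normSq c ≠ 0 := by rwa [Ne, Complex.normSq_eq_zero]
  rw [homPoint, homPoint, hv, map_mul, map_mul, ← mul_add, mul_inv, smul_smul,
    mul_right_comm, inv_mul_cancel₀ h, one_mul]

theorem invStereo_coe (z : ℂ) : (invStereo z).1 = homPoint z 1 := by
  have e0 : (invStereo (z : OnePoint ℂ)).1 0 = 2 * z.re / (Complex.normSq z + 1) := rfl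
  have e1 : (invStereo (z : OnePoint ℂ)).1 1 = 2 * z.im / (Complex.normSq z + 1) := rfl
  have e2 : (invStereo (z : OnePoint ℂ)).1 2
    = (Complex.normSq z - 1) / (Complex.normSq z + 1) := rfl
  apply E3.ext
  · rw [e0]; simp [homPoint, homVec, vec3_zero]; ring
  · rw [e1]; simp [homPoint, homVec, vec3_one]; ring
  · rw [e2]; simp [homPoint, homVec, vec3_two]; ring

theorem invStereo_infty : (invStereo OnePoint.infty).1 = homPoint 1 0 := by
  have e0 : (invStereo OnePoint.infty).1 0 = 0 := rfl
  have e1 : (invStereo OnePoint.infty).1 1 = 0 := rfl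
  have e2 : (invStereo OnePoint.infty).1 2 = 1 := rfl
  apply E3.ext
  · rw [e0]; simp [homPoint, homVec, vec3_zero]
  · rw [e1]; simp [homPoint, homVec, vec3_one]
  · rw [e2]; simp [homPoint, homVec, vec3_two]

theorem homPoint_of_ne_zero {a b : ℂ} (hb : b ≠ 0) :
    homPoint a b = (invStereo ((a / b : ℂ) : OnePoint ℂ)).1 := by
  rw [invStereo_coe, ← homPoint_smul hb (a / b), mul_one, mul_div_cancel₀ _ hb]

theorem homPoint_zero_right {a : ℂ} (ha : a ≠ 0) :
    homPoint a 0 = (invStereo OnePoint.infty).1 := by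
  rw [invStereo_infty, ← homPoint_smul ha 1, mul_one, mul_zero]

/-- Linear fractional transformations act linearly on homogeneous coordinates. -/
theorem exists_homogeneous (x : OnePoint ℂ) : ∃ a b : ℂ, (a ≠ 0 ∨ b ≠ 0) ∧
    (invStereo x).1 = homPoint a b ∧ ∀ A : GL (Fin 2) ℂ,
      (invStereo (A • x)).1 = homPoint (A 0 0 * a + A 0 1 * b) (A 1 0 * a + A 1 1 * b) := by
  have hdet : ∀ A : GL (Fin 2) ℂ, A 0 0 * A 1 1 - A 0 1 * A 1 0 ≠ 0 := fun A => by
    have := A.det_ne_zero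
    rwa [Matrix.det_fin_two] at this
  induction x using OnePoint.rec with
  | infty =>
    refine ⟨1, 0, Or.inl one_ne_zero, invStereo_infty, fun A => ?_⟩
    simp only [mul_one, mul_zero, add_zero]
    rw [OnePoint.smul_infty_eq_ite]
    split_ifs with h
    · rw [h, homPoint_zero_right]
      intro h'
      exact hdet A (by rw [h, h']; ring)
    · rw [homPoint_of_ne_zero h]
  | coe z =>
    refine ⟨z, 1, Or.inr one_ne_zero, invStereo_coe z, fun A => ?_⟩
    simp only [mul_one]
    rw [OnePoint.smul_some_eq_ite]
    split_ifs with h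
    · rw [h, homPoint_zero_right]
      intro h'
      refine hdet A ?_
      by_cases h1 : A 1 0 = 0
      · rw [h1, zero_mul, zero_add] at h
        rw [h, h1]; ring
      · have : A 1 0 * (A 0 0 * A 1 1 - A 0 1 * A 1 0) = 0 := by
          linear_combination A 0 0 * A 1 0 * h - A 1 0 * A 1 0 * h'
        exact (mul_eq_zero.1 this).resolve_left h1
    · rw [homPoint_of_ne_zero h]

/-- The matrix in `SU(2)` attached to a unit quaternion. -/
def quatMatrix (q : ℍ[ℝ]) : Matrix (Fin 2) (Fin 2) ℂ :=
  !![⟨q.re, q.imK⟩, ⟨-q.imJ, q.imI⟩; ⟨q.imJ, q.imI⟩, ⟨q.re, -q.imK⟩]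

theorem det_quatMatrix (q : unitary ℍ[ℝ]) : (quatMatrix q.1).det = 1 := by
  have h := sq_sum_unitary q
  rw [Matrix.det_fin_two]
  apply Complex.ext
  · simp [quatMatrix]; linear_combination h
  · simp [quatMatrix]; ring

/-- The element of `GL(2, ℂ)` attached to a unit quaternion. -/
def quatGL (q : unitary ℍ[ℝ]) : GL (Fin 2) ℂ :=
  Matrix.GeneralLinearGroup.mkOfDetNeZero (quatMatrix q.1) (by rw [det_quatMatrix]; exact one_ne_zero)

theorem quatGL_apply (q : unitary ℍ[ℝ]) (i j : Fin 2) : quatGL q i j = quatMatrix q.1 i j := rfl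

/-- The rotation given by a unit quaternion is a linear fractional transformation. -/
theorem stereoConj_rotIso (q : unitary ℍ[ℝ]) : stereoConj (rotIso q) = mobius (quatGL q) := by
  ext1 x
  rw [stereoConj_apply]
  apply stereo.symm.injective
  rw [Equiv.symm_apply_apply]
  apply Subtype.ext
  change rotIso q (invStereo x).1 = (invStereo (quatGL q • x)).1
  obtain ⟨a, b, -, h1, h2⟩ := exists_homogeneous x
  rw [h1, h2, homPoint, homPoint, map_smul]
  simp only [quatGL_apply]
  set a' := quatMatrix q.1 0 0 * a + quatMatrix q.1 0 1 * b with ha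
  set b' := quatMatrix q.1 1 0 * a + quatMatrix q.1 1 1 * b with hb
  have h := sq_sum_unitary q
  have hN : Complex.normSq a' + Complex.normSq b' = Complex.normSq a + Complex.normSq b := by
    simp only [ha, hb, quatMatrix, Complex.normSq_apply, Matrix.of_apply, Matrix.cons_val,
      Complex.add_re, Complex.add_im, Complex.mul_re, Complex.mul_im]
    linear_combination (a.re ^ 2 + a.im ^ 2 + b.re ^ 2 + b.im ^ 2) * h
  rw [hN]
  congr 1
  rw [rotIso_apply]
  apply E3.ext <;> simp only [rot_apply_zero, rot_apply_one, rot_apply_two, homVec, vec3_zero,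
    vec3_one, vec3_two, ha, hb, quatMatrix, Complex.normSq_apply, Matrix.of_apply, Matrix.cons_val,
      Complex.add_re, Complex.add_im, Complex.mul_re, Complex.mul_im] <;> ring

theorem stereoConj_mem_linearFractionalGroup {g : E3 ≃ₗᵢ[ℝ] E3}
    (hg : LinearMap.det (g.toLinearEquiv : E3 →ₗ[ℝ] E3) = 1) :
    stereoConj g ∈ linearFractionalGroup := by
  obtain ⟨q, rfl⟩ := exists_rotIso_eq g hg
  rw [stereoConj_rotIso]
  exact ⟨_, rfl⟩

/-- Finite fixed points are roots of `c z² + (d - a) z - b`; three distinct roots make it vanish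
identically. -/
theorem scalar_of_three_fixed {A : GL (Fin 2) ℂ} {z₁ z₂ z₃ : ℂ} (h12 : z₁ ≠ z₂) (h13 : z₁ ≠ z₃)
    (h23 : z₂ ≠ z₃) (h1 : mobius A z₁ = z₁) (h2 : mobius A z₂ = z₂) (h3 : mobius A z₃ = z₃) :
    A 1 0 = 0 ∧ A 0 1 = 0 ∧ A 0 0 = A 1 1 := by
  have key : ∀ z : ℂ, mobius A z = z → A 0 0 * z + A 0 1 = z * (A 1 0 * z + A 1 1) := by
    intro z hz
    change A • (z : OnePoint ℂ) = z at hz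
    rw [OnePoint.smul_some_eq_ite] at hz
    split_ifs at hz with h
    · exact absurd hz (OnePoint.infty_ne_coe _)
    · rw [OnePoint.coe_eq_coe, div_eq_iff h] at hz
      exact hz
  have k1 := key _ h1
  have k2 := key _ h2
  have k3 := key _ h3
  have m12 : A 0 0 - A 1 1 = A 1 0 * (z₁ + z₂) := by
    apply mul_left_cancel₀ (sub_ne_zero.2 h12)
    linear_combination k1 - k2
  have m13 : A 0 0 - A 1 1 = A 1 0 * (z₁ + z₃) := by
    apply mul_left_cancel₀ (sub_ne_zero.2 h13)
    linear_combination k1 - k3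
  have hc : A 1 0 = 0 := by
    have : (z₂ - z₃) * A 1 0 = 0 := by linear_combination m13 - m12
    exact (mul_eq_zero.1 this).resolve_left (sub_ne_zero.2 h23)
  have had : A 0 0 = A 1 1 := by
    rw [hc, zero_mul] at m12
    exact sub_eq_zero.1 m12
  refine ⟨hc, ?_, had⟩
  rw [hc, had] at k1
  linear_combination k1

theorem mobius_eq_one_of_three_fixed {f : Equiv.Perm (OnePoint ℂ)} (hf : f ∈ linearFractionalGroup)
    {z₁ z₂ z₃ : ℂ} (h12 : z₁ ≠ z₂) (h13 : z₁ ≠ z₃)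
    (h23 : z₂ ≠ z₃) (h1 : f z₁ = z₁) (h2 : f z₂ = z₂) (h3 : f z₃ = z₃) : f = 1 := by
  obtain ⟨A, rfl⟩ := mem_linearFractionalGroup.1 hf
  obtain ⟨hc, hb, had⟩ := scalar_of_three_fixed h12 h13 h23 h1 h2 h3
  have hd : A 1 1 ≠ 0 := by
    intro h
    have := A.det_ne_zero
    rw [Matrix.det_fin_two, hc, h] at this
    simp at this
  ext1 x
  change A • x = x
  induction x using OnePoint.rec with
  | infty => rw [OnePoint.smul_infty_eq_ite, if_pos hc]
  | coe z =>
    rw [OnePoint.smul_some_eq_ite, hc, hb, had]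
    simp [hd]

/-- The stabilizer of a finite set with at least four points is finite. -/
theorem finite_setStabilizer {α : Set S2} (hα : α.Finite) (h4 : 4 ≤ α.ncard) :
    (setStabilizer α : Set (Equiv.Perm (OnePoint ℂ))).Finite := by
  set S := stereo '' α with hS
  have hSf : S.Finite := hα.image _
  have hScard : 4 ≤ S.ncard := by rwa [hS, Set.ncard_image_of_injective _ stereo.injective]
  -- Four points are asked for so that three finite ones remain when `∞` is discarded.
  have h3 : 2 < (S \ {OnePoint.infty}).ncard := by
    have := Set.pred_ncard_le_ncard_sdiff_singleton S OnePoint.infty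
    omega
  rw [Set.two_lt_ncard (hSf.subset Set.sdiff_subset)] at h3
  obtain ⟨x₁, ⟨m1, n1⟩, x₂, ⟨m2, n2⟩, x₃, ⟨m3, n3⟩, h12, h13, h23⟩ := h3
  obtain ⟨z₁, rfl⟩ := OnePoint.ne_infty_iff_exists.1 n1
  obtain ⟨z₂, rfl⟩ := OnePoint.ne_infty_iff_exists.1 n2
  obtain ⟨z₃, rfl⟩ := OnePoint.ne_infty_iff_exists.1 n3
  have hmap : ∀ f ∈ setStabilizer α, ∀ x ∈ S, f x ∈ S := by
    intro f hf x hx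
    have h := MulAction.mem_stabilizer_iff.1 hf.2
    rw [← hS] at h
    rw [← h]
    exact ⟨x, hx, rfl⟩
  have : Finite S := hSf
  -- An element is determined by its action on `S`, since fixing three points forces the identity.
  let F : setStabilizer α → (S → S) := fun f x => ⟨f.1 x.1, hmap f.1 f.2 x.1 x.2⟩
  have hinj : Function.Injective F := by
    intro f g hfg
    have h : ∀ x ∈ S, (f⁻¹ * g).1 x = x := by
      intro x hx
      have h1 : f.1 x = g.1 x := congrArg Subtype.val (congrFun hfg ⟨x, hx⟩)
      change f.1.symm (g.1 x) = x
      rw [← h1, Equiv.symm_apply_apply]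
    have h1 := mobius_eq_one_of_three_fixed (f⁻¹ * g).2.1 (z₁ := z₁) (z₂ := z₂) (z₃ := z₃)
      (fun h => h12 (by rw [h])) (fun h => h13 (by rw [h])) (fun h => h23 (by rw [h]))
      (h _ m1) (h _ m2) (h _ m3)
    exact inv_mul_eq_one.1 (Subtype.ext h1)
  have : Finite (setStabilizer α) := Finite.of_injective F hinj
  exact Set.toFinite _
/-! ### Finite groups of linear fractional transformations containing a four-group -/

/-- The Hermitian matrix `AᴴA / |det A|`. -/
def gramMatrix (A : GL (Fin 2) ℂ) : Matrix (Fin 2) (Fin 2) ℂ :=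
  ((‖A.1.det‖⁻¹ : ℝ) : ℂ) • (A.1.conjTranspose * A.1)

/-- A Gram matrix is the standard Hermitian form pulled back by `A` and scaled to determinant one.
Right translation by `U` acts as a further pull-back, so a sum over a group is invariant. -/
theorem gramMatrix_mul (A U : GL (Fin 2) ℂ) : gramMatrix (A * U) =
    ((‖U.1.det‖⁻¹ : ℝ) : ℂ) • (U.1.conjTranspose * gramMatrix A * U.1) := by
  simp only [gramMatrix, Units.val_mul, Matrix.det_mul, norm_mul, mul_inv, Complex.ofReal_mul,
    Matrix.conjTranspose_mul, Matrix.mul_smul, Matrix.smul_mul, smul_smul, Matrix.mul_assoc]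
  rw [mul_comm]

theorem gramMatrix_eq_one_of_scalar {A : GL (Fin 2) ℂ}
    (h : A 1 0 = 0 ∧ A 0 1 = 0 ∧ A 0 0 = A 1 1) : gramMatrix A = 1 := by
  obtain ⟨h1, h2, h3⟩ := h
  have hd : A.1.det = A 1 1 * A 1 1 := by
    rw [Matrix.det_fin_two]
    change A 0 0 * A 1 1 - A 0 1 * A 1 0 = _
    rw [h2, h3]; ring
  have hA : A.1 = (A 1 1) • (1 : Matrix (Fin 2) (Fin 2) ℂ) := by
    ext i j
    fin_cases i <;> fin_cases j <;> simp [h1, h2, h3]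
  obtain ⟨d, hd'⟩ : ∃ d, A 1 1 = d := ⟨_, rfl⟩
  rw [hd'] at hd hA
  have h0 : ‖d‖ ≠ 0 := by
    intro h
    rw [norm_eq_zero] at h
    exact A.det_ne_zero (by rw [hd, h, mul_zero])
  rw [gramMatrix, hd, hA, Matrix.conjTranspose_smul, Matrix.conjTranspose_one, Matrix.smul_mul,
    one_mul, smul_smul, smul_smul, norm_mul, mul_assoc, Complex.star_def, Complex.conj_mul']
  have : (((‖d‖ * ‖d‖)⁻¹ : ℝ) : ℂ) * (‖d‖ : ℂ) ^ 2 = 1 := by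
    push_cast
    have : (‖d‖ : ℂ) ≠ 0 := by exact_mod_cast h0
    field_simp
  rw [this, one_smul]

/-- The matrix `AᴴA / |det A|` depends only on the linear fractional transformation. -/
theorem gramMatrix_eq_of_mobius_eq {A B : GL (Fin 2) ℂ} (h : mobius A = mobius B) :
    gramMatrix A = gramMatrix B := by
  have h1 : mobius (B * A⁻¹) = 1 := by rw [map_mul, ← h, ← map_mul, mul_inv_cancel, map_one]
  have h2 : gramMatrix (B * A⁻¹) = 1 := by
    refine gramMatrix_eq_one_of_scalar (scalar_of_three_fixed (z₁ := 0) (z₂ := 1) (z₃ := 2)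
      (by norm_num) (by norm_num) (by norm_num) ?_ ?_ ?_) <;> rw [h1] <;> rfl
  have h3 : B = (B * A⁻¹) * A := by group
  rw [h3, gramMatrix_mul, h2, mul_one, gramMatrix]

/-- Dividing `A` by a square root of its determinant does not change the transformation and puts the
matrix in `SU(2)`, whose elements are the matrices of unit quaternions. -/
theorem exists_quaternion_of_gramMatrix {A : GL (Fin 2) ℂ} (h : gramMatrix A = 1) :
    ∃ q, mobius A = stereoConj (rotIso q) := by
  have hd0 : A.1.det ≠ 0 := A.det_ne_zero
  obtain ⟨c, hc⟩ := IsAlgClosed.exists_pow_nat_eq A.1.det two_pos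
  have hc0 : c ≠ 0 := by
    rintro rfl
    rw [← hc] at hd0; simp at hd0
  set α := A 0 0 / c with hα
  set β := A 0 1 / c with hβ
  set γ := A 1 0 / c with hγ
  set δ := A 1 1 / c with hδ
  have eα : A 0 0 = c * α := (mul_div_cancel₀ _ hc0).symm
  have eβ : A 0 1 = c * β := (mul_div_cancel₀ _ hc0).symm
  have eγ : A 1 0 = c * γ := (mul_div_cancel₀ _ hc0).symm
  have eδ : A 1 1 = c * δ := (mul_div_cancel₀ _ hc0).symm
  have hdet : α * δ - β * γ = 1 := by
    have := hc
    rw [Matrix.det_fin_two] at this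
    change c ^ 2 = A 0 0 * A 1 1 - A 0 1 * A 1 0 at this
    rw [eα, eβ, eγ, eδ] at this
    apply mul_left_cancel₀ (pow_ne_zero 2 hc0)
    linear_combination -this
  have hn : ((‖A.1.det‖ : ℝ) : ℂ) = (starRingEnd ℂ) c * c := by
    rw [← hc, norm_pow, Complex.conj_mul']; push_cast; rfl
  have hcc : (starRingEnd ℂ) c * c ≠ 0 := mul_ne_zero ((map_ne_zero _).2 hc0) hc0
  have hgram : A.1.conjTranspose * A.1 =
      ((starRingEnd ℂ) c * c) • (1 : Matrix (Fin 2) (Fin 2) ℂ) := by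
    rw [← h, gramMatrix, smul_smul, ← hn, ← Complex.ofReal_mul, mul_inv_cancel₀, Complex.ofReal_one,
      one_smul]
    exact norm_ne_zero_iff.2 hd0
  have h00 : (starRingEnd ℂ) α * α + (starRingEnd ℂ) γ * γ = 1 := by
    have := congrFun (congrFun hgram 0) 0
    simp only [Matrix.mul_apply, Fin.sum_univ_two, Matrix.conjTranspose_apply, Matrix.smul_apply,
      Matrix.one_apply_eq, smul_eq_mul, mul_one, Complex.star_def] at this
    change (starRingEnd ℂ) (A 0 0) * A 0 0 + (starRingEnd ℂ) (A 1 0) * A 1 0 = _ at this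
    rw [eα, eγ, map_mul, map_mul] at this
    apply mul_left_cancel₀ hcc
    linear_combination this
  have h01 : (starRingEnd ℂ) α * β + (starRingEnd ℂ) γ * δ = 0 := by
    have := congrFun (congrFun hgram 0) 1
    simp only [Matrix.mul_apply, Fin.sum_univ_two, Matrix.conjTranspose_apply, Matrix.smul_apply,
      Complex.star_def, Matrix.one_apply_ne (zero_ne_one : (0 : Fin 2) ≠ 1), smul_zero] at this
    change (starRingEnd ℂ) (A 0 0) * A 0 1 + (starRingEnd ℂ) (A 1 0) * A 1 1 = _ at this
    rw [eα, eγ, eβ, eδ, map_mul, map_mul] at this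
    apply mul_left_cancel₀ hcc
    linear_combination this
  -- For a unitary matrix of determinant one, the adjugate and the conjugate transpose are both the
  -- inverse; comparing them gives this relation and the next.
  have hδα : δ = (starRingEnd ℂ) α := by
    linear_combination (-δ) * h00 + (starRingEnd ℂ) α * hdet + γ * h01
  have hβγ : β = -(starRingEnd ℂ) γ := by
    linear_combination (-β) * h00 + α * h01 - (starRingEnd ℂ) γ * hdet
  have hγβ : γ = -(starRingEnd ℂ) β := by rw [hβγ, map_neg, Complex.conj_conj, neg_neg]
  have hq : quat α.re β.im (-β.re) α.im ∈ unitary ℍ[ℝ] := by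
    rw [quat_mem_unitary]
    have := congrArg Complex.re hdet
    rw [hδα, hγβ] at this
    simp at this
    linear_combination this
  refine ⟨⟨_, hq⟩, ?_⟩
  rw [stereoConj_rotIso]
  have hentry : ∀ i j, A i j = c * quatGL ⟨_, hq⟩ i j := by
    intro i j
    rw [quatGL_apply]
    fin_cases i <;> fin_cases j
    · exact eα
    · change A 0 1 = c * ⟨- -β.re, β.im⟩
      rw [eβ, neg_neg]
    · change A 1 0 = c * ⟨-β.re, β.im⟩
      rw [eγ, hγβ]
      congr 1
      apply Complex.ext <;> simp
    · change A 1 1 = c * ⟨α.re, -α.im⟩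
      rw [eδ, hδα]
      congr 1
  ext1 x
  apply stereo.symm.injective
  apply Subtype.ext
  obtain ⟨a, b, -, -, h2⟩ := exists_homogeneous x
  change (invStereo (A • x)).1 = (invStereo (quatGL ⟨_, hq⟩ • x)).1
  rw [h2, h2]
  simp only [hentry]
  rw [← homPoint_smul hc0 (quatGL ⟨_, hq⟩ 0 0 * a + _)]
  congr 1 <;> ring

theorem gramMatrix_zero_zero (A : GL (Fin 2) ℂ) : ∃ r : ℝ, 0 < r ∧ gramMatrix A 0 0 = r := by
  have hd0 : A.1.det ≠ 0 := A.det_ne_zero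
  refine ⟨‖A.1.det‖⁻¹ * (Complex.normSq (A 0 0) + Complex.normSq (A 1 0)), ?_, ?_⟩
  · have h1 := Complex.normSq_nonneg (A 0 0)
    have h2 := Complex.normSq_nonneg (A 1 0)
    refine mul_pos (inv_pos.2 (norm_pos_iff.2 hd0)) (lt_of_le_of_ne (add_nonneg h1 h2) ?_)
    intro h
    have k1 : A 0 0 = 0 := Complex.normSq_eq_zero.1 (by linarith)
    have k2 : A 1 0 = 0 := Complex.normSq_eq_zero.1 (by linarith)
    apply hd0
    rw [Matrix.det_fin_two]
    change A 0 0 * A 1 1 - A 0 1 * A 1 0 = 0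
    rw [k1, k2]; ring
  · simp only [gramMatrix, Matrix.smul_apply, Matrix.mul_apply, Fin.sum_univ_two,
      Matrix.conjTranspose_apply, Complex.star_def, smul_eq_mul, ← Complex.normSq_eq_conj_mul_self]
    push_cast
    rfl

/-- A finite group of linear fractional transformations that contains the half-turns about two
coordinate axes consists of rotations. -/
theorem exists_quaternion_of_mem_finite {H : Subgroup (Equiv.Perm (OnePoint ℂ))}
    (hH : H ≤ linearFractionalGroup) (hfin : (H : Set (Equiv.Perm (OnePoint ℂ))).Finite)
    {j k : unitary ℍ[ℝ]} (hj : j.1 = quat 0 0 1 0) (hk : k.1 = quat 0 0 0 1)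
    (hjH : stereoConj (rotIso j) ∈ H) (hkH : stereoConj (rotIso k) ∈ H)
    {f : Equiv.Perm (OnePoint ℂ)} (hf : f ∈ H) : ∃ q, f = stereoConj (rotIso q) := by
  have : Finite H := hfin
  have : Fintype H := Fintype.ofFinite H
  choose A hA using fun f : H => mem_linearFractionalGroup.1 (hH f.2)
  set M := ∑ f, gramMatrix (A f) with hM
  -- Unitary trick: translation by an element of `H` permutes the summands of `M`.
  have hinv : ∀ U : GL (Fin 2) ℂ, mobius U ∈ H →
      ((‖U.1.det‖⁻¹ : ℝ) : ℂ) • (U.1.conjTranspose * M * U.1) = M := by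
    intro U hU
    rw [hM, Matrix.mul_sum, Matrix.sum_mul, Finset.smul_sum]
    simp only [← gramMatrix_mul]
    rw [← Equiv.sum_comp (Equiv.mulRight (⟨mobius U, hU⟩ : H)) (fun f => gramMatrix (A f))]
    refine Finset.sum_congr rfl fun f _ => gramMatrix_eq_of_mobius_eq ?_
    rw [map_mul, hA, hA]
    rfl
  have hquat : ∀ q : unitary ℍ[ℝ], stereoConj (rotIso q) ∈ H →
      (quatMatrix q.1).conjTranspose * M * quatMatrix q.1 = M := by
    intro q hq
    rw [stereoConj_rotIso] at hq
    have h := hinv _ hq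
    have e : (quatGL q).1 = quatMatrix q.1 := rfl
    rwa [e, det_quatMatrix, norm_one, inv_one, Complex.ofReal_one, one_smul] at h
  have mj := hquat j hjH
  have mk := hquat k hkH
  have ej : quatMatrix j.1 = !![0, -1; 1, 0] := by
    rw [hj]
    ext i j
    fin_cases i <;> fin_cases j <;> apply Complex.ext <;> simp [quatMatrix, quat]
  have ek : quatMatrix k.1 = !![Complex.I, 0; 0, -Complex.I] := by
    rw [hk]
    ext i j
    fin_cases i <;> fin_cases j <;> apply Complex.ext <;> simp [quatMatrix, quat]
  rw [ej] at mj
  rw [ek] at mk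
  -- Invariance under `k` kills the off-diagonal entries and invariance under `j` equalizes the
  -- diagonal ones, so `M` is scalar.
  have k01 := congrFun (congrFun mk 0) 1
  have k10 := congrFun (congrFun mk 1) 0
  have j00 := congrFun (congrFun mj 0) 0
  simp [Matrix.mul_apply, Fin.sum_univ_two] at k01 k10 j00
  have h01 : M 0 1 = 0 := by
    linear_combination (-1 / 2) * k01 + M 0 1 * (1 / 2) * Complex.I_mul_I
  have h10 : M 1 0 = 0 := by
    linear_combination (-1 / 2) * k10 + M 1 0 * (1 / 2) * Complex.I_mul_I
  have hM1 : M = M 0 0 • (1 : Matrix (Fin 2) (Fin 2) ℂ) := by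
    ext i j
    fin_cases i <;> fin_cases j <;> simp [h01, h10, j00]
  have hM0 : M 0 0 ≠ 0 := by
    choose r hr0 hr using fun f => gramMatrix_zero_zero (A f)
    rw [hM, Matrix.sum_apply]
    simp only [hr]
    rw [← Complex.ofReal_sum]
    have : 0 < ∑ f, r f := Finset.sum_pos (fun f _ => hr0 f) Finset.univ_nonempty
    exact_mod_cast this.ne'
  -- For a nonzero scalar `M`, invariance under `f` says that the Gram matrix of `f` is the
  -- identity.
  have hB := hinv (A ⟨f, hf⟩) (by rw [hA]; exact hf)
  rw [hM1, Matrix.mul_smul, Matrix.smul_mul, mul_one, smul_comm] at hB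
  have h1 : gramMatrix (A ⟨f, hf⟩) = 1 := smul_right_injective _ hM0 hB
  obtain ⟨q, hq⟩ := exists_quaternion_of_gramMatrix h1
  exact ⟨q, by rw [← hq, hA]⟩
/-! ### Maximality of the icosahedral group -/

/-- The cross product is at most the product of the two imaginary norms, so commutators of elements
near `±1` are closer still to 1. This drives the descent below. -/
theorem re_commutator (q p : unitary ℍ[ℝ]) :
    (q * p * q⁻¹ * p⁻¹).1.re = 1 - 2 * ‖E3.cross (imVec q.1) (imVec p.1)‖ ^ 2 := by
  have hq := sq_sum_unitary q
  have hp := sq_sum_unitary p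
  have e : (q * p * q⁻¹ * p⁻¹).1 = q.1 * p.1 * star q.1 * star p.1 := rfl
  rw [e, E3.norm_sq]
  simp only [Quaternion.re_mul, Quaternion.imI_mul, Quaternion.imJ_mul, Quaternion.imK_mul,
    Quaternion.re_star, Quaternion.imI_star, Quaternion.imJ_star, Quaternion.imK_star,
    E3.cross_zero, E3.cross_one, E3.cross_two, imVec_zero, imVec_one, imVec_two]
  linear_combination (p.1.re ^ 2 + p.1.imI ^ 2 + p.1.imJ ^ 2 + p.1.imK ^ 2) * hq + hp

theorem re_mul_inv (q p : unitary ℍ[ℝ]) :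
    (q * p⁻¹).1.re = q.1.re * p.1.re + inner ℝ (imVec q.1) (imVec p.1) := by
  have e : (q * p⁻¹).1 = q.1 * star p.1 := rfl
  rw [e, E3.inner_eq]
  simp only [Quaternion.re_mul, Quaternion.re_star, Quaternion.imI_star, Quaternion.imJ_star,
    Quaternion.imK_star, imVec_zero, imVec_one, imVec_two]
  ring

theorem re_sq_add_norm_sq (q : unitary ℍ[ℝ]) : q.1.re ^ 2 + ‖imVec q.1‖ ^ 2 = 1 := by
  have h := sq_sum_unitary q
  rw [E3.norm_sq, imVec_zero, imVec_one, imVec_two]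
  linear_combination h

theorem eq_one_of_imVec_eq_zero {q : unitary ℍ[ℝ]} (h : imVec q.1 = 0) (hr : 0 < q.1.re) :
    q = 1 := by
  have h1 := re_sq_add_norm_sq q
  rw [h, norm_zero] at h1
  have h2 : q.1.re = 1 := by nlinarith
  apply Subtype.ext
  apply Quaternion.ext
  · exact h2
  · exact congrArg (fun v : E3 => v 0) h
  · exact congrArg (fun v : E3 => v 1) h
  · exact congrArg (fun v : E3 => v 2) h

theorem E3.norm_sq_cross_le (u v : E3) : ‖E3.cross u v‖ ^ 2 ≤ ‖u‖ ^ 2 * ‖v‖ ^ 2 := by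
  simp only [E3.norm_sq, E3.cross_zero, E3.cross_one, E3.cross_two]
  nlinarith [sq_nonneg (u 0 * v 0 + u 1 * v 1 + u 2 * v 2)]

/-- With `x = 1 - r` the second claim amounts to `1 - 4x + 4x³ > 0`, true for positive `x` up to
about 0.2696. The threshold 0.7345 respects this and is low enough for the estimate in
`rotIso_mem_of_finite`. -/
theorem descent_inequality {r : ℝ} (h0 : 7345 / 10000 < r) (h1 : r < 1) :
    0 < 1 - 2 * (1 - r) ^ 2 ∧ r < (1 - 2 * (1 - r) ^ 2) ^ 2 := by
  obtain ⟨x, rfl⟩ : ∃ x, r = 1 - x := ⟨1 - r, by ring⟩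
  have hx0 : 0 < x := by linarith
  have hx1 : x < 2655 / 10000 := by linarith
  have e : 1 - (1 - x) = x := by ring
  rw [e]
  constructor
  · nlinarith
  -- For `x > 0` the cube `x³` lies above its tangent line at 0.26.
  · have h3 : 0 ≤ (x - 26 / 100) ^ 2 * (x + 52 / 100) := by positivity
    have h4 : 0 < 1 - 4 * x + 4 * x ^ 3 := by nlinarith
    nlinarith [mul_pos hx0 h4]

/-- In a finite group of rotations containing the icosahedral group no nontrivial element has a
small angle. -/
theorem imVec_eq_zero_of_large_re {Q : Subgroup (unitary ℍ[ℝ])}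
    (hfin : (Q : Set (unitary ℍ[ℝ])).Finite)
    (hG : ∀ q, ∀ hq : q ∈ icosianList, icosianUnit q hq ∈ Q) {q : unitary ℍ[ℝ]} (hq : q ∈ Q)
    (hre : 7345 / 10000 < q.1.re ^ 2) : imVec q.1 = 0 := by
  by_contra him
  set S : Set (unitary ℍ[ℝ]) := {q | q ∈ Q ∧ imVec q.1 ≠ 0 ∧ 7345 / 10000 < q.1.re ^ 2} with hS
  have hSfin : S.Finite := hfin.subset fun q hq => hq.1
  -- A nontrivial element of least angle; the real part is squared because `±q` give the same
  -- rotation.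
  obtain ⟨q₀, ⟨hq₀, him₀, hre₀⟩, hmax⟩ := Set.exists_max_image S (fun q => q.1.re ^ 2) hSfin
    ⟨q, hq, him, hre⟩
  set u := imVec q₀.1 with hu
  have hnorm := re_sq_add_norm_sq q₀
  have hupos : 0 < ‖u‖ ^ 2 := pow_pos (norm_pos_iff.2 him₀) 2
  have hr1 : q₀.1.re ^ 2 < 1 := by linarith
  obtain ⟨d1, d2⟩ := descent_inequality hre₀ hr1
  -- The commutator of `q₀` with its conjugate by `g` has a still larger real part, so it is 1 by
  -- maximality. Hence every `g` in `Q` preserves the axis of `q₀`.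
  have key : ∀ g ∈ Q, E3.cross u (rotIso g u) = 0 := by
    intro g hg
    set p := g * q₀ * g⁻¹ with hp
    have hpQ : p ∈ Q := mul_mem (mul_mem hg hq₀) (inv_mem hg)
    have hpim : imVec p.1 = rotIso g u := imVec_conj_unitary g q₀
    have hc := re_commutator q₀ p
    rw [hpim] at hc
    have hle := E3.norm_sq_cross_le u (rotIso g u)
    rw [LinearIsometryEquiv.norm_map] at hle
    set k := q₀ * p * q₀⁻¹ * p⁻¹ with hk
    have hkQ : k ∈ Q := mul_mem (mul_mem (mul_mem hq₀ hpQ) (inv_mem hq₀)) (inv_mem hpQ)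
    have hu2 : ‖u‖ ^ 2 = 1 - q₀.1.re ^ 2 := by linarith
    rw [hu2] at hle
    have hkre : 1 - 2 * (1 - q₀.1.re ^ 2) ^ 2 ≤ k.1.re := by rw [hc]; nlinarith
    have hkre2 : q₀.1.re ^ 2 < k.1.re ^ 2 :=
      d2.trans_le (pow_le_pow_left₀ d1.le hkre 2)
    have hkim : imVec k.1 = 0 := by
      by_contra hne
      exact absurd (hmax k ⟨hkQ, hne, hre₀.trans hkre2⟩) (not_le.2 hkre2)
    have hk1 := eq_one_of_imVec_eq_zero hkim (d1.trans_le hkre)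
    rw [hk1] at hc
    have h1 : (1 : unitary ℍ[ℝ]).1.re = 1 := rfl
    rw [h1] at hc
    exact norm_eq_zero.1 (pow_eq_zero_iff two_ne_zero |>.1 (by linarith))
  have hval : ∀ (a b c d : ZPhi) (h : ZQuat.mk a ⟨b, c, d⟩ ∈ icosianList),
      (rotIso (icosianUnit _ h) u) = rot (quat (a.toReal / 2) (b.toReal / 2) (c.toReal / 2)
        (d.toReal / 2)) u := fun _ _ _ _ _ => rfl
  -- The half-turns `i`, `j` make the products of two coordinates of `u` vanish. The unit `(1 + i +
  -- j + k)/2` permutes the coordinates cyclically and equates their squares with such products, so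
  -- `u = 0`.
  have ki := key _ (hG ⟨0, ⟨2, 0, 0⟩⟩ (by decide +kernel))
  have kj := key _ (hG ⟨0, ⟨0, 2, 0⟩⟩ (by decide +kernel))
  have kw := key _ (hG ⟨1, ⟨1, 1, 1⟩⟩ (by decide +kernel))
  rw [hval] at ki kj kw
  have i1 := congrArg (fun v : E3 => v 1) ki
  have i2 := congrArg (fun v : E3 => v 2) ki
  have j0 := congrArg (fun v : E3 => v 0) kj
  have w0 := congrArg (fun v : E3 => v 0) kw
  have w1 := congrArg (fun v : E3 => v 1) kw
  have w2 := congrArg (fun v : E3 => v 2) kw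
  simp only [E3.cross_zero, E3.cross_one, E3.cross_two, rot_apply_zero, rot_apply_one,
    rot_apply_two, quat_re, quat_imI, quat_imJ, quat_imK, toReal_zero, toReal_one, toReal_two,
    PiLp.zero_apply] at i1 i2 j0 w0 w1 w2
  apply him₀
  have hxz : u 0 * u 2 = 0 := by linarith
  have hxy : u 0 * u 1 = 0 := by linarith
  have hyz : u 1 * u 2 = 0 := by linarith
  apply E3.ext
  · exact pow_eq_zero_iff two_ne_zero |>.1 (by linarith : u 0 ^ 2 = 0)
  · exact pow_eq_zero_iff two_ne_zero |>.1 (by linarith : u 1 ^ 2 = 0)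
  · exact pow_eq_zero_iff two_ne_zero |>.1 (by linarith : u 2 ^ 2 = 0)

theorem goldenRatio_bounds : 1618 / 1000 < Real.goldenRatio ∧ Real.goldenRatio < 16181 / 10000 := by
  have h := Real.goldenRatio_sq
  have h1 := Real.goldenRatio_pos
  constructor <;> nlinarith

/-- If all three expressions were at most 2.13, each coordinate would be at most 1.32. This bounds
`x + y + z`, hence `xy + yz + zx`, from below, and the sum of the three squares would exceed `3 ·
2.13²`. The constant is not sharp; it is what the later estimate needs. -/
theorem covering_inequality {x y z t : ℝ} (hx : 0 ≤ x) (hy : 0 ≤ y) (hz : 0 ≤ z)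
    (ht : t ^ 2 = t + 1) (ht0 : 1618 / 1000 < t) (h : x ^ 2 + y ^ 2 + z ^ 2 = t + 2) :
    213 / 100 < x + t * z ∨ 213 / 100 < t * y + z ∨ 213 / 100 < t * x + y := by
  by_contra! hcon
  obtain ⟨hA, hB, hC⟩ := hcon
  have bx : x ≤ 132 / 100 := by nlinarith
  have bY : y ≤ 132 / 100 := by nlinarith
  have bz : z ≤ 132 / 100 := by nlinarith
  have hs : t + 2 ≤ 132 / 100 * (x + y + z) := by nlinarith
  have hs2 : 27 / 10 ≤ x + y + z := by linarith
  have he : 1 ≤ x * y + y * z + z * x := by nlinarith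
  have hA2 : (x + t * z) ^ 2 ≤ (213 / 100) ^ 2 := pow_le_pow_left₀ (by positivity) hA 2
  have hB2 : (t * y + z) ^ 2 ≤ (213 / 100) ^ 2 := pow_le_pow_left₀ (by positivity) hB 2
  have hC2 : (t * x + y) ^ 2 ≤ (213 / 100) ^ 2 := pow_le_pow_left₀ (by positivity) hC 2
  have hsum : (x + t * z) ^ 2 + (t * y + z) ^ 2 + (t * x + y) ^ 2 =
      (t + 2) * (t + 2) + 2 * t * (x * y + y * z + z * x) := by
    linear_combination (x ^ 2 + y ^ 2 + z ^ 2) * ht + (t + 2) * h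
  nlinarith

theorem mem_faceList_of_signs : ∀ v ∈ signs ⟨1, 0, phi⟩ ++ signs ⟨0, phi, 1⟩ ++ signs ⟨phi, 1, 0⟩,
    v ∈ faceList := by decide +kernel

theorem exists_signs_inner (a b c : ZPhi) (v : E3) : ∃ f ∈ signs ⟨a, b, c⟩,
    inner ℝ f.toE v = a.toReal * |v 0| + b.toReal * |v 1| + c.toReal * |v 2| := by
  have key : ∀ (t : ℝ) (z : ZPhi), z.toReal * t = z.toReal * |t| ∨
      (-z).toReal * t = z.toReal * |t| := by
    intro t z
    rcases abs_choice t with h' | h' <;> rw [h']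
    · exact Or.inl rfl
    · right; rw [toReal_neg]; ring
  rcases key (v 0) a with h0 | h0 <;> rcases key (v 1) b with h1 | h1 <;>
  rcases key (v 2) c with h2 | h2 <;> rw [← h0, ← h1, ← h2]
  all_goals exact ⟨⟨_, _, _⟩, by simp [signs], E3.inner_eq _ _⟩

/-- Every direction is close to the centre of a face. -/
theorem exists_close_face (v : E3) (hv : ‖v‖ ^ 2 = Real.goldenRatio + 2) :
    ∃ f ∈ faceList, 213 / 100 < inner ℝ f.toE v := by
  rw [E3.norm_sq, ← sq_abs (v 0), ← sq_abs (v 1), ← sq_abs (v 2)] at hv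
  rcases covering_inequality (abs_nonneg _) (abs_nonneg _) (abs_nonneg _) Real.goldenRatio_sq
    goldenRatio_bounds.1 hv with h | h | h
  · obtain ⟨f, hf, hfv⟩ := exists_signs_inner 1 0 phi v
    refine ⟨f, mem_faceList_of_signs f (by simp [hf]), ?_⟩
    rw [hfv, toReal_one, toReal_zero, toReal_phi]
    linarith
  · obtain ⟨f, hf, hfv⟩ := exists_signs_inner 0 phi 1 v
    refine ⟨f, mem_faceList_of_signs f (by simp [hf]), ?_⟩
    rw [hfv, toReal_one, toReal_zero, toReal_phi]
    linarith
  · obtain ⟨f, hf, hfv⟩ := exists_signs_inner phi 1 0 v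
    refine ⟨f, mem_faceList_of_signs f (by simp [hf]), ?_⟩
    rw [hfv, toReal_one, toReal_zero, toReal_phi]
    linarith

theorem faceIcosian_mem : ∀ f ∈ faceList, ZQuat.mk phi (scale psi f) ∈ icosianList := by
  decide +kernel

/-- A finite group of unit quaternions containing the icosian units acts through the rotation
group of the dodecahedron. -/
theorem rotIso_mem_of_finite {Q : Subgroup (unitary ℍ[ℝ])}
    (hfin : (Q : Set (unitary ℍ[ℝ])).Finite)
    (hG : ∀ q, ∀ hq : q ∈ icosianList, icosianUnit q hq ∈ Q) {h : unitary ℍ[ℝ]} (hh : h ∈ Q) :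
    rotIso h ∈ rotationGroup stdDodecahedron := by
  have hψ : psi.toReal ≠ 0 := by
    rw [toReal_psi_eq]; linarith [Real.one_lt_goldenRatio]
  have hre : ∀ f, ∀ hf : f ∈ faceList,
      (icosianUnit _ (faceIcosian_mem f hf)).1.re = Real.goldenRatio / 2 := by
    intro f hf
    change phi.toReal / 2 = _
    rw [toReal_phi]
  have him : ∀ f, ∀ hf : f ∈ faceList,
      imVec (icosianUnit _ (faceIcosian_mem f hf)).1 = (psi.toReal / 2) • f.toE := by
    intro f hf
    change imVec (ZQuat.toQuat _) = _
    rw [ZQuat.imVec_toQuat, toE_scale, smul_smul]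
    congr 1; ring
  have key : ∀ f ∈ faceList, ∃ f' ∈ faceList, rotIso h f.toE = f'.toE := by
    intro f hf
    have hnorm : ‖rotIso h f.toE‖ ^ 2 = Real.goldenRatio + 2 := by
      have : ∀ f ∈ faceList, dot f f = phi + 2 := by decide +kernel
      rw [LinearIsometryEquiv.norm_map, ← real_inner_self_eq_norm_sq, inner_toE, this f hf,
        toReal_add, toReal_phi, toReal_two]
    obtain ⟨f', hf', hclose⟩ := exists_close_face _ hnorm
    refine ⟨f', hf', ?_⟩
    -- `p` and `p'` are the turns by 72° about `f` and `f'`, with real part `φ/2 = cos 36°`.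
    set p := icosianUnit _ (faceIcosian_mem f hf) with hp
    set p' := icosianUnit _ (faceIcosian_mem f' hf') with hp'
    have hpr : p.1.re = Real.goldenRatio / 2 := hre f hf
    have hpr' : p'.1.re = Real.goldenRatio / 2 := hre f' hf'
    have hpi : imVec p.1 = (psi.toReal / 2) • f.toE := him f hf
    have hpi' : imVec p'.1 = (psi.toReal / 2) • f'.toE := him f' hf'
    have hpQ : p ∈ Q := hG _ _
    have hpQ' : p' ∈ Q := hG _ _
    have hr := re_mul_inv (h * p * h⁻¹) p'
    rw [re_conj_unitary, imVec_conj_unitary, hpr, hpr', hpi, hpi', map_smul, inner_smul_left,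
      inner_smul_right, real_inner_comm, toReal_psi_eq] at hr
    have hb := goldenRatio_bounds
    have hφ := Real.goldenRatio_sq
    simp only [conj_trivial] at hr
    -- The value exceeds `(φ + 1)/4 + 2.13 (2 - φ)/4`, about 0.858, and `0.8575²` is above the
    -- threshold 0.7345.
    have hlarge : 8575 / 10000 < (h * p * h⁻¹ * p'⁻¹).1.re := by
      rw [hr]
      have e : Real.goldenRatio / 2 * (Real.goldenRatio / 2) +
          (Real.goldenRatio - 1) / 2 * ((Real.goldenRatio - 1) / 2 *
            inner ℝ f'.toE (rotIso h f.toE)) = (Real.goldenRatio + 1) / 4 +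
            (2 - Real.goldenRatio) / 4 * inner ℝ f'.toE (rotIso h f.toE) := by
        linear_combination (1 / 4 + inner ℝ f'.toE (rotIso h f.toE) / 4) * hφ
      rw [e]
      nlinarith
    have him0 := imVec_eq_zero_of_large_re hfin hG
      (mul_mem (mul_mem (mul_mem hh hpQ) (inv_mem hh)) (inv_mem hpQ')) (by nlinarith)
    have h1 := eq_one_of_imVec_eq_zero him0 (by linarith)
    have h2 : h * p * h⁻¹ = p' := mul_inv_eq_one.1 h1
    have h3 := imVec_conj_unitary h p
    rw [h2, hpi, hpi', map_smul] at h3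
    exact (smul_right_injective _ (div_ne_zero hψ two_ne_zero) h3).symm
  -- Adjacent normals go to adjacent normals, and some icosian has the same effect on this pair.
  obtain ⟨v, hv, h0⟩ := key face₀ (by decide +kernel)
  obtain ⟨w, hw, h1⟩ := key face₁ (by decide +kernel)
  have hd : dot v w = dot face₀ face₁ := by
    apply toReal_injective
    rw [← inner_toE, ← inner_toE, ← h0, ← h1, LinearIsometryEquiv.inner_map_map]
  obtain ⟨q, hq, hqv, hqw⟩ := icosian_face_pair v hv w hw (hd.trans (by decide +kernel))
  rw [eq_icosian_of_pair (det_rotIso h) hq (by decide +kernel) h0 h1 hqv hqw]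
  exact rotIso_icosianUnit_mem q hq
/-! ### Stabilizers of sets invariant under the icosahedral group -/

theorem eq_one_or_eq_neg_one_of_rotIso_eq_one {q : unitary ℍ[ℝ]} (h : rotIso q = 1) :
    q.1 = 1 ∨ q.1 = -1 := by
  have key : ∀ v, E3.cross (imVec q.1) v = 0 := fun v => cross_imVec_of_rot_eq (by rw [h]; rfl)
  have h1 := congrArg (fun v : E3 => v 1) (key (vec3 1 0 0))
  have h2 := congrArg (fun v : E3 => v 2) (key (vec3 1 0 0))
  have h3 := congrArg (fun v : E3 => v 2) (key (vec3 0 1 0))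
  simp only [E3.cross_one, E3.cross_two, vec3_zero, vec3_one, vec3_two, imVec_zero, imVec_one,
    imVec_two, PiLp.zero_apply] at h1 h2 h3
  have hi : q.1.imI = 0 := by linarith
  have hj : q.1.imJ = 0 := by linarith
  have hk : q.1.imK = 0 := by linarith
  have hs := sq_sum_unitary q
  rw [hi, hj, hk] at hs
  have hr : q.1.re ^ 2 = 1 := by linarith
  rcases sq_eq_sq_iff_eq_or_eq_neg.1 (hr.trans (one_pow 2).symm) with hr | hr
  · left
    apply Quaternion.ext <;> simp [hr, hi, hj, hk]
  · right
    apply Quaternion.ext <;> simp [hr, hi, hj, hk]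

theorem finite_fiber_rotIso (g : E3 ≃ₗᵢ[ℝ] E3) : (rotIso ⁻¹' {g}).Finite := by
  rcases (rotIso ⁻¹' {g}).eq_empty_or_nonempty with h | ⟨q₀, hq₀⟩
  · rw [h]; exact Set.finite_empty
  · have hfin : (Subtype.val ⁻¹' {1, -1} : Set (unitary ℍ[ℝ])).Finite :=
      (Set.toFinite _).preimage Subtype.val_injective.injOn
    refine (hfin.image fun q => q₀ * q).subset fun q hq => ⟨q₀⁻¹ * q, ?_, by simp⟩
    exact eq_one_or_eq_neg_one_of_rotIso_eq_one (by
      rw [map_mul, map_inv, (hq : rotIso q = g), (hq₀ : rotIso q₀ = g), inv_mul_cancel])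

theorem mem_setStabilizer_iff {α : Set S2} {f : Equiv.Perm (OnePoint ℂ)} :
    f ∈ setStabilizer α ↔ f ∈ linearFractionalGroup ∧ f '' (stereo '' α) = stereo '' α := Iff.rfl

theorem stereoConj_image (g : E3 ≃ₗᵢ[ℝ] E3) (α : Set S2) :
    stereoConj g '' (stereo '' α) = stereo '' (onSphere g '' α) := by
  simp only [Set.image_image, stereoConj_apply, Equiv.symm_apply_apply]

theorem stereoConj_mem_setStabilizer {g : E3 ≃ₗᵢ[ℝ] E3} {α : Set S2}
    (hg : LinearMap.det (g.toLinearEquiv : E3 →ₗ[ℝ] E3) = 1) :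
    stereoConj g ∈ setStabilizer α ↔ onSphere g '' α = α := by
  rw [mem_setStabilizer_iff, stereoConj_image, stereo.injective.image_injective.eq_iff]
  exact and_iff_right (stereoConj_mem_linearFractionalGroup hg)

/-- Averaging makes the stabilizer a group of rotations; maximality then applies to its preimage in
the unit quaternions, which is finite because quaternions cover rotations with finite fibres. -/
theorem setStabilizer_eq_std {α : Set S2} (hα : α.Finite) (h4 : 4 ≤ α.ncard)
    (hG : ∀ g ∈ rotationGroup stdDodecahedron, onSphere g '' α = α) :
    setStabilizer α = rotationGroupOnRiemannSphere stdDodecahedron := by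
  have hmem : ∀ g ∈ rotationGroup stdDodecahedron, stereoConj g ∈ setStabilizer α :=
    fun g hg => (stereoConj_mem_setStabilizer hg.1).2 (hG g hg)
  have hfin := finite_setStabilizer hα h4
  apply le_antisymm
  · intro f hf
    have hj : ZQuat.mk 0 ⟨0, 2, 0⟩ ∈ icosianList := by decide +kernel
    have hk : ZQuat.mk 0 ⟨0, 0, 2⟩ ∈ icosianList := by decide +kernel
    obtain ⟨q, rfl⟩ := exists_quaternion_of_mem_finite (inf_le_left : setStabilizer α ≤ _) hfin
      (j := icosianUnit _ hj) (k := icosianUnit _ hk)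
      (by change quat _ _ _ _ = _; simp only [toReal_zero, toReal_two]; norm_num)
      (by change quat _ _ _ _ = _; simp only [toReal_zero, toReal_two]; norm_num)
      (hmem _ (rotIso_icosianUnit_mem _ hj)) (hmem _ (rotIso_icosianUnit_mem _ hk)) hf
    refine ⟨rotIso q, rotIso_mem_of_finite
      (Q := (setStabilizer α).comap (stereoConj.comp rotIso)) ?_
      (fun p hp => hmem _ (rotIso_icosianUnit_mem p hp)) hf, rfl⟩
    exact (hfin.preimage stereoConj_injective.injOn).preimage' fun g _ => finite_fiber_rotIso g
  · rintro _ ⟨g, hg, rfl⟩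
    exact hmem g hg

/-! ### Transfer to an arbitrary regular dodecahedron -/

theorem det_conj_linearIsometryEquiv (g L : E3 ≃ₗᵢ[ℝ] E3) :
    LinearMap.det ((L⁻¹ * g * L).toLinearEquiv : E3 →ₗ[ℝ] E3) =
      LinearMap.det (g.toLinearEquiv : E3 →ₗ[ℝ] E3) :=
  LinearMap.det_conj (g.toLinearEquiv : E3 →ₗ[ℝ] E3) L.symm.toLinearEquiv

theorem mem_rotationGroup_similarity {P : Set E3} {r : ℝ} (hr : r ≠ 0) {L g : E3 ≃ₗᵢ[ℝ] E3} :
    g ∈ rotationGroup (similarity r hr L '' P) ↔ L⁻¹ * g * L ∈ rotationGroup P := by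
  have himg : g '' (similarity r hr L '' P) = similarity r hr L '' ((L⁻¹ * g * L) '' P) := by
    rw [Set.image_image, Set.image_image]
    refine Set.image_congr fun x _ => ?_
    rw [similarity_apply, similarity_apply, map_smul]
    exact congrArg (r • ·) (L.apply_symm_apply (g (L x))).symm
  change (_ ∧ _) ↔ (_ ∧ _)
  rw [det_conj_linearIsometryEquiv, himg,
    (similarity r hr L).injective.image_injective.eq_iff]

theorem rotationGroup_similarity {P : Set E3} {r : ℝ} (hr : r ≠ 0) (L : E3 ≃ₗᵢ[ℝ] E3) :
    rotationGroup (similarity r hr L '' P) =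
      (rotationGroup P).map (MulAut.conj L).toMonoidHom := by
  ext g
  rw [mem_rotationGroup_similarity, Subgroup.mem_map_equiv]
  rfl

theorem rotationOrbit_similarity {P : Set E3} {r : ℝ} (hr : r ≠ 0) (L : E3 ≃ₗᵢ[ℝ] E3) (X : S2) :
    rotationOrbit (similarity r hr L '' P) (onSphere L X) = onSphere L '' rotationOrbit P X := by
  ext Y
  constructor
  · rintro ⟨g, hg, rfl⟩
    refine ⟨_, ⟨_, (mem_rotationGroup_similarity hr).1 hg, rfl⟩, ?_⟩
    exact (onSphere L).apply_symm_apply (onSphere g (onSphere L X))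
  · rintro ⟨_, ⟨g, hg, rfl⟩, rfl⟩
    refine ⟨L * g * L⁻¹, (mem_rotationGroup_similarity hr).2 ?_, ?_⟩
    · simpa [mul_assoc] using hg
    · exact congrArg (fun Y => onSphere L (onSphere g Y)) ((onSphere L).symm_apply_apply X)

theorem image_conj_eq_iff {X : Type*} (c f : Equiv.Perm X) (S : Set X) :
    (c⁻¹ * f * c) '' S = S ↔ f '' (c '' S) = c '' S := by
  have h : (c⁻¹ * f * c) '' S = (c⁻¹ : Equiv.Perm X) '' (f '' (c '' S)) := by
    simp only [Set.image_image]; rfl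
  rw [h, ← c.injective.image_injective.eq_iff, Equiv.Perm.inv_def, Equiv.image_symm_image]

/-- Determinant one makes `stereoConj L` linear fractional, so conjugation by it preserves the
linear fractional group. -/
theorem setStabilizer_onSphere_image {α : Set S2} {L : E3 ≃ₗᵢ[ℝ] E3}
    (hL : LinearMap.det (L.toLinearEquiv : E3 →ₗ[ℝ] E3) = 1) :
    setStabilizer (onSphere L '' α) =
      (setStabilizer α).map (MulAut.conj (stereoConj L)).toMonoidHom := by
  have hc := stereoConj_mem_linearFractionalGroup hL
  ext f
  have e : (MulAut.conj (stereoConj L)).symm f = (stereoConj L)⁻¹ * f * stereoConj L := rfl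
  rw [Subgroup.mem_map_equiv, mem_setStabilizer_iff, mem_setStabilizer_iff, e, ← stereoConj_image,
    Subgroup.mul_mem_cancel_right _ hc, Subgroup.mul_mem_cancel_left _ (inv_mem hc)]
  exact and_congr_right fun _ => (image_conj_eq_iff _ _ _).symm

theorem rotationGroupOnRiemannSphere_similarity {P : Set E3} {r : ℝ} (hr : r ≠ 0)
    (L : E3 ≃ₗᵢ[ℝ] E3) :
    rotationGroupOnRiemannSphere (similarity r hr L '' P) =
      (rotationGroupOnRiemannSphere P).map (MulAut.conj (stereoConj L)).toMonoidHom := by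
  change (rotationGroup _).map stereoConj = ((rotationGroup P).map stereoConj).map _
  rw [rotationGroup_similarity, Subgroup.map_map, Subgroup.map_map]
  congr 1
  ext1 g
  simp

theorem neg_image_stdDodecahedron :
    LinearIsometryEquiv.neg ℝ '' stdDodecahedron = stdDodecahedron := by
  refine (image_stdDodecahedron_eq_iff _).2 ?_
  have h : ∀ x ∈ stdDodecahedronVertices, LinearIsometryEquiv.neg ℝ x ∈ stdDodecahedronVertices := by
    intro x hx
    simpa [stdDodecahedronVertices] using hx
  exact subset_antisymm (Set.image_subset_iff.2 h) fun x hx => ⟨_, h x hx, neg_neg x⟩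

theorem det_eq_one_or_neg_one (L : E3 ≃ₗᵢ[ℝ] E3) :
    LinearMap.det (L.toLinearEquiv : E3 →ₗ[ℝ] E3) = 1 ∨
      LinearMap.det (L.toLinearEquiv : E3 →ₗ[ℝ] E3) = -1 := by
  have h := LinearIsometry.normDet_eq_one L.toLinearIsometry
  rw [LinearMap.normDet_eq_abs_det] at h
  exact eq_or_eq_neg_of_abs_eq h

/-- The definition admits orientation-reversing `L`. Composing with -1, which preserves the standard
solid and has determinant -1 in dimension three, yields a rotation. -/
theorem IsRegularDodecahedron.exists_similarity {P : Set E3} (hP : IsRegularDodecahedron P) :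
    ∃ (r : ℝ) (hr : 0 < r) (L : E3 ≃ₗᵢ[ℝ] E3),
      LinearMap.det (L.toLinearEquiv : E3 →ₗ[ℝ] E3) = 1 ∧
      P = similarity r hr.ne' L '' stdDodecahedron := by
  obtain ⟨r, L, hr, rfl⟩ := hP
  rcases det_eq_one_or_neg_one L with h | h
  · exact ⟨r, hr, L, h, rfl⟩
  · refine ⟨r, hr, L * LinearIsometryEquiv.neg ℝ, ?_, ?_⟩
    · have e : ((L * LinearIsometryEquiv.neg ℝ).toLinearEquiv : E3 →ₗ[ℝ] E3) =
          (-1 : ℝ) • (L.toLinearEquiv : E3 →ₗ[ℝ] E3) := by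
        ext1 x
        change L (-x) = (-1 : ℝ) • L x
        simp
      rw [e, LinearMap.det_smul, h, finrank_euclideanSpace_fin]
      norm_num
    · change _ '' stdDodecahedron = _
      conv_lhs => rw [← neg_image_stdDodecahedron]
      rw [Set.image_image]
      rfl

/-! ### Invariant sets as unions of orbits, and the theorem -/

theorem rotationOrbit_eq_of_mem {P : Set E3} {X Y : S2} (hY : Y ∈ rotationOrbit P X) :
    rotationOrbit P Y = rotationOrbit P X := by
  obtain ⟨h, hh, rfl⟩ := hY
  ext Z
  constructor
  · rintro ⟨g, hg, rfl⟩
    exact onSphere_mem_rotationOrbit hg ⟨h, hh, rfl⟩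
  · rintro ⟨g, hg, rfl⟩
    exact ⟨g * h⁻¹, mul_mem hg (inv_mem hh), by simp [map_mul, map_inv]⟩

theorem isUnion_orbits_iff {P : Set E3} {V F E α : Set S2} (hV : ∃ X, V = rotationOrbit P X)
    (hF : ∃ X, F = rotationOrbit P X) (hE : ∃ X, E = rotationOrbit P X) :
    (∃ C : Set (Set S2), C ⊆ {V, F, E} ∪ {B | ∃ X, X ∉ V ∪ F ∪ E ∧ B = rotationOrbit P X} ∧
      α = ⋃₀ C) ↔ ∀ g ∈ rotationGroup P, onSphere g '' α = α := by
  have self_mem : ∀ X, X ∈ rotationOrbit P X := fun X => ⟨1, one_mem _, rfl⟩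
  constructor
  · rintro ⟨C, hC, rfl⟩ g hg
    have horb : ∀ c ∈ C, ∃ X, c = rotationOrbit P X := by
      intro c hc
      rcases hC hc with (rfl | rfl | rfl) | ⟨X, -, h⟩
      exacts [hV, hF, hE, ⟨X, h⟩]
    have key : ∀ g ∈ rotationGroup P, ∀ Y ∈ ⋃₀ C, onSphere g Y ∈ ⋃₀ C := by
      rintro g hg Y ⟨c, hc, hY⟩
      obtain ⟨X, rfl⟩ := horb c hc
      exact ⟨_, hc, onSphere_mem_rotationOrbit hg hY⟩
    exact subset_antisymm (Set.image_subset_iff.2 (key g hg)) fun Y hY =>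
      ⟨_, key _ (inv_mem hg) Y hY, (onSphere g).apply_symm_apply Y⟩
  · intro hα
    -- An invariant set is the union of the orbits of its points; a point of `V`, `F` or `E` has
    -- that set as its orbit.
    refine ⟨rotationOrbit P '' α, ?_, ?_⟩
    · rintro _ ⟨X, -, rfl⟩
      by_cases hX : X ∈ V ∪ F ∪ E
      · left
        obtain ⟨A, rfl⟩ := hV
        obtain ⟨B, rfl⟩ := hF
        obtain ⟨D, rfl⟩ := hE
        rcases hX with (h | h) | h <;> rw [rotationOrbit_eq_of_mem h] <;> simp
      · exact Or.inr ⟨X, hX, rfl⟩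
    · ext Y
      constructor
      · exact fun hY => ⟨_, ⟨Y, hY, rfl⟩, self_mem Y⟩
      · rintro ⟨_, ⟨X, hX, rfl⟩, g, hg, rfl⟩
        rw [← hα g hg]
        exact ⟨X, hX, rfl⟩

theorem nonempty_rotationGroup_std :
    Nonempty (rotationGroup stdDodecahedron ≃* alternatingGroup (Fin 5)) :=
  nonempty_mulEquiv_alternatingGroup card_rotationGroup_std axisStabilizer index_axisStabilizer
    normalCore_axisStabilizer

/-- A nonempty invariant set contains a whole orbit, hence at least twelve points, which is more
than the four needed for a finite stabilizer. -/
theorem setStabilizer_eq_iff_std {α : Set S2} (hα : α.Finite) (hne : α.Nonempty) :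
    setStabilizer α = rotationGroupOnRiemannSphere stdDodecahedron ↔
      ∀ g ∈ rotationGroup stdDodecahedron, onSphere g '' α = α := by
  constructor
  · intro h g hg
    rw [← stereoConj_mem_setStabilizer hg.1, h]
    exact ⟨g, hg, rfl⟩
  · intro h
    refine setStabilizer_eq_std hα ?_ h
    obtain ⟨X, hX⟩ := hne
    have hsub : rotationOrbit stdDodecahedron X ⊆ α := by
      rintro _ ⟨g, hg, rfl⟩
      rw [← h g hg]
      exact ⟨X, hX, rfl⟩
    refine le_trans ?_ (Set.ncard_le_ncard hsub hα)
    obtain ⟨nV, nF, nE⟩ := ncard_radialSet_lists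
    by_cases hX' : X ∈ radialSet vertexList ∪ radialSet faceList ∪ radialSet edgeList
    · obtain ⟨A, hA⟩ := exists_vertexBase
      obtain ⟨B, hB⟩ := exists_faceBase
      obtain ⟨D, hD⟩ := exists_edgeBase
      rw [← rotationOrbit_vertexBase hA] at nV hX'
      rw [← rotationOrbit_faceBase hB] at nF hX'
      rw [← rotationOrbit_edgeBase hD] at nE hX'
      rcases hX' with (h | h) | h <;> rw [rotationOrbit_eq_of_mem h] <;> omega
    · rw [ncard_rotationOrbit_of_free fun g hg => eq_one_of_fixed hX' hg]
      norm_num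

theorem mainTheorem5 (P : Set E3) (hP : IsRegularDodecahedron P) :
    -- the rotation group `G` of `P`, also as a group of transformations of the Riemann sphere
    Nonempty (rotationGroup P ≃* alternatingGroup (Fin 5)) ∧
    Nonempty (rotationGroupOnRiemannSphere P ≃* alternatingGroup (Fin 5)) ∧
    -- the orbits of `G`
    (∃ X, vertexPoints P = rotationOrbit P X) ∧ (vertexPoints P).ncard = 20 ∧
    (∃ X, facePoints P = rotationOrbit P X) ∧ (facePoints P).ncard = 12 ∧
    (∃ X, edgePoints P = rotationOrbit P X) ∧ (edgePoints P).ncard = 30 ∧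
    (∀ X, X ∉ vertexPoints P ∪ facePoints P ∪ edgePoints P →
      (∀ g ∈ rotationGroup P, onSphere g X = X → g = 1) ∧ (rotationOrbit P X).ncard = 60) ∧
    -- the finite sets whose stabilizer is `G`
    ∀ α : Set S2, α.Finite → α.Nonempty →
      (setStabilizer α = rotationGroupOnRiemannSphere P ↔
        ∃ C : Set (Set S2),
          C ⊆ {vertexPoints P, facePoints P, edgePoints P} ∪
            {B | ∃ X, X ∉ vertexPoints P ∪ facePoints P ∪ edgePoints P ∧
              B = rotationOrbit P X} ∧
          α = ⋃₀ C) := by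
  obtain ⟨r, hr, L, hL, rfl⟩ := hP.exists_similarity
  obtain ⟨e⟩ := nonempty_rotationGroup_std
  obtain ⟨eV, eF, eE⟩ := points_similarity (P := stdDodecahedron) hr L
  obtain ⟨nV, nF, nE⟩ := ncard_radialSet_lists
  rw [vertexPoints_std] at eV
  rw [facePoints_std] at eF
  rw [edgePoints_std] at eE
  have hinj := (onSphere L).injective
  have e' : rotationGroup (similarity r hr.ne' L '' stdDodecahedron) ≃*
      alternatingGroup (Fin 5) :=
    (MulEquiv.subgroupCongr (rotationGroup_similarity hr.ne' L)).trans
      (((MulAut.conj L).subgroupMap (rotationGroup stdDodecahedron)).symm.trans e)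
  have orbV : ∃ X, vertexPoints (similarity r hr.ne' L '' stdDodecahedron) =
      rotationOrbit (similarity r hr.ne' L '' stdDodecahedron) X := by
    obtain ⟨B, hB⟩ := exists_vertexBase
    exact ⟨onSphere L B, by rw [eV, rotationOrbit_similarity, rotationOrbit_vertexBase hB]⟩
  have orbF : ∃ X, facePoints (similarity r hr.ne' L '' stdDodecahedron) =
      rotationOrbit (similarity r hr.ne' L '' stdDodecahedron) X := by
    obtain ⟨B, hB⟩ := exists_faceBase
    exact ⟨onSphere L B, by rw [eF, rotationOrbit_similarity, rotationOrbit_faceBase hB]⟩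
  have orbE : ∃ X, edgePoints (similarity r hr.ne' L '' stdDodecahedron) =
      rotationOrbit (similarity r hr.ne' L '' stdDodecahedron) X := by
    obtain ⟨B, hB⟩ := exists_edgeBase
    exact ⟨onSphere L B, by rw [eE, rotationOrbit_similarity, rotationOrbit_edgeBase hB]⟩
  refine ⟨⟨e'⟩, ⟨((rotationGroup _).equivMapOfInjective stereoConj stereoConj_injective).symm.trans
    e'⟩, orbV, ?_, orbF, ?_, orbE, ?_, ?_, ?_⟩
  · rw [eV, Set.ncard_image_of_injective _ hinj, nV]
  · rw [eF, Set.ncard_image_of_injective _ hinj, nF]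
  · rw [eE, Set.ncard_image_of_injective _ hinj, nE]
  · intro Y hY
    obtain ⟨X, rfl⟩ := (onSphere L).surjective Y
    rw [eV, eF, eE, ← Set.image_union, ← Set.image_union, hinj.mem_set_image] at hY
    have hfree := fun g hg => eq_one_of_fixed hY (g := g) hg
    constructor
    · intro g hg hgX
      have h1 := hfree _ ((mem_rotationGroup_similarity hr.ne').1 hg) 
        ((congrArg (onSphere L).symm hgX).trans ((onSphere L).symm_apply_apply X))
      rw [mul_assoc, inv_mul_eq_one] at h1
      exact (mul_eq_right.1 h1.symm)
    · rw [rotationOrbit_similarity, Set.ncard_image_of_injective _ hinj]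
      exact ncard_rotationOrbit_of_free hfree
  · intro α hα hne
    rw [isUnion_orbits_iff orbV orbF orbE]
    -- Write `α` as the image under `L` of its preimage; both groups are then conjugates by
    -- `stereoConj L` of those for the standard solid.
    obtain ⟨β, rfl⟩ : ∃ β, α = onSphere L '' β :=
      ⟨onSphere L ⁻¹' α, ((onSphere L).image_preimage α).symm⟩
    rw [setStabilizer_onSphere_image hL, rotationGroupOnRiemannSphere_similarity,
      (Subgroup.map_injective (MulAut.conj (stereoConj L)).injective).eq_iff,
      setStabilizer_eq_iff_std (hα.of_finite_image hinj.injOn) (Set.image_nonempty.1 hne),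
      rotationGroup_similarity]
    simp only [Subgroup.mem_map, forall_exists_index, and_imp, forall_apply_eq_imp_iff₂]
    refine forall₂_congr fun g _ => ?_
    rw [← hinj.image_injective.eq_iff]
    simp only [← Set.image_comp, ← Equiv.Perm.coe_mul, ← map_mul]
    simp
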